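/- Let $\Omega$ be a countable (finite or infinite) set with at least three elements, let $T$ be a tree, and let $c$ be a colouring of the edges of $T$ by $\Omega$ that restricts, for every vertex $v$, to a bijection $c_v$ from the set of edges around $v$ onto $\Omega$. For $g\in\mathrm{Aut}(T)$ and a vertex $v$ put $\sigma(g,v)=c_{gv}\circ g_v\circ c_v^{-1}\in\mathrm{Sym}(\Omega)$, where $g_v$ is the bijection induced by $g$ from the edges around $v$ to the edges around $gv$. For $F\le F'\le\mathrm{Sym}(\Omega)$ let $G(F,F')$ be the group of all $g\in\mathrm{Aut}(T)$ with $\sigma(g,v)\in F'$ for every $v$ and $\sigma(g,v)\in F$ for all but finitely many $v$, and let $G(F,F')^\ast$ be its subgroup preserving the two classes of the bipartition of the vertices of $T$. Endow $T\sqcup\partial T$ (vertices and ends) with the coarsest topology for which every half-tree, together with the ends it defines, is open; $\partial T$ has the induced topology, and $X_T\subset T\sqcup\partial T$ is the complement of the set of vertices of finite degree. For a group $G$, let $\mathrm{Sub}(G)\subset\{0,1\}^G$ carry the topology induced by the product topology. A URS of $G$ is a non-empty closed conjugation-invariant subset of $\mathrm{Sub}(G)$ that is minimal for these properties. If $G$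 acts on a topological space $X$, then $\mathcal S_G(X)$ is the closure in $\mathrm{Sub}(G)$ of the set of stabilizers $G_x$, where $x$ ranges over the continuity points of the map $x\mapsto G_x$, and $G_x^0$ is the subgroup of the elements of $G$ fixing pointwise a neighbourhood of $x$ in $X$. A URS is amenable if all its elements are amenable groups. For $\mathcal H,\mathcal K\subset\mathrm{Sub}(G)$ write $\mathcal H\preccurlyeq\mathcal K$ if some $H\in\mathcal H$ is contained in some $K\in\mathcal K$. The Furstenberg URS of $G$ is the amenable URS $\mathcal A_G$ such that $\mathcal H\preccurlyeq\mathcal A_G$ for every amenable URS $\mathcal H$ of $G$. **Theorem.** Let $F\le F'\le\mathrm{Sym}(\Omega)$, and assume that $F$ acts freely on $\Omega$. 1. If moreover $F$ is transitive on $\Omega$, $F'$ is $2$-transitive on $\Omega$, and the point stabilizers of $F'$ are perfect, then $G^\ast=G(F,F')^\ast$ has exactly three URS's, namely $\{\{1\}\}$, $\mathcal S_{G^\ast}(X_T)$ and $\{G^\ast\}$, and these are pairwise distinct. 2. If $\Omega$ is finite, then $G=G(F,F')$ has a unique Furstenberg URS $\mathcal A_G$, and $\mathcal A_G=\mathcal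 S_G(\partial T)=\{G_\xi^0 : \xi\in\partial T\}$. -/

import Mathlib

open Filter Topology Pointwise

noncomputable section

namespace TreeURS

/-! ### The Chabauty space and uniformly recurrent subgroups -/

section Chabauty

variable (G : Type*) [Group G]

/-- The Chabauty topology on the set of subgroups of the (discrete) group `G`: the topology
induced by the product topology through `Sub(G) ⊆ {0,1}^G`, where `{0,1}` is discrete. -/
instance chabauty : TopologicalSpace (Subgroup G) :=
  TopologicalSpace.induced
    (fun (H : Subgroup G) (g : G) => (open Classical in decide (g ∈ H) : Bool)) inferInstance

/-- Invariance under conjugation (`MulAut.conj g • H` is `g H g⁻¹`). -/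
def ConjInvariant {G : Type*} [Group G] (A : Set (Subgroup G)) : Prop :=
  ∀ (g : G), ∀ H ∈ A, MulAut.conj g • H ∈ A

/-- A uniformly recurrent subgroup: a non-empty closed conjugation-invariant set of subgroups that
is minimal among such sets. -/
structure IsURS {G : Type*} [Group G] (A : Set (Subgroup G)) : Prop where
  nonempty : A.Nonempty
  isClosed : IsClosed A
  invariant : ConjInvariant A
  minimal : ∀ B ⊆ A, B.Nonempty → IsClosed B → ConjInvariant B → B = A

/-- Amenability of a discrete group: there is a left-invariant finitely additive probability
measure defined on all subsets. -/
def IsAmenable : Prop :=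
  ∃ m : Set G → ℝ, (∀ A, 0 ≤ m A) ∧ m Set.univ = 1 ∧
    (∀ A B, Disjoint A B → m (A ∪ B) = m A + m B) ∧
    ∀ (g : G) (A : Set G), m ((fun x => g * x) '' A) = m A

/-- A uniformly recurrent subgroup all of whose elements are amenable groups. -/
def IsAmenableURS {G : Type*} [Group G] (A : Set (Subgroup G)) : Prop :=
  IsURS A ∧ ∀ H ∈ A, IsAmenable H

/-- The relation `A ≼ B`: some element of `A` is contained in some element of `B`. -/
def URSLE {G : Type*} [Group G] (A B : Set (Subgroup G)) : Prop :=
  ∃ H ∈ A, ∃ K ∈ B, H ≤ K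

/-- `A` is a largest amenable uniformly recurrent subgroup. -/
def IsFurstenbergURS {G : Type*} [Group G] (A : Set (Subgroup G)) : Prop :=
  IsAmenableURS A ∧ ∀ B : Set (Subgroup G), IsAmenableURS B → URSLE B A

/-- `S_G(X)`: the closure, in the space of subgroups, of the set of stabilizers `G_x` with `x` a
continuity point of the stabilizer map. -/
def stabilizerURS (X : Type*) [TopologicalSpace X] [MulAction G X] : Set (Subgroup G) :=
  closure (MulAction.stabilizer G '' {x : X | ContinuousAt (MulAction.stabilizer G) x})

/-- `G_x^0`: the subgroup of elements that fix pointwise a neighbourhood of `x`. -/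
def germStabilizer {X : Type*} [TopologicalSpace X] [MulAction G X] (x : X) : Subgroup G where
  carrier := {g | ∀ᶠ y in 𝓝 x, g • y = y}
  one_mem' := by simp
  mul_mem' := by
    intro a b ha hb
    filter_upwards [ha, hb] with y h1 h2
    rw [mul_smul, h2, h1]
  inv_mem' := by
    intro a ha
    filter_upwards [ha] with y h1
    rw [inv_smul_eq_iff, h1]

end Chabauty

/-! ### Half-trees, ends, and the space `T ⊔ ∂T` -/

section Tree

variable {V : Type*} (T : SimpleGraph V)

/-- The half-tree of the oriented edge `(v, w)`: the vertices of the component of `w` in the graph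
obtained from `T` by removing the edge between `v` and `w`. -/
def halfTree (v w : V) : Set V :=
  {u | (T.deleteEdges {s(v, w)}).Reachable w u}

/-- Rays: infinite injective paths. -/
def Ray : Type _ :=
  {r : ℕ → V // Function.Injective r ∧ ∀ n, T.Adj (r n) (r (n + 1))}

/-- Two rays are equivalent if they coincide from some point on, up to a shift. -/
def raySetoid : Setoid (Ray T) where
  r a b := ∃ m n : ℕ, ∀ k, a.1 (m + k) = b.1 (n + k)
  iseqv :=
    { refl := fun _ => ⟨0, 0, fun _ => rfl⟩
      symm := fun ⟨m, n, h⟩ => ⟨n, m, fun k => (h k).symm⟩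
      trans := by
        rintro a b c ⟨m, n, h⟩ ⟨m', n', h'⟩
        refine ⟨m + m', n' + n, fun k => ?_⟩
        rw [add_assoc, h, add_assoc, ← h', Nat.add_left_comm] }

/-- The set `∂T` of ends of the tree `T`. -/
def Ends : Type _ := Quotient (raySetoid T)

variable {T}

/-- The end represented by a ray. -/
def Ray.toEnd (r : Ray T) : Ends T := Quotient.mk (raySetoid T) r

/-- The image of a ray by an automorphism. -/
def Ray.map (g : T ≃g T) (r : Ray T) : Ray T :=
  ⟨fun n => g (r.1 n), g.injective.comp r.2.1, fun n => g.map_adj_iff.2 (r.2.2 n)⟩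

instance : MulAction (T ≃g T) (Ends T) where
  smul g := Quotient.map (Ray.map g) (fun _ _ ⟨m, n, h⟩ => ⟨m, n, fun k => congrArg g (h k)⟩)
  one_smul := by
    intro x
    induction x using Quotient.inductionOn with
    | _ r => rfl
  mul_smul := by
    intro g h x
    induction x using Quotient.inductionOn with
    | _ r => rfl

variable (T)

/-- The set `T ⊔ ∂T` of vertices and ends. -/
inductive WithEnds : Type _
  | vertex (v : V) : WithEnds
  | ofEnd (ξ : Ends T) : WithEnds

variable {T}

instance : MulAction (T ≃g T) (WithEnds T) where
  smul g x := match x with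
    | .vertex v => .vertex (g v)
    | .ofEnd ξ => .ofEnd (g • ξ)
  one_smul := by
    rintro (v | ξ)
    · rfl
    · exact congrArg WithEnds.ofEnd (one_smul _ ξ)
  mul_smul := by
    rintro g h (v | ξ)
    · rfl
    · exact congrArg WithEnds.ofEnd (mul_smul g h ξ)

/-- A set of vertices together with the ends it defines: those having a representing ray almost
all of whose vertices lie in the set. -/
def addEnds (A : Set V) : Set (WithEnds T) :=
  {x | (∃ v ∈ A, x = .vertex v) ∨
    ∃ r : Ray T, (∀ᶠ n in atTop, r.1 n ∈ A) ∧ x = .ofEnd r.toEnd}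

/-- The coarsest topology on `T ⊔ ∂T` for which every half-tree (with its ends) is open. -/
instance : TopologicalSpace (WithEnds T) :=
  TopologicalSpace.generateFrom
    {U | ∃ v w : V, T.Adj v w ∧ U = addEnds (halfTree T v w)}

/-- The topology on `∂T` is the one induced from `T ⊔ ∂T`. -/
instance : TopologicalSpace (Ends T) :=
  TopologicalSpace.induced WithEnds.ofEnd inferInstance

variable (T)

/-- The space `X_T = (T ∖ T_f) ⊔ ∂T`, where `T_f` is the set of vertices of finite degree, with its
action of the automorphism group. -/
def XT : SubMulAction (T ≃g T) (WithEnds T) where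
  carrier := {x | ∀ v : V, x = .vertex v → (T.neighborSet v).Infinite}
  smul_mem' := by
    rintro g (v | ξ) hx w hw
    · have hv := hx v rfl
      have hgw : g v = w := by
        have h' : (WithEnds.vertex (g v) : WithEnds T) = .vertex w := hw
        injection h'
      subst hgw
      intro hfin
      have hfin' : Finite (T.neighborSet (g v)) := hfin
      exact hv (Finite.of_equiv _ (g.mapNeighborSet v).symm : Finite (T.neighborSet v))
    · have h' : (WithEnds.ofEnd (g • ξ) : WithEnds T) = .vertex w := hw
      cases h'

/-- The group of automorphisms preserving the types of vertices; two vertices of a tree have the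
same type if they are joined by a walk of even length. -/
def typePreserving : Subgroup (T ≃g T) where
  carrier := {g | ∀ v, ∃ p : T.Walk v (g v), Even p.length}
  one_mem' := fun v => ⟨SimpleGraph.Walk.nil, by simp⟩
  mul_mem' := by
    intro a b ha hb v
    obtain ⟨p, hp⟩ := hb v
    obtain ⟨q, hq⟩ := ha (b v)
    have hpq : Even (p.append q).length := by
      rw [SimpleGraph.Walk.length_append]
      exact hp.add hq
    exact ⟨p.append q, hpq⟩
  inv_mem' := by
    intro a ha v
    obtain ⟨p, hp⟩ := ha (a⁻¹ v)
    have h : a (a⁻¹ v) = v := RelIso.apply_inv_self a v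
    exact ⟨(p.copy rfl h).reverse, by simpa using hp⟩

end Tree

/-! ### Colourings and the groups `G(F, F')` -/

section LocalAction

variable {V Ω : Type*} {T : SimpleGraph V}

/-- A colouring of the edges of `T` by `Ω` that induces, for every vertex `v`, a bijection between
the edges around `v` (indexed by the neighbours of `v`) and `Ω`. -/
structure EdgeColouring (T : SimpleGraph V) (Ω : Type*) where
  colour : T.edgeSet → Ω
  bijective : ∀ v, Function.Bijective
    fun w : T.neighborSet v => colour ⟨s(v, w.1), T.mem_edgeSet.2 w.2⟩

/-- The bijection `c_v`. -/
def EdgeColouring.around (c : EdgeColouring T Ω) (v : V) : T.neighborSet v ≃ Ω :=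
  Equiv.ofBijective _ (c.bijective v)

/-- The local permutation `σ(g, v) = c_{gv} ∘ g_v ∘ c_v⁻¹`. -/
def EdgeColouring.localPerm (c : EdgeColouring T Ω) (g : T ≃g T) (v : V) : Equiv.Perm Ω :=
  ((c.around v).symm.trans (g.mapNeighborSet v)).trans (c.around (g v))

theorem EdgeColouring.localPerm_one (c : EdgeColouring T Ω) (v : V) :
    c.localPerm 1 v = 1 := by
  ext a
  exact (c.around v).apply_symm_apply a

theorem EdgeColouring.localPerm_mul (c : EdgeColouring T Ω) (g h : T ≃g T) (v : V) :
    c.localPerm (g * h) v = c.localPerm g (h v) * c.localPerm h v := by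
  ext a
  change _ = (c.around (g (h v))) ((g.mapNeighborSet (h v)) ((c.around (h v)).symm
    ((c.around (h v)) ((h.mapNeighborSet v) ((c.around v).symm a)))))
  rw [Equiv.symm_apply_apply]
  rfl

theorem EdgeColouring.localPerm_inv (c : EdgeColouring T Ω) (g : T ≃g T) (v : V) :
    c.localPerm g⁻¹ v = (c.localPerm g (g⁻¹ v))⁻¹ := by
  rw [← mul_eq_one_iff_inv_eq.1 (?_ : c.localPerm g (g⁻¹ v) * c.localPerm g⁻¹ v = 1)]
  rw [← c.localPerm_mul, mul_inv_cancel, c.localPerm_one]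

/-- The group `G(F, F')` of automorphisms having all local permutations in `F'`, and all but
finitely many in `F`. -/
def almostPrescribed (c : EdgeColouring T Ω) (F F' : Subgroup (Equiv.Perm Ω)) :
    Subgroup (T ≃g T) where
  carrier := {g | (∀ v, c.localPerm g v ∈ F') ∧ {v | c.localPerm g v ∉ F}.Finite}
  one_mem' := by simp [EdgeColouring.localPerm_one, one_mem]
  mul_mem' := by
    rintro g h ⟨hg, hg'⟩ ⟨hh, hh'⟩
    refine ⟨fun v => by rw [c.localPerm_mul]; exact mul_mem (hg _) (hh _), ?_⟩
    refine ((hg'.preimage h.injective.injOn).union hh').subset fun v hv => ?_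
    by_contra hcon
    simp only [Set.mem_union, Set.mem_preimage, Set.mem_ofPred_eq, not_or, not_not] at hcon
    exact hv (by rw [c.localPerm_mul]; exact mul_mem hcon.1 hcon.2)
  inv_mem' := by
    rintro g ⟨hg, hg'⟩
    refine ⟨fun v => by rw [c.localPerm_inv]; exact inv_mem (hg _), ?_⟩
    refine (hg'.preimage (g⁻¹).injective.injOn).subset fun v hv hcon => ?_
    exact hv (by rw [c.localPerm_inv]; exact inv_mem hcon)

/-- The subgroup `G(F, F')^*` of `G(F, F')` preserving the types of vertices. -/
def almostPrescribedStar (c : EdgeColouring T Ω) (F F' : Subgroup (Equiv.Perm Ω)) :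
    Subgroup (T ≃g T) :=
  almostPrescribed c F F' ⊓ typePreserving T

end LocalAction

end TreeURS

end

open Filter Topology Pointwise

namespace TreeURS

/-! ### The Chabauty space -/

section Chabauty

variable {G : Type*} [Group G]

/-! Freeness of `F` makes elements rigid. One that fixes an edge and has all its local permutations
in `F` on the half-tree behind it fixes that half-tree pointwise (`fixed_of_free`). As an element
has only finitely many singularities (vertices whose local permutation is outside `F`), its
behaviour near an end is decided on a single cone of a ray.

Part 1. Let `A` be non-empty, closed and invariant, containing neither `⊥` nor `⊤`. By compactness a
finite set of non-trivial elements meets every member of `A`. The Hales–Jewett theorem and double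
commutators turn this into a member containing the rigid stabilizer of a half-tree
(`exists_rist_le`). This uses that such rigid stabilizers are perfect, which is proved by removing
singularities one at a time (`commutator_rist_halfTree`). Conjugating so that the complementary
half-tree shrinks to an end, and passing to a limit, gives `L ∈ A` containing every element trivial
near that end (`exists_fixators_le`). If `L` moved the end, 2-transitivity would force `L = ⊤`
(`eq_top_of_fixators_le`). So `L` fixes the end, and equals its stabilizer at continuity points.
Hence the stabilizer URS lies in `A`, which yields both its minimality and the classification.

Part 2. Germ stabilizers depend continuously on the end, the boundary is compact and every orbit in
it is dense, so they form a URS. It equals `S_G(∂T)`, because a ray with an aperiodic colour pattern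
provides a continuity point (`exists_generic_ray`). Its members are locally finite, hence amenable.
Conversely, an invariant mean gives a half-tree that no element of a given amenable subgroup moves
off itself. Shrinking this half-tree to the generic end puts a limit of conjugates inside a germ
stabilizer. Uniqueness is antisymmetry of `≼` (`IsURS.antisymm`). -/

theorem isClopen_setOf_mem (g : G) : IsClopen {H : Subgroup G | g ∈ H} := by
  have hc : Continuous fun H : Subgroup G => (open Classical in decide (g ∈ H) : Bool) := by
    have h : Continuous fun (H : Subgroup G) (g : G) =>
      (open Classical in decide (g ∈ H) : Bool) := continuous_induced_dom
    exact (continuous_apply g).comp h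
  have h := (isClopen_discrete ({true} : Set Bool)).preimage hc
  convert h using 1
  ext H
  simp

theorem tendsto_subgroup_iff {ι : Type*} {l : Filter ι} {f : ι → Subgroup G} {H : Subgroup G} :
    Tendsto f l (𝓝 H) ↔
      ∀ g, (g ∈ H → ∀ᶠ i in l, g ∈ f i) ∧ (g ∉ H → ∀ᶠ i in l, g ∉ f i) := by
  constructor
  · intro h g
    exact ⟨fun hg => h.eventually ((isClopen_setOf_mem g).isOpen.mem_nhds hg),
      fun hg => h.eventually ((isClopen_setOf_mem g).compl.isOpen.mem_nhds hg)⟩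
  · intro h
    rw [nhds_induced, tendsto_comap_iff, tendsto_pi_nhds]
    intro g
    rw [nhds_discrete, tendsto_pure]
    by_cases hg : g ∈ H
    · filter_upwards [(h g).1 hg] with i hi
      simp [hi, hg]
    · filter_upwards [(h g).2 hg] with i hi
      simp [hi, hg]

theorem continuous_subgroup_iff {X : Type*} [TopologicalSpace X] {f : X → Subgroup G} :
    Continuous f ↔ ∀ g, IsClopen {x | g ∈ f x} := by
  constructor
  · intro h g
    exact (isClopen_setOf_mem g).preimage h
  · intro h
    rw [continuous_iff_continuousAt]
    intro x
    exact tendsto_subgroup_iff.2 fun g => ⟨fun hg => (h g).isOpen.mem_nhds hg,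
      fun hg => (h g).compl.isOpen.mem_nhds hg⟩

instance : T2Space (Subgroup G) := by
  refine ⟨fun H K hHK => ?_⟩
  obtain ⟨g, hg⟩ : ∃ g, ¬ (g ∈ H ↔ g ∈ K) := by
    by_contra! h
    exact hHK (SetLike.ext h)
  by_cases h : g ∈ H
  · exact ⟨_, _, (isClopen_setOf_mem g).isOpen, (isClopen_setOf_mem g).compl.isOpen, h,
      fun h' => hg ⟨fun _ => h', fun _ => h⟩, disjoint_compl_right⟩
  · refine ⟨_, _, (isClopen_setOf_mem g).compl.isOpen, (isClopen_setOf_mem g).isOpen, h, ?_,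
      disjoint_compl_left⟩
    by_contra h'
    exact hg ⟨fun h'' => absurd h'' h, fun h'' => absurd h'' h'⟩

/-- The limit of a family of subgroups along an ultrafilter. -/
def ultralimit {ι : Type*} (u : Ultrafilter ι) (f : ι → Subgroup G) : Subgroup G where
  carrier := {g | ∀ᶠ i in u, g ∈ f i}
  one_mem' := Eventually.of_forall fun i => one_mem _
  mul_mem' := fun ha hb => by filter_upwards [ha, hb] with i h1 h2 using mul_mem h1 h2
  inv_mem' := fun ha => by filter_upwards [ha] with i h1 using inv_mem h1

theorem mem_ultralimit {ι : Type*} {u : Ultrafilter ι} {f : ι → Subgroup G} {g : G} :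
    g ∈ ultralimit u f ↔ ∀ᶠ i in u, g ∈ f i := Iff.rfl

/-- An ultrafilter decides the membership of every element. This is the compactness of the space of
subgroups, in the form used throughout. -/
theorem tendsto_ultralimit {ι : Type*} (u : Ultrafilter ι) (f : ι → Subgroup G) :
    Tendsto f u (𝓝 (ultralimit u f)) :=
  tendsto_subgroup_iff.2 fun _ => ⟨fun h => h, fun h => Ultrafilter.eventually_not.2 h⟩

theorem ultralimit_mem {ι : Type*} {u : Ultrafilter ι} {f : ι → Subgroup G} {A : Set (Subgroup G)}
    (hA : IsClosed A) (h : ∀ i, f i ∈ A) : ultralimit u f ∈ A :=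
  hA.mem_of_tendsto (tendsto_ultralimit u f) (Eventually.of_forall h)

theorem mem_conj_smul {g x : G} {H : Subgroup G} : x ∈ MulAut.conj g • H ↔ g⁻¹ * x * g ∈ H := by
  rw [Subgroup.mem_pointwise_smul_iff_inv_smul_mem, ← map_inv, MulAut.smul_def, MulAut.conj_apply,
    inv_inv]

theorem continuous_conj_smul (g : G) : Continuous fun H : Subgroup G => MulAut.conj g • H :=
  continuous_subgroup_iff.2 fun x => by
    simpa only [mem_conj_smul] using isClopen_setOf_mem (g⁻¹ * x * g)

theorem ConjInvariant.closure {A : Set (Subgroup G)} (h : ConjInvariant A) :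
    ConjInvariant (closure A) := fun g _ hH =>
  map_mem_closure (continuous_conj_smul g) hH fun _ => h g _

theorem isURS_singleton {H : Subgroup G} (hH : ∀ g : G, MulAut.conj g • H = H) :
    IsURS ({H} : Set (Subgroup G)) where
  nonempty := Set.singleton_nonempty H
  isClosed := isClosed_singleton
  invariant := by
    rintro g _ rfl
    exact hH g
  minimal := fun B hB hne _ _ => (Set.subset_singleton_iff_eq.1 hB).resolve_left hne.ne_empty

theorem isURS_bot : IsURS ({⊥} : Set (Subgroup G)) :=
  isURS_singleton fun _ => Subgroup.smul_bot _

theorem isURS_top : IsURS ({⊤} : Set (Subgroup G)) :=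
  isURS_singleton fun g => by ext x; simp

theorem IsURS.eq_of_mem {A B : Set (Subgroup G)} (hA : IsURS A) (hB : IsURS B) {H : Subgroup G}
    (h : H ∈ A) (h' : H ∈ B) : A = B := by
  have hinv : ConjInvariant (A ∩ B) := fun g K hK =>
    ⟨hA.invariant g K hK.1, hB.invariant g K hK.2⟩
  rw [← hA.minimal (A ∩ B) Set.inter_subset_left ⟨H, h, h'⟩ (hA.isClosed.inter hB.isClosed) hinv]
  exact hB.minimal (A ∩ B) Set.inter_subset_right ⟨H, h, h'⟩ (hA.isClosed.inter hB.isClosed) hinv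

theorem conj_smul_le_conj_smul {g : G} {H K : Subgroup G} (h : H ≤ K) :
    MulAut.conj g • H ≤ MulAut.conj g • K := fun _ hx =>
  mem_conj_smul.2 (h (mem_conj_smul.1 hx))

/-- If some element of a uniformly recurrent subgroup `A` is contained in an element of `B`, then
all are. -/
theorem IsURS.exists_ge {A B : Set (Subgroup G)} (hA : IsURS A) (hB : IsClosed B)
    (hBi : ConjInvariant B) (h : URSLE A B) {H : Subgroup G} (hH : H ∈ A) : ∃ K ∈ B, H ≤ K := by
  -- The members lying below `B` form an invariant set, which is closed because a limit of upper
  -- bounds bounds the limit; minimality applies.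
  have : {H ∈ A | ∃ K ∈ B, H ≤ K} = A := by
    refine hA.minimal _ (Set.sep_subset _ _) h ?_ ?_
    · rw [isClosed_iff_ultrafilter]
      intro L u huL hu
      have hfA : ∀ᶠ H in (u : Filter (Subgroup G)), H ∈ A := by
        filter_upwards [hu] with H hH using hH.1
      have hLA : L ∈ A := hA.isClosed.mem_of_tendsto (tendsto_id'.2 huL) hfA
      refine ⟨hLA, ?_⟩
      -- Outside the set `⊥` is a dummy value, invisible to the ultrafilter.
      have hch : ∀ H : Subgroup G, ∃ K, H ∈ {H ∈ A | ∃ K ∈ B, H ≤ K} → K ∈ B ∧ H ≤ K := by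
        intro H
        by_cases hH : H ∈ {H ∈ A | ∃ K ∈ B, H ≤ K}
        · obtain ⟨K, hK⟩ := hH.2
          exact ⟨K, fun _ => hK⟩
        · exact ⟨⊥, fun h => absurd h hH⟩
      choose f hf using hch
      refine ⟨ultralimit u f, ?_, ?_⟩
      · refine hB.mem_of_tendsto (tendsto_ultralimit u f) ?_
        filter_upwards [hu] with H hH using (hf H hH).1
      · intro g hg
        have := (tendsto_subgroup_iff.1 (tendsto_id'.2 huL) g).1 hg
        filter_upwards [this, hu] with H h1 h2 using (hf H h2).2 h1
    · rintro g H ⟨hHA, K, hK, hHK⟩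
      exact ⟨hA.invariant g H hHA, _, hBi g K hK, conj_smul_le_conj_smul hHK⟩
  rw [← this] at hH
  exact hH.2

/-- The relation `≼` is antisymmetric on uniformly recurrent subgroups. -/
theorem IsURS.antisymm {A B : Set (Subgroup G)} (hA : IsURS A) (hB : IsURS B) (h : URSLE A B)
    (h' : URSLE B A) : A = B := by
  have hAB : ∀ H : A, ∃ K : B, (H : Subgroup G) ≤ K := fun H => by
    obtain ⟨K, hK, hHK⟩ := hA.exists_ge hB.isClosed hB.invariant h H.2
    exact ⟨⟨K, hK⟩, hHK⟩
  have hBA : ∀ K : B, ∃ H : A, (K : Subgroup G) ≤ H := fun K => by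
    obtain ⟨H, hH, hKH⟩ := hB.exists_ge hA.isClosed hA.invariant h' K.2
    exact ⟨⟨H, hH⟩, hKH⟩
  choose f hf using hAB
  choose k hk using hBA
  obtain ⟨H₀, hH₀⟩ := hA.nonempty
  -- Inclusions alternate between `A` and `B` in one increasing chain, so both sequences converge to
  -- its union, a common member.
  let s : ℕ → A := fun n => Nat.rec ⟨H₀, hH₀⟩ (fun _ H => k (f H)) n
  have hs : ∀ n, (f (s n) : Subgroup G) ≤ s (n + 1) := fun n => hk (f (s n))
  let u : Ultrafilter ℕ := hyperfilter ℕ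
  let a : ℕ → Subgroup G := fun n => (s n).1
  let b : ℕ → Subgroup G := fun n => (f (s n)).1
  have h1 : ultralimit u a ∈ A := ultralimit_mem hA.isClosed fun n => (s n).2
  have h2 : ultralimit u b ∈ B := ultralimit_mem hB.isClosed fun n => (f (s n)).2
  have hmono : Monotone a :=
    monotone_nat_of_le_succ fun n => (hf (s n)).trans (hs n)
  have heq : ultralimit u a = ultralimit u b := by
    refine le_antisymm (fun g hg => ?_) (fun g hg => ?_)
    · filter_upwards [mem_ultralimit.1 hg] with n hn using hf (s n) hn
    · obtain ⟨n, hn⟩ := (mem_ultralimit.1 hg).exists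
      have hle : (u : Filter ℕ) ≤ atTop := by
        rw [← Nat.cofinite_eq_atTop]
        exact hyperfilter_le_cofinite
      have : ∀ᶠ m in (u : Filter ℕ), n + 1 ≤ m := hle (eventually_ge_atTop (n + 1))
      filter_upwards [this] with m hm using hmono hm (hs n hn)
  exact hA.eq_of_mem hB h1 (heq ▸ h2)

/-- A closed set of subgroups that does not contain the trivial subgroup is detected by a finite
set of non-trivial elements. -/
theorem exists_finset_of_bot_notMem {A : Set (Subgroup G)} (hA : IsClosed A) (h : ⊥ ∉ A) :
    ∃ P : Finset G, 1 ∉ P ∧ ∀ H ∈ A, ∃ p ∈ P, p ∈ H := by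
  classical
  -- Otherwise members avoiding larger and larger finite sets of non-trivial elements converge to
  -- `⊥`.
  by_contra! hcon
  have hch : ∀ P : Finset G, ∃ H ∈ A, ∀ p ∈ P, p ∈ H → p = 1 := by
    intro P
    obtain ⟨H, hH, hp⟩ := hcon (P.erase 1) (Finset.notMem_erase _ _)
    refine ⟨H, hH, fun p hpP hpH => ?_⟩
    by_contra hp1
    exact hp p (Finset.mem_erase.2 ⟨hp1, hpP⟩) hpH
  choose f hfA hf using hch
  refine h (hA.mem_of_tendsto (b := atTop) (f := f) ?_ (Eventually.of_forall hfA))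
  refine tendsto_subgroup_iff.2 fun g => ⟨fun hg => ?_, fun hg => ?_⟩
  · rw [Subgroup.mem_bot.1 hg]
    exact Eventually.of_forall fun _ => one_mem _
  · filter_upwards [eventually_ge_atTop ({g} : Finset G)] with P hP hgP
    exact hg (Subgroup.mem_bot.2 (hf P g (hP (Finset.mem_singleton_self g)) hgP))

end Chabauty

/-! ### Stabilizer maps and germ stabilizers. -/

section Stabilizers

variable {G : Type*} [Group G] {X : Type*} [MulAction G X]

theorem stabilizer_smul_eq_conj_smul (g : G) (x : X) :
    MulAction.stabilizer G (g • x) = MulAut.conj g • MulAction.stabilizer G x := by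
  ext h
  rw [mem_conj_smul, MulAction.mem_stabilizer_iff, MulAction.mem_stabilizer_iff, mul_smul, mul_smul,
    inv_smul_eq_iff]

variable [TopologicalSpace X]

theorem conjInvariant_stabilizerURS [ContinuousConstSMul G X] :
    ConjInvariant (stabilizerURS G X) := by
  refine ConjInvariant.closure ?_
  rintro g _ ⟨x, hx, rfl⟩
  refine ⟨g • x, ?_, stabilizer_smul_eq_conj_smul g x⟩
  have h1 : MulAction.stabilizer G = fun y : X => MulAut.conj g •
      MulAction.stabilizer G (g⁻¹ • y) := by
    funext y
    rw [← stabilizer_smul_eq_conj_smul, smul_inv_smul]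
  change ContinuousAt (MulAction.stabilizer G) (g • x)
  rw [h1]
  have hx' : ContinuousAt (MulAction.stabilizer G) (g⁻¹ • g • x) := by
    rw [inv_smul_smul]
    exact hx
  have hg : ContinuousAt (fun y : X => g⁻¹ • y) (g • x) := (continuous_const_smul g⁻¹).continuousAt
  exact (continuous_conj_smul g).continuousAt.comp (hx'.comp hg)

theorem germStabilizer_le_stabilizer (x : X) : germStabilizer G x ≤ MulAction.stabilizer G x :=
  fun g hg => Eventually.self_of_nhds (p := fun y => g • y = y) hg

theorem mem_germStabilizer {x : X} {g : G} : g ∈ germStabilizer G x ↔ ∀ᶠ y in 𝓝 x, g • y = y :=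
  Iff.rfl

/-- Containing `g` is an open condition on subgroups, so near a continuity point fixed by `g` all
points are fixed by `g`. -/
theorem stabilizer_eq_germStabilizer_of_continuousAt {x : X}
    (hx : ContinuousAt (MulAction.stabilizer G) x) :
    MulAction.stabilizer G x = germStabilizer G x :=
  le_antisymm (fun g hg => show ∀ᶠ y in 𝓝 x, g • y = y from (tendsto_subgroup_iff.1 hx g).1 hg)
    (germStabilizer_le_stabilizer x)

theorem germStabilizer_smul_eq_conj_smul [ContinuousConstSMul G X] (g : G) (x : X) :
    germStabilizer G (g • x) = MulAut.conj g • germStabilizer G x := by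
  ext h
  rw [mem_conj_smul, mem_germStabilizer, mem_germStabilizer]
  have hm : 𝓝 (g • x) = map (fun y => g • y) (𝓝 x) := ((Homeomorph.smul g).map_nhds_eq x).symm
  rw [hm, eventually_map]
  simp only [mul_smul, inv_smul_eq_iff]

end Stabilizers

/-! ### Rigid stabilizers and confined subgroups -/

section RigidStabilizer

variable {G X : Type*} [Group G] [MulAction G X]

variable (G) in
/-- The rigid stabilizer of `U`: the elements supported in `U`. -/
def rist (U : Set X) : Subgroup G := fixingSubgroup G Uᶜ

theorem mem_rist {U : Set X} {g : G} : g ∈ rist G U ↔ ∀ x ∉ U, g • x = x :=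
  mem_fixingSubgroup_iff G

theorem rist_mono {U V : Set X} (h : U ⊆ V) : rist G U ≤ rist G V := fun _ hg =>
  mem_rist.2 fun x hx => mem_rist.1 hg x fun hxU => hx (h hxU)

theorem smul_mem_iff_of_mem_rist {U : Set X} {g : G} (hg : g ∈ rist G U) {x : X} :
    g • x ∈ U ↔ x ∈ U := by
  constructor
  · intro h
    by_contra hx
    rw [mem_rist.1 hg x hx] at h
    exact hx h
  · intro h
    by_contra hx
    have := mem_rist.1 hg _ hx
    rw [smul_left_cancel_iff] at this
    exact hx (this.symm ▸ h)

theorem conj_mem_rist_smul {U : Set X} {g h : G} (hg : g ∈ rist G U) :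
    h * g * h⁻¹ ∈ rist G (h • U) := by
  refine mem_rist.2 fun x hx => ?_
  rw [mul_smul, mul_smul, mem_rist.1 hg, smul_inv_smul]
  rwa [← Set.mem_smul_set_iff_inv_smul_mem]

variable [FaithfulSMul G X]

theorem commute_of_mem_rist {U : Set X} {a b : G} (ha : a ∈ rist G U)
    (hb : ∀ x ∈ U, b • x = x) : Commute a b := by
  refine FaithfulSMul.eq_of_smul_eq_smul (α := X) fun x => ?_
  rw [mul_smul, mul_smul]
  by_cases hx : x ∈ U
  · rw [hb x hx, hb _ ((smul_mem_iff_of_mem_rist ha).2 hx)]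
  · rw [mem_rist.1 ha x hx, mem_rist.1 ha]
    intro h
    have := hb _ h
    rw [smul_left_cancel_iff] at this
    exact hx (this ▸ h)

theorem commute_of_disjoint {U V : Set X} (h : Disjoint U V) {a b : G} (ha : a ∈ rist G U)
    (hb : b ∈ rist G V) : Commute a b :=
  commute_of_mem_rist ha fun x hx => mem_rist.1 hb x fun hxV => Set.disjoint_left.1 h hx hxV

/-- If `p` moves `U` off itself and `H` contains the conjugates of `p` by `1`, `x`, `y` and `x * y`,
where `x` and `y` are supported in `U`, then `H` contains a commutator of `x` and `y`. -/
theorem commutator_mem_of_conj_mem {U : Set X} {H : Subgroup G} {p x y : G}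
    (hp : Disjoint (p • U) U) (hx : x ∈ rist G U) (hy : y ∈ rist G U) (h1 : p ∈ H)
    (hpx : x⁻¹ * p * x ∈ H) (hpy : y⁻¹ * p * y ∈ H) (hpxy : (x * y)⁻¹ * p * (x * y) ∈ H) :
    x⁻¹ * y⁻¹ * x * y ∈ H := by
  -- The conjugate of `x` by `p` is supported in `p • U`, away from the support of `y`; in the
  -- product below all conjugates by `p` then cancel.
  have hc : Commute (p * x * p⁻¹) y := commute_of_disjoint hp (conj_mem_rist_smul hx) hy
  have h2 := mul_mem (mul_mem (mul_mem hpx (inv_mem h1)) (mul_mem hpy (inv_mem h1)))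
    (inv_mem (mul_mem hpxy (inv_mem h1)))
  convert h2 using 1
  have hc' : p * x * p⁻¹ * y⁻¹ = y⁻¹ * (p * x * p⁻¹) := hc.inv_right
  calc x⁻¹ * y⁻¹ * x * y = x⁻¹ * (y⁻¹ * (p * x * p⁻¹)) * (p * x⁻¹ * p⁻¹) * x * y := by group
    _ = x⁻¹ * (p * x * p⁻¹ * y⁻¹) * (p * x⁻¹ * p⁻¹) * x * y := by rw [hc']
    _ = _ := by group

/-- All conjugates of `p` by the rigid stabilizer are available, so `H` contains all its
commutators, and these generate it. -/
theorem rist_le_of_conj_mem {U : Set X} {H : Subgroup G} {p : G} (hp : Disjoint (p • U) U)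
    (hperf : ⁅rist G U, rist G U⁆ = rist G U) (h : ∀ γ ∈ rist G U, γ⁻¹ * p * γ ∈ H) :
    rist G U ≤ H := by
  rw [← hperf, Subgroup.commutator_le]
  intro x hx y hy
  have h1 := commutator_mem_of_conj_mem hp (inv_mem hx) (inv_mem hy)
    (by simpa using h 1 (one_mem _))
    (h _ (inv_mem hx)) (h _ (inv_mem hy)) (h _ (mul_mem (inv_mem hx) (inv_mem hy)))
  simpa [commutatorElement_def] using h1

section Product

variable {ι : Type} {V : ι → Set X}

theorem pairwise_commute_rist (hV : Pairwise fun i j => Disjoint (V i) (V j)) :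
    Pairwise fun i j => ∀ x y : G, x ∈ rist G (V i) → y ∈ rist G (V j) → Commute x y :=
  fun _ _ hij _ _ hx hy => commute_of_disjoint (hV hij) hx hy

variable [Fintype ι] (hV : Pairwise fun i j => Disjoint (V i) (V j))

/-- The homomorphism from the product of the rigid stabilizers of disjoint sets. -/
noncomputable def ristProd : (∀ i, rist G (V i)) →* G :=
  Subgroup.noncommPiCoprod (pairwise_commute_rist hV)

theorem ristProd_mulSingle [DecidableEq ι] (i : ι) (x : rist G (V i)) :
    ristProd hV (Pi.mulSingle i x) = x := by
  rw [ristProd, Subgroup.noncommPiCoprod_mulSingle]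

theorem ristProd_mem {U : Set X} (hVU : ∀ i, V i ⊆ U) (w : ∀ i, rist G (V i)) :
    ristProd hV w ∈ rist G U := by
  have h : ristProd hV w ∈ (ristProd (G := G) hV).range := ⟨w, rfl⟩
  rw [ristProd, Subgroup.noncommPiCoprod_range] at h
  exact (iSup_le fun i => rist_mono (hVU i)) h

end Product

/-- An application of the Hales–Jewett theorem. -/
theorem exists_line_of_confined {U : Set X} {S : Finset G} (hS : ∀ q ∈ S, Disjoint (q • U) U) :
    ∃ (ι : Type) (_ : Fintype ι), ∀ (V : ι → Set X)
      (hV : Pairwise fun i j => Disjoint (V i) (V j)) (_ : ∀ i, V i ⊆ U)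
      (x y : ∀ i, rist G (V i)) (H : Subgroup G),
      (∀ γ ∈ rist G U, ∃ q ∈ S, γ⁻¹ * q * γ ∈ H) →
      ∃ I : Finset ι, I.Nonempty ∧ ristProd hV
        (fun i => open Classical in if i ∈ I then (x i)⁻¹ * (y i)⁻¹ * x i * y i else 1) ∈ H := by
  classical
  -- A letter records whether `x i` and `y i` occur in the `i`-th factor; the colour of a word is
  -- some `q ∈ S` whose conjugate by the word lies in `H`. The index type depends on `S` only, so
  -- the disjoint sets can be chosen afterwards.
  obtain ⟨ι, hι, hHJ⟩ := Combinatorics.Line.exists_mono_in_high_dimension (Bool × Bool) S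
  refine ⟨ι, hι, fun V hV hVU x y H hH => ?_⟩
  let word : (ι → Bool × Bool) → ∀ i, rist G (V i) := fun w i =>
    (if (w i).1 then x i else 1) * (if (w i).2 then y i else 1)
  have hch : ∀ w, ∃ q : S, (ristProd hV (word w))⁻¹ * q * ristProd hV (word w) ∈ H := fun w => by
    obtain ⟨q, hq, h⟩ := hH _ (ristProd_mem hV hVU (word w))
    exact ⟨⟨q, hq⟩, h⟩
  choose C hC using hch
  obtain ⟨L, q, hq⟩ := hHJ C
  -- Along a monochromatic line a word is the constant part `δ` times the active part `z a`. So the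
  -- single element `d⁻¹ * q * d` satisfies the hypotheses of `commutator_mem_of_conj_mem`.
  let δ : ∀ i, rist G (V i) := fun i => if L.idxFun i = none then 1 else word (L (true, true)) i
  let z : Bool × Bool → ∀ i, rist G (V i) := fun a i => if L.idxFun i = none then
    (if a.1 then x i else 1) * (if a.2 then y i else 1) else 1
  have hword : ∀ a, word (L a) = δ * z a := by
    intro a
    funext i
    simp only [word, δ, z, Pi.mul_apply]
    rcases h : L.idxFun i with _ | b
    · simp only [Combinatorics.Line.apply_none _ _ _ h, if_true, one_mul]
    · simp only [Combinatorics.Line.apply_some h, reduceCtorEq, if_false, mul_one]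
  have hmul : z (true, true) = z (true, false) * z (false, true) := by
    funext i
    by_cases h : L.idxFun i = none <;> simp [z, h]
  have h1 : z (false, false) = 1 := by
    funext i
    simp [z]
  set d := ristProd hV δ
  have hd : d ∈ rist G U := ristProd_mem hV hVU δ
  have key : ∀ a, (ristProd hV (z a))⁻¹ * (d⁻¹ * q * d) * ristProd hV (z a) ∈ H := by
    intro a
    have := hC (L a)
    rw [hq a, hword a, map_mul] at this
    convert this using 1
    simp only [d]
    group
  have hdU : d • U = U := by
    ext v
    rw [Set.mem_smul_set_iff_inv_smul_mem, smul_mem_iff_of_mem_rist (inv_mem hd)]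
  have hdisj : Disjoint ((d⁻¹ * q * d) • U) U := by
    rw [mul_smul, mul_smul, hdU]
    have := hS q q.2
    rw [← Set.disjoint_smul_set (a := d), smul_inv_smul, hdU]
    exact this
  have hfin := commutator_mem_of_conj_mem hdisj (ristProd_mem hV hVU (z (true, false)))
    (ristProd_mem hV hVU (z (false, true))) (by simpa [h1] using key (false, false)) (key _) (key _)
    (by rw [← map_mul, ← hmul]; exact key _)
  obtain ⟨i₀, hi₀⟩ := L.proper
  refine ⟨Finset.univ.filter fun i => L.idxFun i = none, ⟨i₀, by simp [hi₀]⟩, ?_⟩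
  rw [← map_inv, ← map_inv, ← map_mul, ← map_mul, ← map_mul] at hfin
  convert hfin using 2
  funext i
  by_cases h : L.idxFun i = none <;> simp [z, h]

/-- Let `G` act faithfully on `X`, and let `𝓤` be a family of subsets of `X` whose rigid
stabilizers are perfect and non-trivial. If the closed invariant set `A` of subgroups
does not contain the trivial subgroup, then some element of `A` contains the rigid stabilizer of
some element of `𝓤`. -/
theorem exists_rist_le {𝓤 : Set (Set X)}
    (hmove : ∀ g : G, ∀ U ∈ 𝓤, (∃ x ∈ U, g • x ≠ x) → ∃ U' ∈ 𝓤, U' ⊆ U ∧ Disjoint (g • U') U')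
    (hfaith : ∀ g : G, g ≠ 1 → ∃ U ∈ 𝓤, ∃ x ∈ U, g • x ≠ x)
    (hperf : ∀ U ∈ 𝓤, ⁅rist G U, rist G U⁆ = rist G U) (hne : ∀ U ∈ 𝓤, rist G U ≠ ⊥)
    (hsplit : ∀ U ∈ 𝓤, ∀ (ι : Type) [Fintype ι], ∃ V : ι → Set X, (∀ i, V i ∈ 𝓤) ∧
      (∀ i, V i ⊆ U) ∧ Pairwise fun i j => Disjoint (V i) (V j))
    {A : Set (Subgroup G)} (hAn : A.Nonempty) (hA : IsClosed A) (hAi : ConjInvariant A)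
    (hbot : ⊥ ∉ A) : ∃ H ∈ A, ∃ U ∈ 𝓤, rist G U ≤ H := by
  classical
  have hconj : ∀ (γ : G), ∀ H ∈ A, ∃ H' ∈ A, ∀ g, g ∈ H' ↔ γ * g * γ⁻¹ ∈ H := fun γ H hH =>
    ⟨_, hAi γ⁻¹ H hH, fun g => by rw [mem_conj_smul, inv_inv]⟩
  -- a minimal finite set meeting all elements of `A`
  obtain ⟨P, ⟨hP1, hPA⟩, hPmin⟩ :=
    exists_minimal_of_wellFoundedLT (fun P : Finset G => 1 ∉ P ∧ ∀ H ∈ A, ∃ p ∈ P, p ∈ H)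
      (exists_finset_of_bot_notMem hA hbot)
  obtain ⟨H₀, hH₀⟩ := hAn
  obtain ⟨p, hpP, -⟩ := hPA H₀ hH₀
  -- By minimality `p` cannot be erased from `P`, so some member of `A` meets `P` in `p` alone.
  obtain ⟨H, hHA, hH⟩ : ∃ H ∈ A, ∀ q ∈ P, q ∈ H → q = p := by
    by_contra! hcon
    have := hPmin (y := P.erase p) ⟨fun h => hP1 (Finset.mem_of_mem_erase h), fun H hH => ?_⟩
      (Finset.erase_subset p P)
    · exact Finset.notMem_erase p P (this hpP)
    · obtain ⟨q, hq, hqH, hqp⟩ := hcon H hH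
      exact ⟨q, Finset.mem_erase.2 ⟨hqp, hq⟩, hqH⟩
  obtain ⟨U₀, hU₀, hU₀p⟩ := hfaith p fun h => hP1 (h ▸ hpP)
  obtain ⟨U₁, hU₁, -, hpU₁⟩ := hmove p U₀ hU₀ hU₀p
  -- Inside `U₁`, which `p` moves off itself, shrink until each element of a finite set either fixes
  -- the set pointwise or moves it off itself.
  have hstable : ∀ Q : Finset G, ∃ U ∈ 𝓤, U ⊆ U₁ ∧
      ∀ q ∈ Q, (∀ x ∈ U, q • x = x) ∨ Disjoint (q • U) U := by
    intro Q
    induction Q using Finset.induction_on with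
    | empty => exact ⟨U₁, hU₁, subset_rfl, by simp⟩
    | insert q Q _ ih =>
      obtain ⟨U, hU, hUU₁, h⟩ := ih
      by_cases hq : ∃ x ∈ U, q • x ≠ x
      · obtain ⟨U', hU', hU'U, hq'⟩ := hmove q U hU hq
        refine ⟨U', hU', hU'U.trans hUU₁, fun q' hq'Q => ?_⟩
        rcases Finset.mem_insert.1 hq'Q with rfl | hq'Q
        · exact Or.inr hq'
        · exact (h q' hq'Q).imp (fun h x hx => h x (hU'U hx))
            fun h => h.mono (Set.smul_set_mono hU'U) hU'U
      · push Not at hq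
        refine ⟨U, hU, hUU₁, fun q' hq'Q => ?_⟩
        rcases Finset.mem_insert.1 hq'Q with rfl | hq'Q
        · exact Or.inl hq
        · exact h q' hq'Q
  obtain ⟨U, hU, hUU₁, hUP⟩ := hstable P
  set S := P.filter fun q => Disjoint (q • U) U
  -- If `q` fixes `U` pointwise it commutes with `γ`, so it already lies in `H` and must be `p`,
  -- which moves `U` off itself. So `S` always provides a witness.
  have hQ : ∀ γ ∈ rist G U, ∃ q ∈ S, γ⁻¹ * q * γ ∈ H := by
    intro γ hγ
    obtain ⟨H', hH'A, hH'⟩ := hconj γ⁻¹ H hHA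
    obtain ⟨q, hqP, hqH'⟩ := hPA H' hH'A
    rw [hH', inv_inv] at hqH'
    rcases hUP q hqP with h | h
    · have hc : Commute γ q := commute_of_mem_rist hγ h
      have hqH : q ∈ H := by rwa [mul_assoc, ← hc.eq, inv_mul_cancel_left] at hqH'
      have hqp := hH q hqP hqH
      subst hqp
      exact ⟨q, Finset.mem_filter.2 ⟨hqP, hpU₁.mono (Set.smul_set_mono hUU₁) hUU₁⟩, hqH'⟩
    · exact ⟨q, Finset.mem_filter.2 ⟨hqP, h⟩, hqH'⟩
  obtain ⟨ι, _, hHJ⟩ := exists_line_of_confined (S := S) fun q hq => (Finset.mem_filter.1 hq).2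
  obtain ⟨V, hV𝓤, hVU, hV⟩ := hsplit U hU ι
  have hxy : ∀ i, ∃ x y : rist G (V i), x⁻¹ * y⁻¹ * x * y ≠ 1 := by
    intro i
    by_contra! hcon
    refine hne _ (hV𝓤 i) ?_
    rw [← hperf _ (hV𝓤 i), eq_bot_iff, Subgroup.commutator_le]
    intro a ha b hb
    have := hcon (⟨a, ha⟩⁻¹) (⟨b, hb⟩⁻¹)
    simpa [commutatorElement_def, Subtype.ext_iff] using this
  choose x y hz using hxy
  set z : ∀ i, rist G (V i) := fun i => (x i)⁻¹ * (y i)⁻¹ * x i * y i with hzdef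
  let Z : Finset ι → ∀ i, rist G (V i) := fun I i => if i ∈ I then z i else 1
  let Φ := ristProd (G := G) hV
  let B : Set (Subgroup G) := {H | H ∈ A ∧ ∀ γ ∈ rist G U, ∃ q ∈ S, γ⁻¹ * q * γ ∈ H}
  have hBZ : ∀ H ∈ B, ∃ I : Finset ι, I.Nonempty ∧ Φ (Z I) ∈ H := fun H hH =>
    hHJ V hV hVU x y H hH.2
  -- A second minimality argument, on families of index sets detecting all of `B`. Discarding the
  -- sets that contain `l` must lose some `K ∈ B`, so every set of the family detected by `K`
  -- contains `l`.
  obtain ⟨F, ⟨hFne, hFB⟩, hFmin⟩ := exists_minimal_of_wellFoundedLT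
    (fun F : Finset (Finset ι) => (∀ I ∈ F, I.Nonempty) ∧ ∀ H ∈ B, ∃ I ∈ F, Φ (Z I) ∈ H)
    ⟨Finset.univ.filter fun I => I.Nonempty, by simp, by simpa using hBZ⟩
  obtain ⟨I₀, hI₀, -⟩ := hFB H ⟨hHA, hQ⟩
  obtain ⟨l, hl⟩ := hFne I₀ hI₀
  obtain ⟨K, hKB, hK⟩ : ∃ K ∈ B, ∀ I ∈ F, Φ (Z I) ∈ K → l ∈ I := by
    by_contra! hcon
    have := hFmin (y := F.filter fun I => l ∉ I)
      ⟨fun I hI => hFne I (Finset.mem_filter.1 hI).1, fun K hK => ?_⟩ (Finset.filter_subset _ _) hI₀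
    · exact (Finset.mem_filter.1 this).2 hl
    · obtain ⟨I, hI, hIK, hlI⟩ := hcon K hK
      exact ⟨I, Finset.mem_filter.2 ⟨hI, hlI⟩, hIK⟩
  -- If `l ∉ I`, conjugation by `γ` leaves `Z I` unchanged, so `K` contains its image under `Φ`,
  -- against the choice of `K`.
  have hKγ : ∀ γ : rist G (V l), ∃ I, l ∈ I ∧
      Pi.mulSingle l γ⁻¹ * Z I * Pi.mulSingle l γ ∈ K.comap Φ := by
    intro γ
    have hγU : (γ : G) ∈ rist G U := rist_mono (hVU l) γ.2
    obtain ⟨K', hK'A, hK'⟩ := hconj (γ : G)⁻¹ K hKB.1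
    have hK'B : K' ∈ B := by
      refine ⟨hK'A, fun δ hδ => ?_⟩
      obtain ⟨q, hq, hqK⟩ := hKB.2 (δ * γ) (mul_mem hδ hγU)
      refine ⟨q, hq, ?_⟩
      rw [hK']
      convert hqK using 1
      group
    obtain ⟨I, hI, hIK⟩ := hFB K' hK'B
    have hmem : Pi.mulSingle l γ⁻¹ * Z I * Pi.mulSingle l γ ∈ K.comap Φ := by
      rw [hK', inv_inv] at hIK
      rw [Subgroup.mem_comap, map_mul, map_mul]
      simp only [Φ, ristProd_mulSingle]
      exact hIK
    refine ⟨I, ?_, hmem⟩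
    by_contra hlI
    refine hlI (hK I hI ?_)
    have : Pi.mulSingle l γ⁻¹ * Z I * Pi.mulSingle l γ = Z I := by
      funext i
      by_cases hi : i = l
      · subst hi
        simp [Z, hlI]
      · simp [Pi.mulSingle_eq_of_ne hi]
    rwa [this, Subgroup.mem_comap] at hmem
  -- the projection to the `l`-th factor of a suitable subgroup of `K`
  let N : Subgroup (∀ i, rist G (V i)) :=
    K.comap Φ ⊓ Subgroup.pi {l}ᶜ fun i => Subgroup.zpowers (z i)
  let E : Subgroup G := (N.map (Pi.evalMonoidHom _ l)).map (rist G (V l)).subtype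
  -- Coordinates other than `l` are powers of one element `z i`, so they commute, and commutators in
  -- `N` survive only at `l`.
  have hEK : ⁅E, E⁆ ≤ K := by
    rw [Subgroup.commutator_le]
    rintro _ ⟨_, ⟨w, hw, rfl⟩, rfl⟩ _ ⟨_, ⟨w', hw', rfl⟩, rfl⟩
    have h1 : w * w' * w⁻¹ * w'⁻¹ ∈ K.comap Φ :=
      mul_mem (mul_mem (mul_mem hw.1 hw'.1) (inv_mem hw.1)) (inv_mem hw'.1)
    have h2 : w * w' * w⁻¹ * w'⁻¹ = Pi.mulSingle l (w l * w' l * (w l)⁻¹ * (w' l)⁻¹) := by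
      funext i
      by_cases hi : i = l
      · subst hi
        simp
      · rw [Pi.mulSingle_eq_of_ne hi]
        obtain ⟨m, hm⟩ := hw.2 i hi
        obtain ⟨n, hn⟩ := hw'.2 i hi
        simp only [Pi.mul_apply, Pi.inv_apply]
        rw [← hm, ← hn]
        simp only
        rw [(Commute.zpow_zpow_self (z i) m n).eq, mul_inv_cancel_right, mul_inv_cancel]
    rw [h2, Subgroup.mem_comap] at h1
    simp only [Φ, ristProd_mulSingle] at h1
    exact h1
  have hEz : ∀ γ ∈ rist G (V l), γ⁻¹ * z l * γ ∈ E := by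
    intro γ hγ
    obtain ⟨I, hlI, hI⟩ := hKγ ⟨γ, hγ⟩
    refine ⟨_, ⟨_, ⟨hI, fun i hi => ?_⟩, rfl⟩, ?_⟩
    · have hi' : i ≠ l := hi
      by_cases hiI : i ∈ I
      · simp [Pi.mulSingle_eq_of_ne hi', Z, hiI]
      · simp [Pi.mulSingle_eq_of_ne hi', Z, hiI]
    · simp [Z, hlI]
  obtain ⟨v, hv, hzv⟩ : ∃ v ∈ V l, (z l : G) • v ≠ v := by
    by_contra! hcon
    refine hz l (Subtype.ext (FaithfulSMul.eq_of_smul_eq_smul (α := X) fun v => ?_))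
    rw [OneMemClass.coe_one, one_smul]
    by_cases hv : v ∈ V l
    · exact hcon v hv
    · exact mem_rist.1 (z l).2 v hv
  obtain ⟨U', hU', hU'V, hzU'⟩ := hmove (z l) (V l) (hV𝓤 l) ⟨v, hv, hzv⟩
  refine ⟨K, hKB.1, U', hU', ?_⟩
  -- The double commutator argument again, with `z l` in the role of `p`. Perfectness then passes
  -- from `E` to its derived subgroup, which lies in `K`.
  have hE : rist G U' ≤ E := rist_le_of_conj_mem hzU' (hperf U' hU') fun γ hγ =>
    hEz γ (rist_mono hU'V hγ)
  rw [← hperf U' hU']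
  exact (Subgroup.commutator_mono hE hE).trans hEK

end RigidStabilizer

/-- A locally finite group is amenable. -/
theorem isAmenable_of_locallyFinite {G : Type*} [Group G]
    (h : ∀ s : Finset G, ∃ K : Subgroup G, Finite K ∧ ∀ g ∈ s, g ∈ K) : IsAmenable G := by
  choose K hK hsK using h
  -- The mean is a limit of the uniform probabilities on the finite subgroups `K s`; a given `g`
  -- eventually belongs to `K s`, whence invariance.
  let u : Ultrafilter (Finset G) := Ultrafilter.of atTop
  have hu : (u : Filter (Finset G)) ≤ atTop := Ultrafilter.of_le _
  let f : Set G → Finset G → ℝ := fun A s => ((A ∩ K s).ncard : ℝ) / (Nat.card (K s) : ℝ)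
  have hpos : ∀ s, (0 : ℝ) < Nat.card (K s) := fun s => by
    have := hK s
    exact_mod_cast Nat.card_pos
  have hfin : ∀ A s, (A ∩ (K s : Set G)).Finite := fun A s =>
    have := hK s
    (Set.toFinite (K s : Set G)).subset Set.inter_subset_right
  have hf0 : ∀ A s, 0 ≤ f A s := fun A s => by positivity
  have hf1 : ∀ A s, f A s ≤ 1 := fun A s => by
    refine (div_le_one (hpos s)).2 ?_
    have := hK s
    have h1 := Set.ncard_le_ncard (Set.inter_subset_right (s := A) (t := (K s : Set G)))
      (Set.toFinite _)
    rw [← Nat.card_coe_set_eq (K s : Set G)] at h1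
    exact_mod_cast h1
  have hlim : ∀ A, ∃ x, Tendsto (f A) u (𝓝 x) := fun A => by
    obtain ⟨x, -, hx⟩ := isCompact_Icc.ultrafilter_le_nhds (u.map (f A))
      (le_principal_iff.2 (mem_map.2 (univ_mem' fun s => Set.mem_Icc.2 ⟨hf0 A s, hf1 A s⟩)))
    exact ⟨x, hx⟩
  choose m hm using hlim
  refine ⟨m, fun A => ge_of_tendsto' (hm A) (hf0 A), ?_, fun A B hAB => ?_, fun g A => ?_⟩
  · refine tendsto_nhds_unique (hm Set.univ) (tendsto_const_nhds.congr fun s => ?_)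
    simp only [f, Set.univ_inter]
    rw [← Nat.card_coe_set_eq (K s : Set G)]
    exact (div_self (hpos s).ne').symm
  · refine tendsto_nhds_unique (hm (A ∪ B)) (((hm A).add (hm B)).congr fun s => ?_)
    simp only [f]
    rw [Set.union_inter_distrib_right, Set.ncard_union_eq
      (hAB.mono Set.inter_subset_left Set.inter_subset_left) (hfin A s) (hfin B s)]
    push_cast
    ring
  · refine tendsto_nhds_unique (hm _) ((hm A).congr' ?_)
    filter_upwards [hu (eventually_ge_atTop {g})] with s hs
    have hg : g ∈ K s := hsK s g (hs (Finset.mem_singleton_self g))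
    have : (fun x => g * x) '' A ∩ (K s : Set G) = (fun x => g * x) '' (A ∩ K s) := by
      ext y
      constructor
      · rintro ⟨⟨x, hx, rfl⟩, hy⟩
        exact ⟨x, ⟨hx, (Subgroup.mul_mem_cancel_left _ hg).1 hy⟩, rfl⟩
      · rintro ⟨x, ⟨hx, hxK⟩, rfl⟩
        exact ⟨⟨x, hx, rfl⟩, mul_mem hg hxK⟩
    simp only [f]
    rw [this, Set.ncard_image_of_injective _ (mul_right_injective g)]

/-! ### Half-trees -/

section HalfTree

variable {V : Type*} {T : SimpleGraph V}

theorem mem_halfTree_self (v w : V) : w ∈ halfTree T v w := SimpleGraph.Reachable.refl w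

theorem halfTree_induction {v w : V} {p : V → Prop} (h0 : p w)
    (hstep : ∀ x y, x ∈ halfTree T v w → T.Adj x y → y ∈ halfTree T v w → p x → p y) {u : V}
    (hu : u ∈ halfTree T v w) : p u := by
  have hu' : (T.deleteEdges {s(v, w)}).Reachable w u := hu
  rw [SimpleGraph.reachable_iff_reflTransGen] at hu'
  induction hu' with
  | refl => exact h0
  | tail h1 h2 ih =>
    rename_i x y
    have hx : x ∈ halfTree T v w := (SimpleGraph.reachable_iff_reflTransGen _ _).2 h1
    exact hstep x y hx (SimpleGraph.deleteEdges_le _ h2) hu (ih hx)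

theorem mem_halfTree_of_adj {v w x y : V} (hx : x ∈ halfTree T v w) (hxy : T.Adj x y)
    (hne : s(x, y) ≠ s(v, w)) : y ∈ halfTree T v w := by
  have hx' : (T.deleteEdges {s(v, w)}).Reachable w x := hx
  refine hx'.trans (SimpleGraph.Adj.reachable ?_)
  rw [SimpleGraph.deleteEdges_adj]
  exact ⟨hxy, hne⟩

theorem notMem_halfTree_self (hT : T.IsTree) {v w : V} (h : T.Adj v w) : v ∉ halfTree T v w := by
  intro hv
  have := SimpleGraph.isAcyclic_iff_forall_adj_isBridge.1 hT.isAcyclic h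
  rw [SimpleGraph.isBridge_iff] at this
  exact this (SimpleGraph.Reachable.symm hv)

/-- The only edge through which one can enter a half-tree is the edge defining it. -/
theorem eq_of_adj_of_notMem (hT : T.IsTree) {v w x y : V} (h : T.Adj v w) (hxy : T.Adj x y)
    (hx : x ∉ halfTree T v w) (hy : y ∈ halfTree T v w) : x = v ∧ y = w := by
  by_contra hcon
  refine hx (mem_halfTree_of_adj hy hxy.symm fun heq => ?_)
  rcases Sym2.eq_iff.1 heq with ⟨rfl, rfl⟩ | ⟨rfl, rfl⟩
  · exact notMem_halfTree_self hT h hy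
  · exact hcon ⟨rfl, rfl⟩

theorem connected_induction (hT : T.IsTree) {p : V → Prop} {v : V} (h0 : p v)
    (hstep : ∀ x y, T.Adj x y → p x → p y) (u : V) : p u := by
  have h := (SimpleGraph.reachable_iff_reflTransGen v u).1 (hT.connected.preconnected v u)
  induction h with
  | refl => exact h0
  | tail _ h2 ih => exact hstep _ _ h2 ih

/-- A path inside the first half-tree, starting at `w`, could enter the second only at `w'`, which
it never visits. -/
theorem halfTree_disjoint_of_notMem (hT : T.IsTree) {v w v' w' : V} (h' : T.Adj v' w')
    (h1 : w ∉ halfTree T v' w') (h2 : w' ∉ halfTree T v w) :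
    Disjoint (halfTree T v w) (halfTree T v' w') := by
  rw [Set.disjoint_left]
  intro u hu
  refine halfTree_induction (p := fun u => u ∉ halfTree T v' w') h1 (fun x y _ hxy hy hx' hy' => ?_)
    hu
  exact h2 ((eq_of_adj_of_notMem hT h' hxy hx' hy').2 ▸ hy)

theorem compl_halfTree (hT : T.IsTree) {v w : V} (h : T.Adj v w) :
    (halfTree T v w)ᶜ = halfTree T w v := by
  have hd : Disjoint (halfTree T v w) (halfTree T w v) :=
    halfTree_disjoint_of_notMem hT h.symm (notMem_halfTree_self hT h.symm)
      (notMem_halfTree_self hT h)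
  refine subset_antisymm (fun u hu => ?_) (Set.disjoint_left.1 hd.symm)
  have : u ∈ halfTree T v w ∨ u ∈ halfTree T w v := by
    refine connected_induction hT (p := fun u => u ∈ halfTree T v w ∨ u ∈ halfTree T w v)
      (Or.inl (mem_halfTree_self v w)) (fun x y hxy hx => ?_) u
    by_cases heq : s(x, y) = s(v, w)
    · rcases Sym2.eq_iff.1 heq with ⟨rfl, rfl⟩ | ⟨rfl, rfl⟩
      · exact Or.inl (mem_halfTree_self _ _)
      · exact Or.inr (mem_halfTree_self _ _)
    · refine hx.imp (fun h => mem_halfTree_of_adj h hxy heq) fun h => mem_halfTree_of_adj h hxy ?_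
      rwa [Sym2.eq_swap (a := w)]
  exact this.resolve_left hu

theorem notMem_halfTree (hT : T.IsTree) {v w u : V} (h : T.Adj v w) :
    u ∉ halfTree T v w ↔ u ∈ halfTree T w v := by
  rw [← compl_halfTree hT h, Set.mem_compl_iff]

theorem halfTree_disjoint (hT : T.IsTree) {v x y : V} (hx : T.Adj v x) (hy : T.Adj v y)
    (hxy : x ≠ y) : Disjoint (halfTree T v x) (halfTree T v y) := by
  refine halfTree_disjoint_of_notMem hT hy (fun h => ?_) fun h => ?_
  · exact hxy (eq_of_adj_of_notMem hT hy hx (notMem_halfTree_self hT hy) h).2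
  · exact hxy (eq_of_adj_of_notMem hT hx hy (notMem_halfTree_self hT hx) h).2.symm

theorem halfTree_subset (hT : T.IsTree) {v w x : V} (h : T.Adj v w) (hx : T.Adj w x) (hxv : x ≠ v) :
    halfTree T w x ⊆ halfTree T v w := by
  intro u hu
  by_contra hu'
  rw [notMem_halfTree hT h] at hu'
  exact Set.disjoint_left.1 (halfTree_disjoint hT hx h.symm hxv) hu hu'

theorem exists_mem_halfTree (hT : T.IsTree) {v u : V} (h : u ≠ v) :
    ∃ x, T.Adj v x ∧ u ∈ halfTree T v x := by
  have := connected_induction hT (v := v)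
    (p := fun u => u ≠ v → ∃ x, T.Adj v x ∧ u ∈ halfTree T v x)
    (fun h => absurd rfl h) (fun x y hxy hx hy => ?_) u
  · exact this h
  · by_cases hxv : x = v
    · subst hxv
      exact ⟨y, hxy, mem_halfTree_self _ _⟩
    · obtain ⟨z, hz, hxz⟩ := hx hxv
      refine ⟨z, hz, mem_halfTree_of_adj hxz hxy fun heq => ?_⟩
      rcases Sym2.eq_iff.1 heq with ⟨rfl, rfl⟩ | ⟨rfl, rfl⟩
      · exact hxv rfl
      · exact hy rfl

theorem exists_mem_halfTree_of_mem (hT : T.IsTree) {v w u : V} (h : T.Adj v w)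
    (hu : u ∈ halfTree T v w) (huw : u ≠ w) : ∃ x, T.Adj w x ∧ x ≠ v ∧ u ∈ halfTree T w x := by
  obtain ⟨x, hx, hux⟩ := exists_mem_halfTree hT huw
  refine ⟨x, hx, ?_, hux⟩
  rintro rfl
  exact (notMem_halfTree hT h).2 hux hu

theorem map_mem_halfTree (hT : T.IsTree) (g : T ≃g T) {v w u : V} :
    g u ∈ halfTree T (g v) (g w) ↔ u ∈ halfTree T v w := by
  have key : ∀ (g : T ≃g T) {v w u : V}, u ∈ halfTree T v w → g u ∈ halfTree T (g v) (g w) := by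
    intro g v w u hu
    refine halfTree_induction (p := fun u => g u ∈ halfTree T (g v) (g w)) (mem_halfTree_self _ _)
      (fun x y hx hxy hy hgx => ?_) hu
    by_cases heq : s(x, y) = s(v, w)
    · rcases Sym2.eq_iff.1 heq with ⟨rfl, rfl⟩ | ⟨rfl, rfl⟩
      · exact mem_halfTree_self _ _
      · exact absurd hy (notMem_halfTree_self hT hxy.symm)
    · refine mem_halfTree_of_adj hgx (g.map_adj_iff.2 hxy) fun h => heq ?_
      have h' : Sym2.map g s(x, y) = Sym2.map g s(v, w) := h
      exact Sym2.map.injective g.injective h'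
  refine ⟨fun h => ?_, key g⟩
  have := key g.symm h
  simpa using this

/-- A walk from `v` into the half-tree must cross the edge to `w`, and what remains is strictly
shorter. -/
theorem dist_lt_of_mem_halfTree (hT : T.IsTree) {v w u : V} (h : T.Adj v w)
    (hu : u ∈ halfTree T v w) : T.dist w u < T.dist v u := by
  obtain ⟨p, hp⟩ := hT.connected.exists_walk_length_eq_dist v u
  have hw : ∀ {a b : V} (p : T.Walk a b), a ∉ halfTree T v w → b ∈ halfTree T v w →
      T.dist w b < p.length := by
    intro a b p
    induction p with
    | nil => exact fun h1 h2 => absurd h2 h1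
    | cons hab q ih =>
      rename_i a c b
      intro h1 h2
      by_cases hc : c ∈ halfTree T v w
      · obtain ⟨-, rfl⟩ := eq_of_adj_of_notMem hT h hab h1 hc
        rw [SimpleGraph.Walk.length_cons]
        exact Nat.lt_succ_of_le (SimpleGraph.dist_le q)
      · rw [SimpleGraph.Walk.length_cons]
        exact (ih hc h2).trans (Nat.lt_succ_self _)
  rw [← hp]
  exact hw p (notMem_halfTree_self hT h) hu

end HalfTree

/-! ### Automorphisms built from local permutations, and rigidity. -/

section Colouring

variable {V Ω : Type*} {T : SimpleGraph V} (c : EdgeColouring T Ω)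

/-- The neighbour of `v` along the edge of colour `a`. -/
noncomputable def EdgeColouring.step (v : V) (a : Ω) : V := ((c.around v).symm a).1

namespace EdgeColouring

theorem adj_step (v : V) (a : Ω) : T.Adj v (c.step v a) := ((c.around v).symm a).2

theorem around_step (v : V) (a : Ω) : c.around v ⟨c.step v a, c.adj_step v a⟩ = a :=
  (c.around v).apply_symm_apply a

theorem around_symm {v w : V} (h : T.Adj v w) : c.around w ⟨v, h.symm⟩ = c.around v ⟨w, h⟩ := by
  change c.colour ⟨s(w, v), _⟩ = c.colour ⟨s(v, w), _⟩
  congr 2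
  exact Sym2.eq_swap

theorem step_around {v w : V} (h : T.Adj v w) : c.step v (c.around v ⟨w, h⟩) = w := by
  rw [step, Equiv.symm_apply_apply]

theorem exists_step {v w : V} (h : T.Adj v w) : ∃ a, w = c.step v a :=
  ⟨_, (c.step_around h).symm⟩

theorem step_step (v : V) (a : Ω) : c.step (c.step v a) a = v := by
  have h := c.around_symm (c.adj_step v a)
  rw [c.around_step] at h
  have h' := c.step_around (c.adj_step v a).symm
  rwa [h] at h'

theorem step_injective (v : V) : Function.Injective (c.step v) := fun _ _ h =>
  (c.around v).symm.injective (Subtype.ext h)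

theorem map_step (g : T ≃g T) (v : V) (a : Ω) :
    g (c.step v a) = c.step (g v) (c.localPerm g v a) := by
  change _ = ((c.around (g v)).symm ((c.around (g v)) (g.mapNeighborSet v ((c.around v).symm a)))).1
  rw [Equiv.symm_apply_apply]
  rfl

theorem localPerm_apply_eq {g : T ≃g T} {v : V} {a b : Ω} (h : g (c.step v a) = c.step (g v) b) :
    c.localPerm g v a = b :=
  c.step_injective (g v) ((c.map_step g v a).symm.trans h)

/-- The edge of colour `a` is seen from both its ends. By `exists_aut` this is the only constraint
on a family of local permutations. -/
theorem localPerm_step (g : T ≃g T) (v : V) (a : Ω) :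
    c.localPerm g (c.step v a) a = c.localPerm g v a := by
  refine c.localPerm_apply_eq ?_
  rw [c.step_step, c.map_step, c.step_step]

theorem localPerm_apply_self {g : T ≃g T} {v : V} {a : Ω} (h : g v = v)
    (h' : g (c.step v a) = c.step v a) : c.localPerm g v a = a :=
  c.localPerm_apply_eq (by rw [h', h])

/-- The endpoint of the path starting at `v` whose edges have the given colours. -/
noncomputable def go (v : V) (l : List Ω) : V := l.foldl c.step v

@[simp] theorem go_nil (v : V) : c.go v [] = v := rfl

@[simp] theorem go_cons (v : V) (a : Ω) (l : List Ω) : c.go v (a :: l) = c.go (c.step v a) l := rfl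

theorem go_append (v : V) (l l' : List Ω) : c.go v (l ++ l') = c.go (c.go v l) l' :=
  List.foldl_append

theorem go_concat (v : V) (l : List Ω) (a : Ω) : c.go v (l ++ [a]) = c.step (c.go v l) a := by
  rw [go_append]
  rfl

theorem halfTree_step_subset (hT : T.IsTree) (v : V) {a b : Ω} (h : a ≠ b) :
    halfTree T (c.step v a) (c.step (c.step v a) b) ⊆ halfTree T v (c.step v a) := by
  refine halfTree_subset hT (c.adj_step v a) (c.adj_step _ b) fun h' => h ?_
  have := (c.step_step v a).trans h'.symm
  exact c.step_injective _ this

theorem go_cons_mem (hT : T.IsTree) (v : V) (a : Ω) (l : List Ω)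
    (hl : (a :: l).IsChain (· ≠ ·)) : c.go v (a :: l) ∈ halfTree T v (c.step v a) := by
  induction l generalizing v a with
  | nil => exact mem_halfTree_self _ _
  | cons b l ih =>
    rw [List.isChain_cons_cons] at hl
    exact c.halfTree_step_subset hT v hl.1 (ih (c.step v a) b hl.2)

theorem go_injective (hT : T.IsTree) (v : V) {l l' : List Ω} (hl : l.IsChain (· ≠ ·))
    (hl' : l'.IsChain (· ≠ ·)) (h : c.go v l = c.go v l') : l = l' := by
  induction l generalizing v l' with
  | nil =>
    cases l' with
    | nil => rfl
    | cons a l' =>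
      have h1 := c.go_cons_mem hT v a l' hl'
      rw [← h] at h1
      exact absurd h1 (notMem_halfTree_self hT (c.adj_step v a))
  | cons a l ih =>
    cases l' with
    | nil =>
      have h1 := c.go_cons_mem hT v a l hl
      rw [h] at h1
      exact absurd h1 (notMem_halfTree_self hT (c.adj_step v a))
    | cons b l' =>
      have h1 := c.go_cons_mem hT v a l hl
      have h2 := c.go_cons_mem hT v b l' hl'
      by_cases hab : a = b
      · subst hab
        rw [ih (c.step v a) (l' := l') hl.tail hl'.tail h]
      · rw [h] at h1
        exact absurd h2 (Set.disjoint_left.1 (halfTree_disjoint hT (c.adj_step v a)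
          (c.adj_step v b) fun h => hab (c.step_injective v h)) h1)

theorem exists_go (hT : T.IsTree) (v u : V) : ∃ l : List Ω, l.IsChain (· ≠ ·) ∧ c.go v l = u := by
  refine connected_induction hT (v := v)
    (p := fun u => ∃ l : List Ω, l.IsChain (· ≠ ·) ∧ c.go v l = u) ⟨[], List.isChain_nil, rfl⟩
    (fun x y hxy ⟨l, hl, hx⟩ => ?_) u
  obtain ⟨a, rfl⟩ := c.exists_step hxy
  by_cases h : ∀ b ∈ l.getLast?, b ≠ a
  · refine ⟨l ++ [a], ?_, by rw [go_concat, hx]⟩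
    rw [List.isChain_append]
    exact ⟨hl, List.isChain_singleton a, fun b hb d hd => by
      simp only [List.head?_cons, Option.mem_some_iff] at hd
      exact hd ▸ h b hb⟩
  · push Not at h
    obtain ⟨b, hb, rfl⟩ := h
    obtain ⟨l', rfl⟩ := List.mem_getLast?_eq_getLast hb |>.elim fun hne hbl =>
      (⟨l.dropLast, by rw [hbl, List.dropLast_append_getLast]⟩ : ∃ l', l = l' ++ [b])
    refine ⟨l', (List.isChain_append.1 hl).1, ?_⟩
    rw [go_concat] at hx
    rw [← hx, c.step_step]

/-- The word obtained by applying the permutations `σ` along the path with colours `l`. -/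
noncomputable def twist (σ : V → Equiv.Perm Ω) (v : V) : List Ω → List Ω
  | [] => []
  | a :: l => σ v a :: twist σ (c.step v a) l

theorem twist_concat (σ : V → Equiv.Perm Ω) (v : V) (l : List Ω) (a : Ω) :
    c.twist σ v (l ++ [a]) = c.twist σ v l ++ [σ (c.go v l) a] := by
  induction l generalizing v with
  | nil => rfl
  | cons b l ih => simp [twist, ih]

theorem twist_injective (σ : V → Equiv.Perm Ω) (v : V) : Function.Injective (c.twist σ v) := by
  intro l l' h
  induction l generalizing v l' with
  | nil =>
    cases l' with
    | nil => rfl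
    | cons b l' => simp [twist] at h
  | cons a l ih =>
    cases l' with
    | nil => simp [twist] at h
    | cons b l' =>
      simp only [twist, List.cons.injEq, EmbeddingLike.apply_eq_iff_eq] at h
      obtain ⟨rfl, h⟩ := h
      rw [ih _ h]

theorem twist_isChain {σ : V → Equiv.Perm Ω} (hσ : ∀ v a, σ (c.step v a) a = σ v a) (v : V)
    {l : List Ω} (hl : l.IsChain (· ≠ ·)) : (c.twist σ v l).IsChain (· ≠ ·) := by
  induction l generalizing v with
  | nil => exact List.isChain_nil
  | cons a l ih =>
    cases l with
    | nil => exact List.isChain_singleton _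
    | cons b l =>
      rw [List.isChain_cons_cons] at hl
      have := ih (c.step v a) hl.2
      simp only [twist] at this ⊢
      rw [List.isChain_cons_cons]
      refine ⟨?_, this⟩
      rw [← hσ v a]
      exact (σ _).injective.ne hl.1

/-- Existence of automorphisms with prescribed local permutations. -/
theorem exists_aut (hT : T.IsTree) (v₀ v₁ : V) {σ : V → Equiv.Perm Ω}
    (hσ : ∀ v a, σ (c.step v a) a = σ v a) :
    ∃ g : T ≃g T, g v₀ = v₁ ∧ ∀ v, c.localPerm g v = σ v := by
  choose w hw hgo using c.exists_go hT v₀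
  -- Reduced words are coordinates for the vertices, based at `v₀`; each letter is rewritten by the
  -- permutation prescribed at the vertex where it is read.
  let f : V → V := fun u => c.go v₁ (c.twist σ v₀ (w u))
  have hwgo : ∀ l : List Ω, l.IsChain (· ≠ ·) → w (c.go v₀ l) = l := fun l hl =>
    c.go_injective hT v₀ (hw _) hl (hgo _)
  have hstep : ∀ u a, f (c.step u a) = c.step (f u) (σ u a) := by
    intro u a
    -- The step either cancels the last letter of the word or extends it.
    by_cases h : ∃ l, w u = l ++ [a]
    · obtain ⟨l, hl⟩ := h
      have hlc : l.IsChain (· ≠ ·) := (List.isChain_append.1 (hl ▸ hw u)).1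
      have hu : u = c.step (c.go v₀ l) a := by rw [← hgo u, hl, go_concat]
      have h1 : c.step u a = c.go v₀ l := by rw [hu, c.step_step]
      simp only [f]
      rw [h1, hwgo l hlc, hl, twist_concat, go_concat, hu, hσ, c.step_step]
    · have hch : (w u ++ [a]).IsChain (· ≠ ·) := by
        rw [List.isChain_append]
        refine ⟨hw u, List.isChain_singleton a, fun b hb d hd => ?_⟩
        simp only [List.head?_cons, Option.mem_some_iff] at hd
        subst hd
        rintro rfl
        exact h (List.mem_getLast?_eq_getLast hb |>.elim fun hne hbl =>
          ⟨(w u).dropLast, by rw [hbl, List.dropLast_append_getLast]⟩)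
      have h1 : c.step u a = c.go v₀ (w u ++ [a]) := by rw [go_concat, hgo]
      simp only [f]
      rw [h1, hwgo _ hch, twist_concat, go_concat, hgo]
  have hinj : Function.Injective f := by
    intro u u' h
    have := c.twist_injective σ v₀ (c.go_injective hT v₁ (c.twist_isChain hσ v₀ (hw u))
      (c.twist_isChain hσ v₀ (hw u')) h)
    rw [← hgo u, this, hgo]
  have h0 : f v₀ = v₁ := by
    have : w v₀ = [] := hwgo [] List.isChain_nil
    simp [f, this, twist]
  have hsurj : Function.Surjective f := by
    intro u
    refine connected_induction hT (v := v₁) (p := fun u => ∃ x, f x = u) ⟨v₀, h0⟩ ?_ u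
    rintro _ y hxy ⟨x, rfl⟩
    obtain ⟨a, rfl⟩ := c.exists_step hxy
    refine ⟨c.step x ((σ x).symm a), ?_⟩
    rw [hstep, Equiv.apply_symm_apply]
  let g : T ≃g T := ⟨Equiv.ofBijective f ⟨hinj, hsurj⟩, by
    intro u v
    change T.Adj (f u) (f v) ↔ T.Adj u v
    constructor
    · intro h
      obtain ⟨a, ha⟩ := c.exists_step h
      have : f v = f (c.step u ((σ u).symm a)) := by rw [hstep, Equiv.apply_symm_apply, ha]
      rw [hinj this]
      exact c.adj_step _ _
    · intro h
      obtain ⟨a, rfl⟩ := c.exists_step h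
      rw [hstep]
      exact c.adj_step _ _⟩
  exact ⟨g, h0, fun v => Equiv.ext fun a => c.localPerm_apply_eq (hstep v a)⟩

theorem eqOn_halfTree {g h : T ≃g T} {v w : V} (h0 : g w = h w)
    (heq : ∀ u ∈ halfTree T v w, c.localPerm g u = c.localPerm h u) {u : V}
    (hu : u ∈ halfTree T v w) : g u = h u := by
  refine halfTree_induction (p := fun u => g u = h u) h0 (fun x y hx hxy _ hgx => ?_) hu
  obtain ⟨a, rfl⟩ := c.exists_step hxy
  rw [c.map_step, c.map_step, hgx, heq x hx]

/-- The automorphism equal to `g` on a half-tree and to the identity outside. -/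
theorem exists_glue (hT : T.IsTree) {g : T ≃g T} {v w : V} (h : T.Adj v w) (hv : g v = v)
    (hw : g w = w) : ∃ k : T ≃g T, (∀ u ∉ halfTree T v w, k u = u ∧ c.localPerm k u = 1) ∧
      ∀ u ∈ halfTree T v w, k u = g u ∧ c.localPerm k u = c.localPerm g u := by
  classical
  obtain ⟨a, rfl⟩ := c.exists_step h
  have ha : c.localPerm g v a = a := c.localPerm_apply_self hv hw
  -- Only the base edge joins the two regions, and both prescriptions fix its colour.
  obtain ⟨k, hk, hσ⟩ := c.exists_aut hT v v
    (σ := fun u => if u ∈ halfTree T v (c.step v a) then c.localPerm g u else 1) (by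
      intro u b
      by_cases h1 : u ∈ halfTree T v (c.step v a) <;>
        by_cases h2 : c.step u b ∈ halfTree T v (c.step v a)
      · simp only [h1, h2, if_true]
        exact c.localPerm_step g u b
      · obtain ⟨h3, rfl⟩ := eq_of_adj_of_notMem hT h (c.adj_step u b).symm h2 h1
        obtain rfl : b = a := c.step_injective (c.step v a) (h3.trans (c.step_step v a).symm)
        simp only [h1, h2, if_true, if_false, c.localPerm_step, ha, Equiv.Perm.one_apply]
      · obtain ⟨rfl, h3⟩ := eq_of_adj_of_notMem hT h (c.adj_step u b) h1 h2
        obtain rfl : b = a := c.step_injective u h3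
        simp only [h1, h2, if_true, if_false, c.localPerm_step, ha, Equiv.Perm.one_apply]
      · simp only [h1, h2, if_false])
  have hka : k (c.step v a) = c.step v a := by
    rw [c.map_step, hk, hσ, if_neg (notMem_halfTree_self hT h), Equiv.Perm.one_apply]
  refine ⟨k, fun u hu => ⟨?_, by rw [hσ, if_neg hu]⟩, fun u hu => ⟨?_, by rw [hσ, if_pos hu]⟩⟩
  · rw [notMem_halfTree hT h] at hu
    refine c.eqOn_halfTree (h := 1) hk (fun x hx => ?_) hu
    rw [hσ, if_neg ((notMem_halfTree hT h).2 hx), c.localPerm_one]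
  · exact c.eqOn_halfTree (hka.trans hw.symm) (fun x hx => by rw [hσ, if_pos hx]) hu

/-- An automorphism fixing `w` with prescribed constant local permutations on each branch. -/
theorem exists_spherical [Nonempty Ω] (hT : T.IsTree) (w : V) (f : Equiv.Perm Ω)
    (φ : Ω → Equiv.Perm Ω)
    (hφ : ∀ b, φ b b = f b) : ∃ g : T ≃g T, g w = w ∧ c.localPerm g w = f ∧
      ∀ b, ∀ u ∈ halfTree T w (c.step w b), c.localPerm g u = φ b := by
  classical
  have hbr : ∀ u, ∃ b, u ≠ w → u ∈ halfTree T w (c.step w b) := by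
    intro u
    by_cases hu : u = w
    · exact ⟨Classical.arbitrary Ω, fun h => absurd hu h⟩
    · obtain ⟨x, hx, hux⟩ := exists_mem_halfTree hT hu
      obtain ⟨b, rfl⟩ := c.exists_step hx
      exact ⟨b, fun _ => hux⟩
  choose br hbr using hbr
  have hbru : ∀ b, ∀ u ∈ halfTree T w (c.step w b), br u = b ∧ u ≠ w := by
    intro b u hu
    have huw : u ≠ w := fun h => notMem_halfTree_self hT (c.adj_step w b) (h ▸ hu)
    refine ⟨?_, huw⟩
    by_contra hne
    exact Set.disjoint_left.1 (halfTree_disjoint hT (c.adj_step w (br u)) (c.adj_step w b)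
      fun h => hne (c.step_injective w h)) (hbr u huw) hu
  -- The prescription is constant on each branch, so only the edges at `w` impose a condition,
  -- namely `hφ`.
  obtain ⟨g, hg, hσ⟩ := c.exists_aut hT w w (σ := fun u => if u = w then f else φ (br u)) (by
    intro u a
    by_cases hu : u = w
    · subst hu
      have h1 := hbru a _ (mem_halfTree_self u (c.step u a))
      simp only [h1.2, if_false, if_true, h1.1, hφ]
    · by_cases hu' : c.step u a = w
      · subst hu'
        have h1 := hbru a u (by
          have := mem_halfTree_self (T := T) (c.step u a) (c.step (c.step u a) a)
          rwa [c.step_step] at this ⊢)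
        simp only [h1.1, hu, if_true, if_false, hφ]
      · have h1 := mem_halfTree_of_adj (hbr u hu) (c.adj_step u a) (by
          intro h
          rcases Sym2.eq_iff.1 h with ⟨h, -⟩ | ⟨-, h⟩
          · exact hu h
          · exact hu' h)
        simp only [hu, hu', if_false, (hbru _ _ h1).1])
  refine ⟨g, hg, by rw [hσ, if_pos rfl], fun b u hu => ?_⟩
  rw [hσ, if_neg (hbru b u hu).2, (hbru b u hu).1]

/-- Free local permutations propagate: if all local permutations on a half-tree lie in a subgroup
acting freely, then the condition of being fixed with trivial local permutation holds everywhere or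
nowhere on the half-tree. -/
theorem fixed_iff_of_free {F : Subgroup (Equiv.Perm Ω)} (hfree : ∀ f ∈ F, ∀ a : Ω, f a = a → f = 1)
    {g : T ≃g T} {v w : V} (hF : ∀ u ∈ halfTree T v w, c.localPerm g u ∈ F) {u : V}
    (hu : u ∈ halfTree T v w) :
    (g u = u ∧ c.localPerm g u = 1) ↔ (g w = w ∧ c.localPerm g w = 1) := by
  have key : ∀ x y, T.Adj x y → y ∈ halfTree T v w → g x = x ∧ c.localPerm g x = 1 →
      g y = y ∧ c.localPerm g y = 1 := by
    rintro x y hxy hy ⟨h1, h2⟩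
    obtain ⟨a, rfl⟩ := c.exists_step hxy
    refine ⟨by rw [c.map_step, h1, h2, Equiv.Perm.one_apply], hfree _ (hF _ hy) a ?_⟩
    rw [c.localPerm_step, h2, Equiv.Perm.one_apply]
  refine halfTree_induction (p := fun u => (g u = u ∧ c.localPerm g u = 1) ↔
    (g w = w ∧ c.localPerm g w = 1)) Iff.rfl (fun x y hx hxy hy h => ?_) hu
  exact ⟨fun h' => h.1 (key y x hxy.symm hx h'), fun h' => key x y hxy hy (h.2 h')⟩

/-- Fixing the base edge gives the local permutation at `w` a fixed colour; freeness makes it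
trivial, and triviality propagates. -/
theorem fixed_of_free {F : Subgroup (Equiv.Perm Ω)} (hfree : ∀ f ∈ F, ∀ a : Ω, f a = a → f = 1)
    {g : T ≃g T} {v w : V} (hF : ∀ u ∈ halfTree T v w, c.localPerm g u ∈ F) (h : T.Adj v w)
    (hv : g v = v) (hw : g w = w) {u : V} (hu : u ∈ halfTree T v w) :
    g u = u ∧ c.localPerm g u = 1 := by
  refine (c.fixed_iff_of_free hfree hF hu).2 ⟨hw, ?_⟩
  obtain ⟨a, ha⟩ := c.exists_step h.symm
  refine hfree _ (hF _ (mem_halfTree_self v w)) a (c.localPerm_apply_self hw ?_)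
  rw [← ha, hv]

end EdgeColouring

end Colouring

/-! ### Type-preserving automorphisms. -/

section TypePreserving

variable {V : Type*} {T : SimpleGraph V}

theorem mem_typePreserving_of_walk (hT : T.IsTree) {g : T ≃g T} {v : V} (p : T.Walk v (g v))
    (hp : Even p.length) : g ∈ typePreserving T := by
  intro u
  obtain ⟨q⟩ := hT.connected.preconnected v u
  let q' : T.Walk (g v) (g u) := q.map (g : T →g T)
  have hl : ((q.reverse.append p).append q').length = q.length + p.length + q.length := by
    simp [q']
  refine ⟨(q.reverse.append p).append q', ?_⟩
  rw [hl]
  obtain ⟨k, hk⟩ := hp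
  exact ⟨q.length + k, by omega⟩

theorem mem_typePreserving_of_fixed (hT : T.IsTree) {g : T ≃g T} {v : V} (h : g v = v) :
    g ∈ typePreserving T :=
  mem_typePreserving_of_walk hT (v := v) (SimpleGraph.Walk.nil.copy rfl h.symm) (by simp)

theorem not_adj_of_mem_typePreserving (hT : T.IsTree) {g : T ≃g T} (hg : g ∈ typePreserving T)
    (v : V) : ¬ T.Adj v (g v) := by
  intro h
  obtain ⟨p, hp⟩ := hg v
  let C : T.Coloring Bool := hT.colorable_two.toColoring (by simp)
  have h1 := (C.even_length_iff_congr p).1 hp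
  exact C.valid h (Bool.eq_iff_iff.2 h1)

end TypePreserving

/-! ### Rays, ends and cones -/

section Ends

variable {V : Type*} {T : SimpleGraph V}

theorem halfTree_subset_of_notMem (hT : T.IsTree) {v w x y : V} (h : T.Adj v w)
    (hv : v ∉ halfTree T x y) (hy : y ∈ halfTree T v w) : halfTree T x y ⊆ halfTree T v w := by
  rw [← Set.disjoint_compl_right_iff_subset, compl_halfTree hT h]
  refine halfTree_disjoint_of_notMem hT h.symm (fun h' => ?_) hv
  exact (notMem_halfTree hT h).2 h' hy

/-- The half-tree cut out by the `n`-th edge of a ray. -/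
def Ray.cone (r : Ray T) (n : ℕ) : Set V := halfTree T (r.1 n) (r.1 (n + 1))

namespace Ray

variable (r : Ray T)

theorem adj (n : ℕ) : T.Adj (r.1 n) (r.1 (n + 1)) := r.2.2 n

theorem cone_antitone (hT : T.IsTree) : Antitone r.cone :=
  antitone_nat_of_succ_le fun n => halfTree_subset hT (r.adj n) (r.adj (n + 1)) fun h => by
    have := r.2.1 h
    omega

theorem mem_cone (hT : T.IsTree) {m n : ℕ} (h : n < m) : r.1 m ∈ r.cone n := by
  obtain ⟨k, rfl⟩ : ∃ k, m = k + 1 := ⟨m - 1, by omega⟩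
  exact r.cone_antitone hT (Nat.lt_succ_iff.1 h) (mem_halfTree_self _ _)

theorem eventually_notMem_cone (hT : T.IsTree) (u : V) : ∀ᶠ n in atTop, u ∉ r.cone n := by
  by_contra hcon
  have hall : ∀ n, u ∈ r.cone n := by
    intro n
    by_contra hn
    refine hcon ?_
    filter_upwards [eventually_ge_atTop n] with m hm hum
    exact hn (r.cone_antitone hT hm hum)
  have hanti : StrictAnti fun n => T.dist (r.1 n) u :=
    strictAnti_nat_of_succ_lt fun n => dist_lt_of_mem_halfTree hT (r.adj n) (hall n)
  exact not_strictAnti_of_wellFoundedLT _ hanti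

/-- A cone containing neither end of an edge lies wholly on one side of it. -/
theorem eventually_mem_or (hT : T.IsTree) {v w : V} (h : T.Adj v w) :
    (∀ᶠ n in atTop, r.cone n ⊆ halfTree T v w) ∨ ∀ᶠ n in atTop, r.cone n ⊆ halfTree T w v := by
  have h1 : ∀ᶠ n in atTop, v ∉ r.cone n ∧ w ∉ r.cone n :=
    (r.eventually_notMem_cone hT v).and (r.eventually_notMem_cone hT w)
  obtain ⟨N, hN⟩ := eventually_atTop.1 h1
  by_cases hw : r.1 (N + 1) ∈ halfTree T v w
  · left
    filter_upwards [eventually_ge_atTop N] with n hn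
    exact (r.cone_antitone hT hn).trans (halfTree_subset_of_notMem hT h (hN N le_rfl).1 hw)
  · right
    filter_upwards [eventually_ge_atTop N] with n hn
    exact (r.cone_antitone hT hn).trans
      (halfTree_subset_of_notMem hT h.symm (hN N le_rfl).2 ((notMem_halfTree hT h).1 hw))

theorem eventually_cone_subset (hT : T.IsTree) {v w : V} (h : T.Adj v w)
    (hr : ∃ᶠ n in atTop, r.1 n ∈ halfTree T v w) : ∀ᶠ n in atTop, r.cone n ⊆ halfTree T v w := by
  refine (r.eventually_mem_or hT h).resolve_right fun h' => ?_
  obtain ⟨N, hN⟩ := eventually_atTop.1 h'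
  obtain ⟨n, hn, hrn⟩ := (frequently_atTop.1 hr) (N + 1)
  exact (notMem_halfTree hT h).2 (hN N le_rfl (r.mem_cone hT hn)) hrn

theorem eventually_mem_of_cone_subset (hT : T.IsTree) {A : Set V}
    (h : ∀ᶠ n in atTop, r.cone n ⊆ A) : ∀ᶠ n in atTop, r.1 n ∈ A := by
  obtain ⟨N, hN⟩ := h.exists
  filter_upwards [eventually_gt_atTop N] with n hn using hN (r.mem_cone hT hn)

theorem toEnd_eq_iff {r s : Ray T} : r.toEnd = s.toEnd ↔ ∃ m n, ∀ k, r.1 (m + k) = s.1 (n + k) :=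
  ⟨fun h => Quotient.exact h, fun h => Quotient.sound h⟩

theorem ofEnd_mem_addEnds {A : Set V} :
    WithEnds.ofEnd r.toEnd ∈ addEnds (T := T) A ↔ ∀ᶠ n in atTop, r.1 n ∈ A := by
  constructor
  · rintro (⟨v, -, h⟩ | ⟨s, hs, h⟩)
    · cases h
    · injection h with h
      obtain ⟨m, n, hmn⟩ := toEnd_eq_iff.1 h
      obtain ⟨N, hN⟩ := eventually_atTop.1 hs
      filter_upwards [eventually_ge_atTop (m + N)] with k hk
      obtain ⟨j, rfl⟩ := Nat.exists_eq_add_of_le hk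
      rw [add_assoc, hmn]
      exact hN _ (by omega)
  · exact fun h => Or.inr ⟨r, h, rfl⟩

theorem ofEnd_mem_addEnds_cone (hT : T.IsTree) (n : ℕ) :
    WithEnds.ofEnd r.toEnd ∈ addEnds (T := T) (r.cone n) := by
  refine r.ofEnd_mem_addEnds.2 ?_
  filter_upwards [eventually_gt_atTop n] with m hm using r.mem_cone hT hm

end Ray

theorem vertex_mem_addEnds {A : Set V} {v : V} :
    WithEnds.vertex v ∈ addEnds (T := T) A ↔ v ∈ A := by
  constructor
  · rintro (⟨w, hw, h⟩ | ⟨s, -, h⟩)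
    · injection h with h
      exact h ▸ hw
    · cases h
  · exact fun h => Or.inl ⟨v, h, rfl⟩

theorem addEnds_mono {A B : Set V} (h : A ⊆ B) : addEnds (T := T) A ⊆ addEnds B := by
  rintro _ (⟨v, hv, rfl⟩ | ⟨r, hr, rfl⟩)
  · exact Or.inl ⟨v, h hv, rfl⟩
  · exact Or.inr ⟨r, hr.mono fun _ h' => h h', rfl⟩

theorem Ends.exists_ray (ξ : Ends T) : ∃ r : Ray T, r.toEnd = ξ := Quotient.exists_rep ξ

theorem isOpen_addEnds {v w : V} (h : T.Adj v w) : IsOpen (addEnds (T := T) (halfTree T v w)) :=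
  TopologicalSpace.isOpen_generateFrom_of_mem ⟨v, w, h, rfl⟩

theorem Ray.hasBasis_nhds (hT : T.IsTree) (r : Ray T) :
    (𝓝 (WithEnds.ofEnd r.toEnd)).HasBasis (fun _ : ℕ => True) fun n => addEnds (r.cone n) := by
  have h : 𝓝 (WithEnds.ofEnd r.toEnd) = ⨅ n, 𝓟 (addEnds (T := T) (r.cone n)) := by
    refine le_antisymm (le_iInf fun n => le_principal_iff.2 ?_) ?_
    · exact (isOpen_addEnds (r.adj n)).mem_nhds (r.ofEnd_mem_addEnds_cone hT n)
    · rw [TopologicalSpace.nhds_generateFrom]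
      refine le_iInf₂ fun U hU => ?_
      obtain ⟨hξ, v, w, hvw, rfl⟩ := hU
      obtain ⟨n, hn⟩ := (r.eventually_cone_subset hT hvw
        (r.ofEnd_mem_addEnds.1 hξ).frequently).exists
      exact (iInf_le _ n).trans (principal_mono.2 (addEnds_mono hn))
  rw [h]
  refine hasBasis_iInf_principal ?_
  exact directed_of_isDirected_le fun m n hmn => addEnds_mono (r.cone_antitone hT hmn)

theorem Ray.hasBasis_nhds_ends (hT : T.IsTree) (r : Ray T) :
    (𝓝 r.toEnd).HasBasis (fun _ : ℕ => True)
      fun n => {ξ : Ends T | WithEnds.ofEnd ξ ∈ addEnds (r.cone n)} := by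
  rw [nhds_induced]
  exact (r.hasBasis_nhds hT).comap _

/-- Distinct ends are separated by an edge of a ray. -/
theorem Ray.separated (hT : T.IsTree) {r s : Ray T} (h : s.toEnd ≠ r.toEnd) :
    ∃ n, ∀ᶠ k in atTop, s.cone k ⊆ (r.cone n)ᶜ := by
  by_contra! hcon
  have hev : ∀ n, ∀ᶠ k in atTop, s.cone k ⊆ r.cone n := fun n =>
    (s.eventually_mem_or hT (r.adj n)).resolve_right fun h' => hcon n (by
      rw [Ray.cone, compl_halfTree hT (r.adj n)]
      simpa using h')
  obtain ⟨N, hN⟩ := eventually_atTop.1 (r.eventually_notMem_cone hT (s.1 0))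
  -- A ray that starts outside `r.cone n` and ends up inside crosses its base edge; doing this for
  -- every large `n`, `s` merges with `r`.
  have hcross : ∀ n ≥ N, ∃ k, s.1 k = r.1 n ∧ s.1 (k + 1) = r.1 (n + 1) := by
    intro n hn
    by_contra! hk
    have hout : ∀ k, s.1 k ∉ r.cone n := by
      intro k
      induction k with
      | zero => exact hN n hn
      | succ k ih =>
        intro h'
        have := eq_of_adj_of_notMem hT (r.adj n) (s.adj k) ih h'
        exact hk k this.1 this.2
    obtain ⟨k, hk⟩ := (s.eventually_mem_of_cone_subset hT (hev n)).exists
    exact hout k hk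
  obtain ⟨k, hk, hk'⟩ := hcross N le_rfl
  refine h (Ray.toEnd_eq_iff.2 ⟨k, N, fun j => ?_⟩)
  have : s.1 (k + j) = r.1 (N + j) ∧ s.1 (k + j + 1) = r.1 (N + j + 1) := by
    induction j with
    | zero => exact ⟨hk, hk'⟩
    | succ j ih =>
      obtain ⟨i, hi, hi'⟩ := hcross (N + j + 1) (by omega)
      have : i = k + j + 1 := s.2.1 (hi.trans ih.2.symm)
      subst this
      exact ⟨ih.2, hi'⟩
  exact this.1

theorem Ray.map_mem_cone_map (hT : T.IsTree) (g : T ≃g T) (r : Ray T) {n : ℕ} {u : V} :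
    g u ∈ (r.map g).cone n ↔ u ∈ r.cone n := map_mem_halfTree hT g

theorem smul_toEnd (g : T ≃g T) (r : Ray T) : g • r.toEnd = (r.map g).toEnd := rfl

theorem Ray.eventually_disjoint_of_smul_ne (hT : T.IsTree) {g : T ≃g T} {r : Ray T}
    (h : g • r.toEnd ≠ r.toEnd) : ∀ᶠ n in atTop, ∀ u ∈ r.cone n, g u ∉ r.cone n := by
  obtain ⟨m, hm⟩ := Ray.separated hT h
  filter_upwards [hm, eventually_ge_atTop m] with n hn hmn u hu hgu
  exact hn ((Ray.map_mem_cone_map hT g r).2 hu) (r.cone_antitone hT hmn hgu)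

theorem ofEnd_smul_mem_addEnds (g : T ≃g T) {A B : Set V} (h : ∀ u, u ∈ A → g u ∈ B)
    {x : WithEnds T} (hx : x ∈ addEnds A) : g • x ∈ addEnds B := by
  rcases hx with ⟨v, hv, rfl⟩ | ⟨r, hr, rfl⟩
  · exact Or.inl ⟨g v, h v hv, rfl⟩
  · exact Or.inr ⟨r.map g, hr.mono fun n hn => h _ hn, rfl⟩

theorem continuous_smul_withEnds (hT : T.IsTree) (g : T ≃g T) :
    Continuous fun x : WithEnds T => g • x := by
  refine continuous_generateFrom_iff.2 ?_
  rintro _ ⟨v, w, hvw, rfl⟩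
  have : (fun x : WithEnds T => g • x) ⁻¹' addEnds (halfTree T v w) =
      addEnds (halfTree T (g⁻¹ v) (g⁻¹ w)) := by
    ext x
    constructor
    · intro hx
      have := ofEnd_smul_mem_addEnds g⁻¹ (B := halfTree T (g⁻¹ v) (g⁻¹ w))
        (fun u hu => (map_mem_halfTree hT g⁻¹).2 hu) hx
      rwa [inv_smul_smul] at this
    · refine ofEnd_smul_mem_addEnds g fun u hu => ?_
      have := (map_mem_halfTree hT g).2 hu
      rwa [RelIso.apply_inv_self, RelIso.apply_inv_self] at this
  rw [this]
  exact isOpen_addEnds (g⁻¹.map_adj_iff.2 hvw)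

theorem continuousConstSMul_ends (hT : T.IsTree) (Γ : Subgroup (T ≃g T)) :
    ContinuousConstSMul Γ (Ends T) :=
  ⟨fun g => by
    have h : Continuous (WithEnds.ofEnd : Ends T → WithEnds T) := continuous_induced_dom
    exact continuous_induced_rng.2 ((continuous_smul_withEnds hT (g : T ≃g T)).comp h)⟩

theorem continuousConstSMul_XT (hT : T.IsTree) (Γ : Subgroup (T ≃g T)) :
    ContinuousConstSMul Γ (XT T) :=
  ⟨fun g => continuous_induced_rng.2
    ((continuous_smul_withEnds hT (g : T ≃g T)).comp continuous_subtype_val)⟩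

/-- An automorphism moving a vertex of a half-tree moves a smaller half-tree off itself. -/
theorem exists_halfTree_disjoint (hT : T.IsTree)
    (hdeg : ∀ v w : V, T.Adj v w → ∃ x y, T.Adj w x ∧ T.Adj w y ∧ x ≠ v ∧ y ≠ v ∧ x ≠ y)
    (g : T ≃g T) {p q : V} (hpq : T.Adj p q) (hg : ∃ u ∈ halfTree T p q, g u ≠ u) :
    ∃ v w, T.Adj v w ∧ halfTree T v w ⊆ halfTree T p q ∧
      ∀ u ∈ halfTree T v w, g u ∉ halfTree T v w := by
  obtain ⟨u, hu, hgu⟩ := hg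
  -- two branches at `u` contained in the half-tree
  have hbranch : ∃ x y, T.Adj u x ∧ T.Adj u y ∧ x ≠ y ∧ halfTree T u x ⊆ halfTree T p q ∧
      halfTree T u y ⊆ halfTree T p q := by
    have key : ∃ z, T.Adj z u ∧ halfTree T z u ⊆ halfTree T p q := by
      have hpu : p ≠ u := fun h => notMem_halfTree_self hT hpq (h ▸ hu)
      obtain ⟨z, hz, hpz⟩ := exists_mem_halfTree hT hpu
      exact ⟨z, hz.symm, halfTree_subset_of_notMem hT hpq ((notMem_halfTree hT hz.symm).2 hpz) hu⟩
    obtain ⟨z, hz, hzu⟩ := key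
    obtain ⟨x, y, hx, hy, hxz, hyz, hxy⟩ := hdeg z u hz
    exact ⟨x, y, hx, hy, hxy, (halfTree_subset hT hz hx hxz).trans hzu,
      (halfTree_subset hT hz hy hyz).trans hzu⟩
  -- Of two branches at `u` one misses `g u`; one step further, a branch at `x` is chosen whose
  -- image misses `x`.
  obtain ⟨x, hx, hxs, hgx⟩ : ∃ x, T.Adj u x ∧ halfTree T u x ⊆ halfTree T p q ∧
      g u ∉ halfTree T u x := by
    obtain ⟨x, y, hx, hy, hxy, hxs, hys⟩ := hbranch
    by_cases h : g u ∈ halfTree T u x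
    · exact ⟨y, hy, hys, Set.disjoint_left.1 (halfTree_disjoint hT hx hy hxy) h⟩
    · exact ⟨x, hx, hxs, h⟩
  have hgx' : g x ∉ halfTree T u x := fun h =>
    hgu (eq_of_adj_of_notMem hT hx (g.map_adj_iff.2 hx) hgx h).1
  obtain ⟨y, hy, hyu, hgy⟩ : ∃ y, T.Adj x y ∧ y ≠ u ∧ x ∉ halfTree T (g x) (g y) := by
    obtain ⟨y, z, hy, hz, hyu, hzu, hyz⟩ := hdeg u x hx
    by_cases h : x ∈ halfTree T (g x) (g y)
    · exact ⟨z, hz, hzu, Set.disjoint_left.1 (halfTree_disjoint hT (g.map_adj_iff.2 hy)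
        (g.map_adj_iff.2 hz) (g.injective.ne hyz)) h⟩
    · exact ⟨y, hy, hyu, h⟩
  have hsub := halfTree_subset hT hx hy hyu
  refine ⟨x, y, hy, hsub.trans hxs, fun v hv hgv => ?_⟩
  have hgv' : g v ∈ halfTree T (g x) (g y) := (map_mem_halfTree hT g).2 hv
  refine Set.disjoint_left.1 (halfTree_disjoint_of_notMem hT (g.map_adj_iff.2 hy) (fun h => ?_)
    fun h => ?_) hgv hgv'
  · have := (eq_of_adj_of_notMem hT (g.map_adj_iff.2 hy) hy hgy h).1
    exact hgx' (this ▸ mem_halfTree_self u x)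
  · have := (eq_of_adj_of_notMem hT hx (g.map_adj_iff.2 hy) hgx' (hsub h)).2
    rw [this] at hgy
    exact hgy (mem_halfTree_self _ _)

end Ends

/-! ### Aperiodic sequences in at least three colours. -/

theorem exists_ne_ne {Ω : Type*} (hΩ : 3 ≤ ENat.card Ω) (a b : Ω) : ∃ d, d ≠ a ∧ d ≠ b := by
  by_contra! hcon
  have h1 : (Set.univ : Set Ω) ⊆ {a, b} := fun d _ => by
    by_cases h : d = a
    · exact Or.inl h
    · exact Or.inr (hcon d h)
  have h2 := Set.encard_le_encard h1
  rw [Set.encard_univ] at h2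
  have h3 : ({a, b} : Set Ω).encard ≤ 2 := by
    refine (Set.encard_insert_le _ _).trans ?_
    rw [Set.encard_singleton]
    norm_num
  have h4 := (hΩ.trans h2).trans h3
  norm_num at h4

theorem nonempty_of_three_le {Ω : Type*} (hΩ : 3 ≤ ENat.card Ω) : Nonempty Ω := by
  by_contra h
  rw [not_nonempty_iff] at h
  rw [ENat.card_eq_zero_iff_empty Ω |>.2 h] at hΩ
  norm_num at hΩ

theorem eq_of_isSquare_add_iff {m k J : ℕ} (h : ∀ j ≥ J, IsSquare (m + j) ↔ IsSquare (k + j)) :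
    m = k := by
  have key : ∀ {m k : ℕ}, m < k → ¬ ∀ j ≥ J, IsSquare (m + j) → IsSquare (k + j) := by
    intro m k hmk h
    -- The gap `2 * s + 1` after the square `s * s` exceeds `k - m`, so `s * s + (k - m)` cannot be
    -- a square.
    set s := k + J + 1 with hs
    have hss : s ≤ s * s := Nat.le_mul_self s
    obtain ⟨t, ht⟩ := h (s * s - m) (by omega) ⟨s, by omega⟩
    have ht' : t * t = s * s + (k - m) := by omega
    have hst : s < t := by
      by_contra hle
      have := Nat.mul_self_le_mul_self (not_lt.1 hle)
      omega
    have h2 := Nat.mul_self_le_mul_self (Nat.succ_le_of_lt hst)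
    have h3 : (s + 1) * (s + 1) = s * s + 2 * s + 1 := by ring
    have h4 : s.succ * s.succ = s * s + 2 * s + 1 := h3
    omega
  rcases lt_trichotomy m k with hlt | heq | hlt
  · exact absurd (fun j hj => (h j hj).1) (key hlt)
  · exact heq
  · exact absurd (fun j hj => (h j hj).2) (key hlt)

/-- A sequence without repetition whose pattern of returns is not eventually periodic. -/
theorem exists_aperiodic_seq {Ω : Type*} (hΩ : 3 ≤ ENat.card Ω) :
    ∃ x : ℕ → Ω, (∀ n, x n ≠ x (n + 1)) ∧ ∀ n, x n = x (n + 2) ↔ ¬ IsSquare n := by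
  classical
  choose third h1 h2 using exists_ne_ne hΩ
  obtain ⟨a⟩ := nonempty_of_three_le hΩ
  -- The state is a pair of consecutive colours. The next colour is the one two places back, except
  -- at squares, where a third colour is inserted.
  let s : ℕ → Ω × Ω := fun n => Nat.rec (a, third a a)
    (fun n p => (p.2, if IsSquare n then third p.1 p.2 else p.1)) n
  have hne : ∀ n, (s n).1 ≠ (s n).2 := by
    intro n
    induction n with
    | zero => exact (h1 a a).symm
    | succ n ih =>
      change (s n).2 ≠ if IsSquare n then third (s n).1 (s n).2 else (s n).1
      split_ifs
      · exact (h2 _ _).symm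
      · exact ih.symm
  refine ⟨fun n => (s n).1, hne, fun n => ?_⟩
  change (s n).1 = (if IsSquare n then third (s n).1 (s n).2 else (s n).1) ↔ _
  by_cases h : IsSquare n
  · simp [h, (h1 (s n).1 (s n).2).symm]
  · simp [h]

/-! ### Rays with prescribed colours. -/

section ColouredRays

variable {V Ω : Type*} {T : SimpleGraph V} (c : EdgeColouring T Ω)

theorem EdgeColouring.exists_ray (hT : T.IsTree) (v : V) {x : ℕ → Ω} (hx : ∀ n, x n ≠ x (n + 1)) :
    ∃ r : Ray T, r.1 0 = v ∧ ∀ n, r.1 (n + 1) = c.step (r.1 n) (x n) := by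
  let r : ℕ → V := fun n => Nat.rec v (fun n u => c.step u (x n)) n
  have hr : ∀ n, r (n + 1) = c.step (r n) (x n) := fun n => rfl
  have hadj : ∀ n, T.Adj (r n) (r (n + 1)) := fun n => c.adj_step _ _
  have hanti : Antitone fun n => halfTree T (r n) (r (n + 1)) := antitone_nat_of_succ_le fun n => by
    simp only [hr]
    exact c.halfTree_step_subset hT (r n) (hx n)
  have hlt : ∀ m n, m < n → r m ≠ r n := by
    intro m n hmn h
    obtain ⟨k, rfl⟩ : ∃ k, n = k + 1 := ⟨n - 1, by omega⟩
    have h1 := hanti (Nat.lt_succ_iff.1 hmn) (mem_halfTree_self (T := T) (r k) (r (k + 1)))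
    rw [← h] at h1
    exact notMem_halfTree_self hT (hadj m) h1
  have hinj : Function.Injective r := by
    intro m n h
    rcases lt_trichotomy m n with h' | h' | h'
    · exact absurd h (hlt m n h')
    · exact h'
    · exact absurd h.symm (hlt n m h')
  exact ⟨⟨r, hinj, hadj⟩, rfl, hr⟩

theorem EdgeColouring.exists_ray_cone_eq (c : EdgeColouring T Ω) (hT : T.IsTree)
    (hΩ : 3 ≤ ENat.card Ω) {v w : V}
    (h : T.Adj v w) : ∃ r : Ray T, r.cone 0 = halfTree T v w := by
  obtain ⟨a, rfl⟩ := c.exists_step h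
  obtain ⟨b, hb, -⟩ := exists_ne_ne hΩ a a
  obtain ⟨r, hr, hr'⟩ := c.exists_ray hT v (x := fun n => if Even n then a else b) (fun n => by
    by_cases hn : Even n
    · simp [hn, Nat.even_add_one, hb.symm]
    · simp [hn, Nat.even_add_one, hb])
  refine ⟨r, ?_⟩
  rw [Ray.cone, hr', hr]
  simp

theorem EdgeColouring.exists_two_branches (c : EdgeColouring T Ω) (hΩ : 3 ≤ ENat.card Ω)
    (v w : V) (h : T.Adj v w) :
    ∃ x y, T.Adj w x ∧ T.Adj w y ∧ x ≠ v ∧ y ≠ v ∧ x ≠ y := by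
  obtain ⟨a, rfl⟩ := c.exists_step h.symm
  obtain ⟨b, hb, -⟩ := exists_ne_ne hΩ a a
  obtain ⟨d, hda, hdb⟩ := exists_ne_ne hΩ a b
  exact ⟨c.step w b, c.step w d, c.adj_step _ _, c.adj_step _ _, (c.step_injective w).ne hb,
    (c.step_injective w).ne hda, (c.step_injective w).ne hdb.symm⟩

theorem Ray.eventually_disjoint_cone (hT : T.IsTree) (r : Ray T) {S : Set V} (hS : S.Finite) :
    ∀ᶠ n in atTop, ∀ u ∈ r.cone n, u ∉ S := by
  have := (eventually_all_finite hS).2 fun u _ => r.eventually_notMem_cone hT u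
  filter_upwards [this] with n hn u hu huS using hn u huS hu

variable {F : Subgroup (Equiv.Perm Ω)}

/-- There is an end all of whose stabilizing automorphisms with almost all local permutations in `F`
fix a neighbourhood of it. -/
theorem EdgeColouring.exists_generic_ray (hT : T.IsTree) (hΩ : 3 ≤ ENat.card Ω)
    (hfree : ∀ f ∈ F, ∀ a : Ω, f a = a → f = 1) :
    ∃ r : Ray T, ∀ g : T ≃g T, {v | c.localPerm g v ∉ F}.Finite → g • r.toEnd = r.toEnd →
      ∃ n, ∀ u ∈ r.cone n, g u = u := by
  obtain ⟨x, hx, hsq⟩ := exists_aperiodic_seq hΩ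
  obtain ⟨v⟩ := hT.connected.nonempty
  obtain ⟨r, -, hr⟩ := c.exists_ray hT v hx
  refine ⟨r, fun g hfin hg => ?_⟩
  obtain ⟨N, hN⟩ := (r.eventually_disjoint_cone hT hfin).exists
  have hNF : ∀ u ∈ r.cone N, c.localPerm g u ∈ F := fun u hu => not_not.1 (hN u hu)
  obtain ⟨m, k, hmk⟩ := Ray.toEnd_eq_iff.1 ((smul_toEnd g r).symm.trans hg)
  replace hmk : ∀ j, g (r.1 (m + j)) = r.1 (k + j) := hmk
  have hf : ∀ j, c.localPerm g (r.1 (m + j)) (x (m + j)) = x (k + j) := fun j => by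
    refine c.localPerm_apply_eq ?_
    rw [← hr, add_assoc, hmk, hmk, ← hr, add_assoc]
  have hF : ∀ j, N + 1 ≤ j → c.localPerm g (r.1 (m + j)) ∈ F := fun j hj =>
    hNF _ (r.mem_cone hT (by omega))
  -- Successive local permutations agree on the colour of their common edge, so they coincide by
  -- freeness: far out, one element of `F` recolours the ray.
  have hconst : ∀ j, N + 1 ≤ j →
      c.localPerm g (r.1 (m + j + 1)) = c.localPerm g (r.1 (m + j)) := by
    intro j hj
    have h1 : c.localPerm g (r.1 (m + j + 1)) (x (m + j)) =
        c.localPerm g (r.1 (m + j)) (x (m + j)) := by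
      rw [hr, c.localPerm_step]
    have h2 := hfree _ (mul_mem (inv_mem (hF j hj)) (hF (j + 1) (by omega))) (x (m + j)) (by
      rw [Equiv.Perm.mul_apply, ← add_assoc, h1]
      exact Equiv.symm_apply_apply _ _)
    exact (inv_mul_eq_one.1 h2).symm
  have hmk' : m = k := by
    refine eq_of_isSquare_add_iff (J := N + 1) fun j hj => not_iff_not.1 ?_
    rw [← hsq, ← hsq, ← hf j, add_assoc k j 2, ← hf (j + 2), ← add_assoc m j 2]
    have h3 : c.localPerm g (r.1 (m + j + 2)) = c.localPerm g (r.1 (m + j)) := by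
      rw [← hconst j hj]
      exact hconst (j + 1) (by omega)
    rw [h3, EmbeddingLike.apply_eq_iff_eq]
  subst hmk'
  refine ⟨m + (N + 1), fun u hu => (c.fixed_of_free hfree (fun u hu => hNF u ?_) (r.adj _)
    (hmk _) (hmk (N + 1 + 1)) hu).1⟩
  exact r.cone_antitone hT (by omega) hu

end ColouredRays

/-! ### Contraction of half-trees. -/

section Groups

variable {V Ω : Type*} {T : SimpleGraph V} (c : EdgeColouring T Ω)
  {F F' : Subgroup (Equiv.Perm Ω)}

/-- Colour-preserving automorphisms suffice: one of them carries `v` to any chosen vertex, here one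
deep enough in the target and of the type of `v`. All limit arguments below push half-trees into the
cones of a ray in this way. -/
theorem exists_contract (hT : T.IsTree) (hΩ : 3 ≤ ENat.card Ω) {p q v w : V} (hpq : T.Adj p q)
    (hvw : T.Adj v w) :
    ∃ g ∈ almostPrescribedStar c F F', ∀ u ∈ halfTree T v w, g u ∈ halfTree T p q := by
  obtain ⟨a, rfl⟩ := c.exists_step hvw
  obtain ⟨b, rfl⟩ := c.exists_step hpq
  have key : ∀ u, (∃ P : T.Walk v u, Even P.length) →
      halfTree T u (c.step u a) ⊆ halfTree T p (c.step p b) →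
      ∃ g ∈ almostPrescribedStar c F F', ∀ x ∈ halfTree T v (c.step v a),
        g x ∈ halfTree T p (c.step p b) := by
    rintro u ⟨P, hP⟩ hu
    obtain ⟨g, rfl, hσ⟩ := c.exists_aut hT v u (σ := fun _ => 1) fun _ _ => rfl
    refine ⟨g, ⟨⟨fun u => ?_, ?_⟩, mem_typePreserving_of_walk hT P hP⟩, fun x hx => hu ?_⟩
    · rw [hσ]
      exact one_mem _
    · simp [hσ, one_mem]
    · have := (map_mem_halfTree hT g).2 hx
      rwa [c.map_step, hσ] at this
  obtain ⟨P⟩ := hT.connected.preconnected v (c.step p b)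
  -- One extra step corrects an odd parity, two preserve an even one; `d` and `e` avoid
  -- backtracking, also before the final edge of colour `a`.
  by_cases hP : Even P.length
  · obtain ⟨d, hdb, -⟩ := exists_ne_ne hΩ b b
    obtain ⟨e, hed, hea⟩ := exists_ne_ne hΩ d a
    refine key (c.step (c.step (c.step p b) d) e)
      ⟨(P.concat (c.adj_step _ d)).concat (c.adj_step _ e), ?_⟩ ?_
    · rw [SimpleGraph.Walk.length_concat, SimpleGraph.Walk.length_concat]
      obtain ⟨k, hk⟩ := hP
      exact ⟨k + 1, by omega⟩
    · exact ((c.halfTree_step_subset hT _ hea).trans (c.halfTree_step_subset hT _ hed.symm)).trans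
        (c.halfTree_step_subset hT _ hdb.symm)
  · obtain ⟨d, hdb, hda⟩ := exists_ne_ne hΩ b a
    refine key (c.step (c.step p b) d) ⟨P.concat (c.adj_step _ d), ?_⟩ ?_
    · rw [SimpleGraph.Walk.length_concat]
      obtain ⟨k, hk⟩ := Nat.not_even_iff_odd.1 hP
      exact ⟨k + 1, by omega⟩
    · exact (c.halfTree_step_subset hT _ hda).trans (c.halfTree_step_subset hT _ hdb.symm)

end Groups

/-! ### Perfectness of the rigid stabilizers of half-trees. -/

section Perfect

variable {V Ω : Type*} {T : SimpleGraph V} (c : EdgeColouring T Ω)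
  {F F' : Subgroup (Equiv.Perm Ω)}

theorem fixed_of_supported (hT : T.IsTree) {g : T ≃g T} {v w : V} (h : T.Adj v w)
    (hg : ∀ u ∉ halfTree T v w, g u = u) : g v = v ∧ g w = w := by
  have hv := notMem_halfTree_self hT h
  have hgv := hg v hv
  refine ⟨hgv, ?_⟩
  have h1 : T.Adj v (g w) := hgv ▸ g.map_adj_iff.2 h
  refine (eq_of_adj_of_notMem hT h h1 hv ?_).2
  by_contra h2
  have h3 : g w = w := g.injective (hg _ h2)
  rw [h3] at h2
  exact h2 (mem_halfTree_self v w)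

theorem mem_halfTree_iff_of_fixed (hT : T.IsTree) {g : T ≃g T} {v w u : V} (hv : g v = v)
    (hw : g w = w) : g u ∈ halfTree T v w ↔ u ∈ halfTree T v w := by
  have := map_mem_halfTree hT g (v := v) (w := w) (u := u)
  rwa [hv, hw] at this

theorem localPerm_eq_one_of_supported (hT : T.IsTree) {g : T ≃g T} {v w : V} (h : T.Adj v w)
    (hg : ∀ u ∉ halfTree T v w, g u = u) {u : V} (hu : u ∉ halfTree T v w) :
    c.localPerm g u = 1 := by
  refine Equiv.ext fun b => c.localPerm_apply_self (hg u hu) ?_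
  by_cases hb : c.step u b ∈ halfTree T v w
  · rw [(eq_of_adj_of_notMem hT h (c.adj_step u b) hu hb).2]
    exact (fixed_of_supported hT h hg).2
  · exact hg _ hb

/-- Elements of `G(F, F')^*` supported in a half-tree, with a prescribed local permutation at its
root and no other singularity. -/
theorem exists_rooted (hT : T.IsTree) (hFF' : F ≤ F') (htrans : MulAction.IsPretransitive F Ω)
    {v w : V} (h : T.Adj v w) {f : Equiv.Perm Ω} (hf : f ∈ F')
    (hfa : f (c.around w ⟨v, h.symm⟩) = c.around w ⟨v, h.symm⟩) :
    ∃ g ∈ almostPrescribedStar c F F', (∀ u ∉ halfTree T v w, g u = u) ∧ c.localPerm g w = f ∧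
      ∀ u, u ≠ w → c.localPerm g u ∈ F := by
  classical
  set a := c.around w ⟨v, h.symm⟩
  have hva : c.step w a = v := c.step_around h.symm
  have : Nonempty Ω := ⟨a⟩
  -- Transitivity of `F` gives each branch a constant local permutation agreeing with `f` on its
  -- first edge; the branch outside the half-tree gets `1`.
  have hφ : ∀ b, ∃ k ∈ F, k b = f b ∧ (b = a → k = 1) := by
    intro b
    by_cases hb : b = a
    · subst hb
      exact ⟨1, one_mem _, hfa.symm, fun _ => rfl⟩
    · obtain ⟨k, hk⟩ := htrans.exists_smul_eq b (f b)
      exact ⟨k, k.2, hk, fun h => absurd h hb⟩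
  choose φ hφF hφ hφa using hφ
  obtain ⟨g, hgw, hgf, hgφ⟩ := c.exists_spherical hT w f φ hφ
  have hF : ∀ u, u ≠ w → c.localPerm g u ∈ F := by
    intro u hu
    obtain ⟨x, hx, hux⟩ := exists_mem_halfTree hT hu
    obtain ⟨b, rfl⟩ := c.exists_step hx
    rw [hgφ b u hux]
    exact hφF b
  refine ⟨g, ⟨⟨fun u => ?_, ?_⟩, mem_typePreserving_of_fixed hT hgw⟩, fun u hu => ?_, hgf, hF⟩
  · by_cases hu : u = w
    · rw [hu, hgf]
      exact hf
    · exact hFF' (hF u hu)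
  · refine (Set.finite_singleton w).subset fun u hu => ?_
    by_contra huw
    exact hu (hF u huw)
  · have hgv : g v = v := by rw [← hva, c.map_step, hgw, hgf, hfa]
    rw [notMem_halfTree hT h] at hu
    refine c.eqOn_halfTree (h := 1) hgv (fun x hx => ?_) hu
    rw [← hva] at hx
    rw [hgφ a x hx, hφa a rfl, c.localPerm_one]

/-- The part of an element of `G(F, F')` in a half-tree whose base edge it fixes. -/
theorem exists_restrict (hT : T.IsTree) {g : T ≃g T} (hg : g ∈ almostPrescribed c F F') {v w : V}
    (h : T.Adj v w) (hv : g v = v) (hw : g w = w) :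
    ∃ k ∈ almostPrescribedStar c F F', (∀ u ∉ halfTree T v w, k u = u ∧ c.localPerm k u = 1) ∧
      ∀ u ∈ halfTree T v w, k u = g u ∧ c.localPerm k u = c.localPerm g u := by
  obtain ⟨k, hk1, hk2⟩ := c.exists_glue hT h hv hw
  refine ⟨k, ⟨⟨fun u => ?_, hg.2.subset fun u hu hgu => hu ?_⟩,
    mem_typePreserving_of_fixed hT (hk1 v (notMem_halfTree_self hT h)).1⟩, hk1, hk2⟩
  · by_cases hu : u ∈ halfTree T v w
    · rw [(hk2 u hu).2]
      exact hg.1 u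
    · rw [(hk1 u hu).2]
      exact one_mem _
  · by_cases hu : u ∈ halfTree T v w
    · rw [(hk2 u hu).2]
      exact hgu
    · rw [(hk1 u hu).2]
      exact one_mem _

theorem mem_rist_iff {Γ : Subgroup (T ≃g T)} {U : Set V} {g : Γ} :
    g ∈ rist Γ U ↔ ∀ u ∉ U, (g : T ≃g T) u = u := mem_rist

variable (hT : T.IsTree) (hFF' : F ≤ F') (hfree : ∀ f ∈ F, ∀ a : Ω, f a = a → f = 1)
  (htrans : MulAction.IsPretransitive F Ω)

/-- The elements of the rigid stabilizer of a half-tree that have no singularity except possibly at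
its root. -/
def rooted (F F' : Subgroup (Equiv.Perm Ω)) (hT : T.IsTree) {v w : V} (h : T.Adj v w) :
    Subgroup (almostPrescribedStar c F F') where
  carrier := {g | g ∈ rist _ (halfTree T v w) ∧ ∀ u, u ≠ w → c.localPerm (g : T ≃g T) u ∈ F}
  one_mem' := ⟨one_mem _, fun u _ => by
    rw [OneMemClass.coe_one, c.localPerm_one]
    exact one_mem _⟩
  mul_mem' := by
    rintro g k ⟨hg, hgF⟩ ⟨hk, hkF⟩
    refine ⟨mul_mem hg hk, fun u hu => ?_⟩
    rw [Subgroup.coe_mul, c.localPerm_mul]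
    refine mul_mem (hgF _ fun h' => hu ?_) (hkF u hu)
    rw [← (fixed_of_supported hT h (mem_rist_iff.1 hk)).2] at h'
    exact (k : T ≃g T).injective h'
  inv_mem' := by
    rintro g ⟨hg, hgF⟩
    refine ⟨inv_mem hg, fun u hu => ?_⟩
    rw [Subgroup.coe_inv, c.localPerm_inv]
    refine inv_mem (hgF _ fun h' => hu ?_)
    rw [← (fixed_of_supported hT h (mem_rist_iff.1 hg)).2, ← h']
    exact (RelIso.apply_inv_self _ _).symm

include hT hFF' hfree htrans in
-- The local permutation at the root identifies this group with a point stabilizer of `F'`: rigidity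
-- gives injectivity, `exists_rooted` surjectivity.
theorem rooted_isPerfect (hperf : ∀ a : Ω, Group.IsPerfect (MulAction.stabilizer F' a)) {v w : V}
    (h : T.Adj v w) : Group.IsPerfect (rooted c F F' hT h) := by
  set a := c.around w ⟨v, h.symm⟩ with ha
  have hva : c.step w a = v := c.step_around h.symm
  have hw : ∀ g : rooted c F F' hT h, (g.1 : T ≃g T) v = v ∧ (g.1 : T ≃g T) w = w := fun g =>
    fixed_of_supported hT h (mem_rist_iff.1 g.2.1)
  let π : rooted c F F' hT h →* MulAction.stabilizer F' a :=
    { toFun := fun g => ⟨⟨c.localPerm (g.1 : T ≃g T) w, g.1.2.1.1 w⟩,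
        c.localPerm_apply_self (hw g).2 (by rw [hva, (hw g).1])⟩
      map_one' := by
        refine Subtype.ext (Subtype.ext ?_)
        exact c.localPerm_one w
      map_mul' := by
        intro g k
        refine Subtype.ext (Subtype.ext ?_)
        change c.localPerm ((g.1 : T ≃g T) * (k.1 : T ≃g T)) w = _
        rw [c.localPerm_mul]
        exact congrArg (fun x => c.localPerm (g.1 : T ≃g T) x * c.localPerm (k.1 : T ≃g T) w)
          (hw k).2 }
  have hinj : Function.Injective π := by
    rw [injective_iff_map_eq_one]
    intro g hg
    have hg' : c.localPerm (g.1 : T ≃g T) w = 1 :=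
      congrArg (fun f : MulAction.stabilizer F' a => ((f : F') : Equiv.Perm Ω)) hg
    refine Subtype.ext (Subtype.ext (RelIso.ext fun u => ?_))
    change (g.1 : T ≃g T) u = u
    by_cases hu : u ∈ halfTree T v w
    · refine (c.fixed_of_free hfree (fun x _ => ?_) h (hw g).1 (hw g).2 hu).1
      by_cases hx : x = w
      · rw [hx, hg']
        exact one_mem _
      · exact g.2.2 x hx
    · exact mem_rist_iff.1 g.2.1 u hu
  have hsurj : Function.Surjective π := by
    rintro ⟨⟨f, hf⟩, hfa⟩
    obtain ⟨g, hg, hgU, hgf, hgF⟩ := exists_rooted c hT hFF' htrans h hf hfa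
    exact ⟨⟨⟨g, hg⟩, mem_rist_iff.2 hgU, hgF⟩, Subtype.ext (Subtype.ext hgf)⟩
  have := hperf a
  exact Group.IsPerfect.ofSurjective (f := (MulEquiv.ofBijective π ⟨hinj, hsurj⟩).symm.toMonoidHom)
    (MulEquiv.surjective _)

include hT hFF' hfree htrans in
/-- The rigid stabilizers of half-trees in `G(F, F')^*` are perfect. -/
theorem commutator_rist_halfTree
    (hperf : ∀ a : Ω, Group.IsPerfect (MulAction.stabilizer F' a)) {v w : V} (h : T.Adj v w) :
    ⁅rist (almostPrescribedStar c F F') (halfTree T v w),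
      rist (almostPrescribedStar c F F') (halfTree T v w)⁆ =
      rist (almostPrescribedStar c F F') (halfTree T v w) := by
  refine le_antisymm (Subgroup.commutator_le_self _) ?_
  have hfin : ∀ g : almostPrescribedStar c F F', {u | c.localPerm (g : T ≃g T) u ∉ F}.Finite :=
    fun g => g.2.1.2
  -- Induction on the total distance from the root to the singularities, over all half-trees at
  -- once; the `+ 1` lets a singularity at the root count.
  suffices H : ∀ (n : ℕ) {v w : V} (_ : T.Adj v w) (g : almostPrescribedStar c F F'),
      g ∈ rist _ (halfTree T v w) → ∑ u ∈ (hfin g).toFinset, (T.dist w u + 1) = n →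
      g ∈ ⁅rist (almostPrescribedStar c F F') (halfTree T v w), rist _ (halfTree T v w)⁆ from
    fun g hg => H _ h g hg rfl
  intro n
  induction n using Nat.strong_induction_on with
  | _ n ih =>
  intro v w h g hg hn
  have hg' := mem_rist_iff.1 hg
  obtain ⟨hgv, hgw⟩ := fixed_of_supported hT h hg'
  have hsing : ∀ (k : almostPrescribedStar c F F') u,
      u ∈ (hfin k).toFinset ↔ c.localPerm (k : T ≃g T) u ∉ F := fun k u => by simp
  -- reduce to an element with fewer singularities
  have hdecr : ∀ k ∈ ⁅rist (almostPrescribedStar c F F') (halfTree T v w),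
      rist _ (halfTree T v w)⁆, (∀ u, c.localPerm (g : T ≃g T) u ∈ F →
        c.localPerm ((k⁻¹ * g : almostPrescribedStar c F F') : T ≃g T) u ∈ F) →
      (∃ u, c.localPerm (g : T ≃g T) u ∉ F ∧
        c.localPerm ((k⁻¹ * g : almostPrescribedStar c F F') : T ≃g T) u ∈ F) →
      g ∈ ⁅rist (almostPrescribedStar c F F') (halfTree T v w), rist _ (halfTree T v w)⁆ := by
    rintro k hk h1 ⟨u, hu, hu'⟩
    have hlt : ∑ u ∈ (hfin (k⁻¹ * g)).toFinset, (T.dist w u + 1) < n := by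
      rw [← hn]
      refine Finset.sum_lt_sum_of_subset (i := u) (fun x hx => ?_) ((hsing _ _).2 hu)
        (fun hx => (hsing _ _).1 hx hu') (Nat.succ_pos _) (fun _ _ _ => Nat.zero_le _)
      rw [hsing] at hx ⊢
      exact fun h => hx (h1 x h)
    have h2 := ih _ hlt h (k⁻¹ * g)
      (mul_mem (inv_mem (Subgroup.commutator_le_self _ hk)) hg) rfl
    have h3 := mul_mem hk h2
    rwa [mul_inv_cancel_left] at h3
  -- If the root is not singular, `g` fixes its neighbours, and its part in a branch with a
  -- singularity has smaller weight as seen from the root of that branch. If the root is singular,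
  -- dividing by a rooted element with the same local permutation there removes this singularity and
  -- creates none.
  by_cases hw : c.localPerm (g : T ≃g T) w ∈ F
  · by_cases hne : ∃ u, c.localPerm (g : T ≃g T) u ∉ F
    · obtain ⟨u, hu⟩ := hne
      have huU : u ∈ halfTree T v w := by
        by_contra huU
        rw [localPerm_eq_one_of_supported c hT h hg' huU] at hu
        exact hu (one_mem _)
      have huw : u ≠ w := fun h => hu (h ▸ hw)
      obtain ⟨x, hwx, hxv, hux⟩ := exists_mem_halfTree_of_mem hT h huU huw
      have hw1 : c.localPerm (g : T ≃g T) w = 1 := by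
        obtain ⟨a, rfl⟩ := c.exists_step h.symm
        exact hfree _ hw a (c.localPerm_apply_self hgw hgv)
      have hgx : (g : T ≃g T) x = x := by
        obtain ⟨b, rfl⟩ := c.exists_step hwx
        rw [c.map_step, hgw, hw1, Equiv.Perm.one_apply]
      obtain ⟨k, hk, hk1, hk2⟩ := exists_restrict c hT g.2.1 hwx hgw hgx
      have hkR : (⟨k, hk⟩ : almostPrescribedStar c F F') ∈ rist _ (halfTree T w x) :=
        mem_rist_iff.2 fun y hy => (hk1 y hy).1
      have hkfix := fixed_of_supported hT hwx fun y hy => (hk1 y hy).1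
      have hsub := halfTree_subset hT h hwx hxv
      have hkC : (⟨k, hk⟩ : almostPrescribedStar c F F') ∈
          ⁅rist (almostPrescribedStar c F F') (halfTree T v w), rist _ (halfTree T v w)⁆ := by
        refine Subgroup.commutator_mono (rist_mono hsub) (rist_mono hsub) (ih _ ?_ hwx _ hkR rfl)
        rw [← hn]
        have hkx : ∀ y ∈ (hfin ⟨k, hk⟩).toFinset, y ∈ halfTree T w x := by
          intro y hy
          by_contra hyx
          rw [hsing] at hy
          exact hy ((hk1 y hyx).2 ▸ one_mem _)
        calc ∑ y ∈ (hfin ⟨k, hk⟩).toFinset, (T.dist x y + 1)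
            < ∑ y ∈ (hfin ⟨k, hk⟩).toFinset, (T.dist w y + 1) := by
              refine Finset.sum_lt_sum_of_nonempty ⟨u, ?_⟩ fun y hy => ?_
              · rw [hsing]
                change c.localPerm k u ∉ F
                rwa [(hk2 u hux).2]
              · exact Nat.succ_lt_succ (dist_lt_of_mem_halfTree hT hwx (hkx y hy))
          _ ≤ _ := by
              refine Finset.sum_le_sum_of_subset fun y hy => ?_
              have hyx := hkx y hy
              rw [hsing] at hy ⊢
              rwa [← (hk2 y hyx).2]
      have hloc : ∀ y, c.localPerm (k⁻¹ * (g : T ≃g T)) y =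
          (c.localPerm k (k⁻¹ ((g : T ≃g T) y)))⁻¹ * c.localPerm (g : T ≃g T) y := fun y => by
        rw [c.localPerm_mul, c.localPerm_inv]
      have hin : ∀ y ∈ halfTree T w x, c.localPerm (k⁻¹ * (g : T ≃g T)) y = 1 := by
        intro y hy
        have : k⁻¹ ((g : T ≃g T) y) = y := by
          rw [← (hk2 y hy).1]
          exact RelIso.inv_apply_self _ _
        rw [hloc, this, (hk2 y hy).2, inv_mul_cancel]
      refine hdecr ⟨k, hk⟩ hkC (fun y hy => ?_) ⟨u, hu, ?_⟩
      · change c.localPerm (k⁻¹ * (g : T ≃g T)) y ∈ F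
        by_cases hyx : y ∈ halfTree T w x
        · rw [hin y hyx]
          exact one_mem _
        · have hgy : (g : T ≃g T) y ∉ halfTree T w x := fun h' =>
            hyx ((mem_halfTree_iff_of_fixed hT hgw hgx).1 h')
          have : k⁻¹ ((g : T ≃g T) y) = (g : T ≃g T) y := by
            conv_lhs => rw [← (hk1 _ hgy).1]
            exact RelIso.inv_apply_self _ _
          rw [hloc, this, (hk1 _ hgy).2, inv_one, one_mul]
          exact hy
      · change c.localPerm (k⁻¹ * (g : T ≃g T)) u ∈ F
        rw [hin u hux]
        exact one_mem _
    · push Not at hne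
      have : g = 1 := by
        refine Subtype.ext (RelIso.ext fun u => ?_)
        change (g : T ≃g T) u = u
        by_cases hu : u ∈ halfTree T v w
        · exact (c.fixed_of_free hfree (fun x _ => hne x) h hgv hgw hu).1
        · exact hg' u hu
      rw [this]
      exact one_mem _
  · have hga : c.localPerm (g : T ≃g T) w (c.around w ⟨v, h.symm⟩) = c.around w ⟨v, h.symm⟩ :=
      c.localPerm_apply_self hgw (by rw [c.step_around h.symm, hgv])
    obtain ⟨k, hk, hkU, hkw, hkF⟩ := exists_rooted c hT hFF' htrans h (g.2.1.1 w) hga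
    have hkw' := (fixed_of_supported hT h hkU).2
    have hkw'' : k⁻¹ w = w := by
      conv_lhs => rw [← hkw']
      exact RelIso.inv_apply_self _ _
    have hkE : (⟨k, hk⟩ : almostPrescribedStar c F F') ∈ rooted c F F' hT h :=
      ⟨mem_rist_iff.2 hkU, hkF⟩
    have hkC : (⟨k, hk⟩ : almostPrescribedStar c F F') ∈
        ⁅rist (almostPrescribedStar c F F') (halfTree T v w), rist _ (halfTree T v w)⁆ := by
      have := rooted_isPerfect c hT hFF' hfree htrans hperf h
      rw [← Subgroup.commutator_eq_self (H := rooted c F F' hT h)] at hkE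
      have hle : rooted c F F' hT h ≤ rist _ (halfTree T v w) := fun _ hy => hy.1
      exact Subgroup.commutator_mono hle hle hkE
    have hloc : ∀ y, c.localPerm (k⁻¹ * (g : T ≃g T)) y =
        (c.localPerm k (k⁻¹ ((g : T ≃g T) y)))⁻¹ * c.localPerm (g : T ≃g T) y := fun y => by
      rw [c.localPerm_mul, c.localPerm_inv]
    have hwF : c.localPerm (k⁻¹ * (g : T ≃g T)) w ∈ F := by
      rw [hloc, hgw, hkw'', hkw, inv_mul_cancel]
      exact one_mem _
    refine hdecr ⟨k, hk⟩ hkC (fun y hy => ?_) ⟨w, hw, hwF⟩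
    change c.localPerm (k⁻¹ * (g : T ≃g T)) y ∈ F
    by_cases hyw : y = w
    · rw [hyw]
      exact hwF
    · rw [hloc]
      refine mul_mem (inv_mem (hkF _ fun h' => hyw ?_)) hy
      have h1 : (g : T ≃g T) y = k w := by
        rw [← h']
        exact (RelIso.apply_inv_self _ _).symm
      rw [hkw', ← hgw] at h1
      exact (g : T ≃g T).injective h1

end Perfect

/-! ### Points of `T ⊔ ∂T` and continuity of stabilizers at ends. -/

section PointsOfT

variable {V : Type*} {T : SimpleGraph V}

theorem smul_eq_of_mem_addEnds {g : T ≃g T} {A : Set V} (h : ∀ u ∈ A, g u = u) {x : WithEnds T}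
    (hx : x ∈ addEnds A) : g • x = x := by
  rcases hx with ⟨v, hv, rfl⟩ | ⟨r, hr, rfl⟩
  · exact congrArg WithEnds.vertex (h v hv)
  · obtain ⟨N, hN⟩ := eventually_atTop.1 hr
    refine congrArg WithEnds.ofEnd (Ray.toEnd_eq_iff (r := r.map g).2 ⟨N, N, fun k => ?_⟩)
    exact h _ (hN _ (by omega))

theorem smul_ne_of_mem_addEnds {g : T ≃g T} {A : Set V} (h : ∀ u ∈ A, g u ∉ A) {x : WithEnds T}
    (hx : x ∈ addEnds A) : g • x ≠ x := by
  intro hgx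
  have h1 := ofEnd_smul_mem_addEnds g (B := Aᶜ) h hx
  rw [hgx] at h1
  rcases hx with ⟨v, hv, rfl⟩ | ⟨r, hr, rfl⟩
  · exact vertex_mem_addEnds.1 h1 hv
  · obtain ⟨n, hn1, hn2⟩ := (hr.and (r.ofEnd_mem_addEnds.1 h1)).exists
    exact hn2 hn1

theorem ofEnd_injective : Function.Injective (WithEnds.ofEnd : Ends T → WithEnds T) :=
  fun _ _ h => by injection h

theorem Ray.exists_branch (hT : T.IsTree) (r : Ray T) (v : V) :
    ∃ x, T.Adj v x ∧ ∀ᶠ n in atTop, r.1 n ∈ halfTree T v x := by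
  obtain ⟨n, hn⟩ := (r.eventually_notMem_cone hT v).exists
  have hne : r.1 (n + 1) ≠ v := fun h => hn (h ▸ mem_halfTree_self _ _)
  obtain ⟨x, hx, hrx⟩ := exists_mem_halfTree hT hne
  refine ⟨x, hx, r.eventually_mem_of_cone_subset hT ?_⟩
  filter_upwards [eventually_ge_atTop n] with m hm
  exact (r.cone_antitone hT hm).trans (halfTree_subset_of_notMem hT hx hn hrx)

variable {Ω : Type*} (c : EdgeColouring T Ω)

/-- Moving a vertex of the half-tree would move a smaller half-tree, and therefore its ends, off
itself. -/
theorem EdgeColouring.fixed_of_fixed_ends (c : EdgeColouring T Ω) (hT : T.IsTree)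
    (hΩ : 3 ≤ ENat.card Ω) {g : T ≃g T} {p q : V} (hpq : T.Adj p q)
    (hg : ∀ ξ : Ends T, WithEnds.ofEnd ξ ∈ addEnds (halfTree T p q) → g • ξ = ξ) {u : V}
    (hu : u ∈ halfTree T p q) : g u = u := by
  by_contra hgu
  obtain ⟨v, w, hvw, hsub, hdisj⟩ :=
    exists_halfTree_disjoint hT (c.exists_two_branches hΩ) g hpq ⟨u, hu, hgu⟩
  obtain ⟨s, hs⟩ := c.exists_ray_cone_eq hT hΩ hvw
  have hs' := s.ofEnd_mem_addEnds_cone hT 0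
  rw [hs] at hs'
  exact smul_ne_of_mem_addEnds hdisj hs' (congrArg WithEnds.ofEnd (hg _ (addEnds_mono hsub hs')))

/-- Near an end `ξ` such that every automorphism of the group `Γ` fixing `ξ` fixes a half-tree
containing it, the elements of `Γ` either fix all points or fix none. -/
theorem Ray.eventually_smul (hT : T.IsTree) {Γ : Subgroup (T ≃g T)} {r : Ray T}
    (hr : ∀ g ∈ Γ, g • r.toEnd = r.toEnd → ∃ n, ∀ u ∈ r.cone n, g u = u) {g : T ≃g T}
    (hg : g ∈ Γ) :
    (g • r.toEnd = r.toEnd → ∀ᶠ y in 𝓝 (WithEnds.ofEnd r.toEnd), g • y = y) ∧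
      (g • r.toEnd ≠ r.toEnd → ∀ᶠ y in 𝓝 (WithEnds.ofEnd r.toEnd), g • y ≠ y) := by
  constructor
  · intro h
    obtain ⟨n, hn⟩ := hr g hg h
    filter_upwards [(r.hasBasis_nhds hT).mem_of_mem (i := n) trivial] with y hy
    exact smul_eq_of_mem_addEnds hn hy
  · intro h
    obtain ⟨n, hn⟩ := (Ray.eventually_disjoint_of_smul_ne hT h).exists
    filter_upwards [(r.hasBasis_nhds hT).mem_of_mem (i := n) trivial] with y hy
    exact smul_ne_of_mem_addEnds hn hy

/-- An end, as a point of `X_T`. -/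
def Ends.toXT (ξ : Ends T) : XT T := ⟨.ofEnd ξ, fun _ h => by cases h⟩

theorem smul_toXT (Γ : Subgroup (T ≃g T)) (g : Γ) (ξ : Ends T) :
    g • ξ.toXT = ξ.toXT ↔ (g : T ≃g T) • ξ = ξ := by
  rw [Subtype.ext_iff]
  exact ofEnd_injective.eq_iff

theorem Ray.continuousAt_stabilizer_XT (hT : T.IsTree) {Γ : Subgroup (T ≃g T)} {r : Ray T}
    (hr : ∀ g ∈ Γ, g • r.toEnd = r.toEnd → ∃ n, ∀ u ∈ r.cone n, g u = u) :
    ContinuousAt (MulAction.stabilizer Γ) r.toEnd.toXT := by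
  refine tendsto_subgroup_iff.2 fun g => ?_
  have hc : Tendsto (Subtype.val : XT T → WithEnds T) (𝓝 r.toEnd.toXT)
    (𝓝 (WithEnds.ofEnd r.toEnd)) := continuous_subtype_val.continuousAt
  have h := Ray.eventually_smul hT hr g.2
  simp only [MulAction.mem_stabilizer_iff, smul_toXT]
  exact ⟨fun hg => (hc.eventually (h.1 hg)).mono fun y hy => Subtype.ext hy,
    fun hg => (hc.eventually (h.2 hg)).mono fun y hy hgy => hy (congrArg Subtype.val hgy)⟩

theorem Ray.continuousAt_stabilizer_ends (hT : T.IsTree) {Γ : Subgroup (T ≃g T)} {r : Ray T}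
    (hr : ∀ g ∈ Γ, g • r.toEnd = r.toEnd → ∃ n, ∀ u ∈ r.cone n, g u = u) :
    ContinuousAt (MulAction.stabilizer Γ) r.toEnd := by
  refine tendsto_subgroup_iff.2 fun g => ?_
  have hc' : Continuous (WithEnds.ofEnd : Ends T → WithEnds T) := continuous_induced_dom
  have hc : Tendsto WithEnds.ofEnd (𝓝 r.toEnd) (𝓝 (WithEnds.ofEnd r.toEnd)) := hc'.continuousAt
  have h := Ray.eventually_smul hT hr g.2
  simp only [MulAction.mem_stabilizer_iff]
  exact ⟨fun hg => (hc.eventually (h.1 hg)).mono fun y hy => ofEnd_injective hy,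
    fun hg => (hc.eventually (h.2 hg)).mono fun y hy hgy => hy (congrArg WithEnds.ofEnd hgy)⟩

theorem fixed_cone_of_continuousAt_XT (c : EdgeColouring T Ω) (hT : T.IsTree)
    (hΩ : 3 ≤ ENat.card Ω) {Γ : Subgroup (T ≃g T)} {r : Ray T}
    (hr : ContinuousAt (MulAction.stabilizer Γ) r.toEnd.toXT) {g : Γ}
    (hg : (g : T ≃g T) • r.toEnd = r.toEnd) : ∃ n, ∀ u ∈ r.cone n, (g : T ≃g T) u = u := by
  have h1 : g ∈ germStabilizer Γ r.toEnd.toXT := by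
    rw [← stabilizer_eq_germStabilizer_of_continuousAt hr]
    exact (smul_toXT Γ g _).2 hg
  rw [mem_germStabilizer, nhds_induced] at h1
  obtain ⟨n, -, hn⟩ := ((r.hasBasis_nhds hT).comap _).eventually_iff.1 h1
  exact ⟨n, fun u hu => c.fixed_of_fixed_ends hT hΩ (r.adj n)
    (fun ξ hξ => (smul_toXT Γ g ξ).1 (hn (x := ξ.toXT) hξ)) hu⟩

end PointsOfT

/-! ### Rotations without fixed ends, and discontinuity at vertices. -/

section Rotation

variable {V Ω : Type*} {T : SimpleGraph V} (c : EdgeColouring T Ω)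
  {F F' : Subgroup (Equiv.Perm Ω)}

/-- Automorphisms fixing a vertex with constant local permutations. -/
theorem exists_rotation (hT : T.IsTree) (hFF' : F ≤ F') (v : V) {f : Equiv.Perm Ω} (hf : f ∈ F) :
    ∃ g ∈ almostPrescribedStar c F F', g v = v ∧ ∀ u, c.localPerm g u = f := by
  obtain ⟨g, hg, hσ⟩ := c.exists_aut hT v v (σ := fun _ => f) fun _ _ => rfl
  exact ⟨g, ⟨⟨fun u => by rw [hσ]; exact hFF' hf, by simp [hσ, hf]⟩,
    mem_typePreserving_of_fixed hT hg⟩, hg, hσ⟩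

theorem exists_ne_one (hΩ : 3 ≤ ENat.card Ω) (htrans : MulAction.IsPretransitive F Ω) :
    ∃ f ∈ F, f ≠ 1 := by
  obtain ⟨a⟩ := nonempty_of_three_le hΩ
  obtain ⟨b, hb, -⟩ := exists_ne_ne hΩ a a
  obtain ⟨f, hf⟩ := htrans.exists_smul_eq a b
  refine ⟨f, f.2, fun h => hb ?_⟩
  rw [← hf]
  change (f : Equiv.Perm Ω) a = a
  rw [h, Equiv.Perm.one_apply]

variable (hT : T.IsTree) (hΩ : 3 ≤ ENat.card Ω) (hFF' : F ≤ F')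
  (hfree : ∀ f ∈ F, ∀ a : Ω, f a = a → f = 1) (htrans : MulAction.IsPretransitive F Ω)
include hT hΩ hFF' hfree htrans

/-- A non-trivial element of the free group `F`, used as local permutation everywhere, moves each
branch at `v` to a different one. -/
theorem exists_fixing_no_end (v : V) : ∃ g ∈ almostPrescribedStar c F F',
    g v = v ∧ (∀ a, g (c.step v a) ≠ c.step v a) ∧ ∀ ξ : Ends T, g • ξ ≠ ξ := by
  obtain ⟨f, hf, hf1⟩ := exists_ne_one hΩ htrans
  obtain ⟨g, hg, hgv, hσ⟩ := exists_rotation c hT hFF' v hf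
  have hstep : ∀ a, g (c.step v a) = c.step v (f a) := fun a => by rw [c.map_step, hgv, hσ]
  have hne : ∀ a, g (c.step v a) ≠ c.step v a := fun a h => hf1 (hfree f hf a
    (c.step_injective v ((hstep a).symm.trans h)))
  refine ⟨g, hg, hgv, hne, fun ξ hξ => ?_⟩
  obtain ⟨r, rfl⟩ := ξ.exists_ray
  obtain ⟨x, hx, hrx⟩ := r.exists_branch hT v
  obtain ⟨a, rfl⟩ := c.exists_step hx
  refine smul_ne_of_mem_addEnds (fun u hu hgu => ?_) (r.ofEnd_mem_addEnds.2 hrx)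
    (congrArg WithEnds.ofEnd hξ)
  have h1 := (map_mem_halfTree hT g).2 hu
  have h2 := g.map_adj_iff.2 (c.adj_step v a)
  rw [hgv] at h1 h2
  exact Set.disjoint_left.1 (halfTree_disjoint hT (c.adj_step v a) h2 (hne a).symm) hgu h1

/-- A half-tree containing `v` misses at most one neighbour of `v`, so the infinitely many
neighbours converge to `v`, while a rotation about `v` fixes none of them. -/
theorem not_continuousAt_vertex {v : V} (hv : WithEnds.vertex v ∈ XT T) :
    ¬ ContinuousAt (MulAction.stabilizer (almostPrescribedStar c F F'))
      (⟨.vertex v, hv⟩ : XT T) := by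
  intro hcont
  obtain ⟨g, hg, hgv, hne, -⟩ := exists_fixing_no_end c (F' := F') hT hΩ hFF' hfree htrans v
  have hinf : Infinite Ω := by
    have : Infinite (T.neighborSet v) := (hv v rfl).to_subtype
    exact Infinite.of_injective _ (c.around v).injective
  have hXT : ∀ a, WithEnds.vertex (c.step v a) ∈ XT T := by
    rintro a w hw
    injection hw with hw
    subst hw
    exact Set.infinite_coe_iff.1 (Infinite.of_injective _ (c.around (c.step v a)).symm.injective)
  have htend : Tendsto (fun a => (⟨.vertex (c.step v a), hXT a⟩ : XT T)) cofinite
      (𝓝 ⟨.vertex v, hv⟩) := by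
    rw [tendsto_subtype_rng]
    refine TopologicalSpace.tendsto_nhds_generateFrom_iff.2 ?_
    rintro _ ⟨p, q, hpq, rfl⟩ hvp
    have hvp' : v ∈ halfTree T p q := vertex_mem_addEnds.1 hvp
    refine (Set.Subsingleton.finite (s := {a | c.step v a = p}) fun a ha b hb =>
      c.step_injective v (ha.trans hb.symm)).subset fun a ha => ?_
    by_contra hap
    refine ha (vertex_mem_addEnds.2 ?_)
    by_contra h
    exact hap (eq_of_adj_of_notMem hT hpq (c.adj_step v a).symm h hvp').1
  have hstab : (⟨g, hg⟩ : almostPrescribedStar c F F') ∈ germStabilizer _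
      (⟨.vertex v, hv⟩ : XT T) := by
    rw [← stabilizer_eq_germStabilizer_of_continuousAt hcont]
    exact Subtype.ext (congrArg WithEnds.vertex hgv)
  obtain ⟨a, ha⟩ := (htend.eventually (mem_germStabilizer.1 hstab)).exists
  refine hne a ?_
  have := congrArg Subtype.val ha
  change WithEnds.vertex (g (c.step v a)) = WithEnds.vertex (c.step v a) at this
  injection this

/-- The continuity points of the stabilizer map on `X_T` are ends. -/
theorem exists_ray_of_continuousAt {x : XT T}
    (hx : ContinuousAt (MulAction.stabilizer (almostPrescribedStar c F F')) x) :
    ∃ r : Ray T, x = r.toEnd.toXT := by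
  obtain ⟨v | ξ, h⟩ := x
  · exact absurd hx (not_continuousAt_vertex c hT hΩ hFF' hfree htrans h)
  · obtain ⟨r, rfl⟩ := ξ.exists_ray
    exact ⟨r, rfl⟩

end Rotation

/-! ### Closed invariant sets of subgroups of `G(F, F')^*`. -/

section HalfTreeAction

variable {V Ω : Type*} {T : SimpleGraph V} (c : EdgeColouring T Ω)
  {F F' : Subgroup (Equiv.Perm Ω)}

theorem EdgeColouring.exists_disjoint_halfTrees (c : EdgeColouring T Ω) (hT : T.IsTree)
    (hΩ : 3 ≤ ENat.card Ω) {v w : V} (h : T.Adj v w) :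
    ∃ B : ℕ → Set V, (∀ n, B n ∈ {U | ∃ p q, T.Adj p q ∧ U = halfTree T p q}) ∧
      (∀ n, B n ⊆ halfTree T v w) ∧ Pairwise fun m n => Disjoint (B m) (B n) := by
  obtain ⟨r, hr⟩ := c.exists_ray_cone_eq hT hΩ h
  have hy : ∀ n, ∃ y, T.Adj (r.1 (n + 1)) y ∧ y ≠ r.1 n ∧ y ≠ r.1 (n + 2) := by
    intro n
    obtain ⟨x, y, hx, hy, hxr, hyr, hxy⟩ := c.exists_two_branches hΩ _ _ (r.adj n)
    by_cases hx' : x = r.1 (n + 2)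
    · exact ⟨y, hy, hyr, fun h' => hxy (hx'.trans h'.symm)⟩
    · exact ⟨x, hx, hxr, hx'⟩
  choose y hy hy1 hy2 using hy
  have hsub : ∀ n, halfTree T (r.1 (n + 1)) (y n) ⊆ r.cone n := fun n =>
    halfTree_subset hT (r.adj n) (hy n) (hy1 n)
  refine ⟨fun n => halfTree T (r.1 (n + 1)) (y n), fun n => ⟨_, _, hy n, rfl⟩, fun n => ?_, ?_⟩
  · rw [← hr]
    exact (hsub n).trans (r.cone_antitone hT (Nat.zero_le n))
  · have key : ∀ m n, m < n → Disjoint (halfTree T (r.1 (m + 1)) (y m))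
        (halfTree T (r.1 (n + 1)) (y n)) := fun m n hmn =>
      (halfTree_disjoint hT (hy m) (r.adj (m + 1)) (hy2 m)).mono_right
        ((hsub n).trans (r.cone_antitone hT hmn))
    intro m n hmn
    rcases lt_or_gt_of_ne hmn with h' | h'
    · exact key m n h'
    · exact (key n m h').symm

variable (hT : T.IsTree) (hΩ : 3 ≤ ENat.card Ω) (hFF' : F ≤ F')
  (hfree : ∀ f ∈ F, ∀ a : Ω, f a = a → f = 1) (htrans : MulAction.IsPretransitive F Ω)
  (h2trans : MulAction.IsMultiplyPretransitive F' Ω 2)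

include h2trans in
theorem exists_mem_apply {a b d e : Ω} (hab : a ≠ b) (hde : d ≠ e) :
    ∃ f ∈ F', f a = d ∧ f b = e := by
  obtain ⟨f, h1, h2⟩ := MulAction.is_two_pretransitive_iff.1 h2trans hab hde
  exact ⟨f, f.2, h1, h2⟩

include hT hΩ hFF' htrans h2trans

/-- With three colours, 2-transitivity gives an element of `F'` fixing one colour and moving
another; it is the local permutation of a rooted element. -/
theorem rist_halfTree_ne_bot {v w : V} (h : T.Adj v w) :
    rist (almostPrescribedStar c F F') (halfTree T v w) ≠ ⊥ := by
  obtain ⟨b, hb, -⟩ := exists_ne_ne hΩ (c.around w ⟨v, h.symm⟩) (c.around w ⟨v, h.symm⟩)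
  obtain ⟨d, hd, hdb⟩ := exists_ne_ne hΩ (c.around w ⟨v, h.symm⟩) b
  obtain ⟨f, hf, hfa, hfb⟩ := exists_mem_apply h2trans hb.symm hd.symm
  obtain ⟨g, hg, hgU, hgw, -⟩ := exists_rooted c hT hFF' htrans h hf hfa
  intro hbot
  have h1 : (⟨g, hg⟩ : almostPrescribedStar c F F') ∈ rist _ (halfTree T v w) :=
    mem_rist_iff.2 hgU
  rw [hbot, Subgroup.mem_bot] at h1
  have h2 : g = 1 := congrArg Subtype.val h1
  rw [h2, c.localPerm_one] at hgw
  rw [← hgw] at hfb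
  exact hdb hfb.symm

include hfree in
/-- A closed invariant set of subgroups of `G(F, F')^*` not containing the trivial subgroup
contains, for every end, a subgroup containing all elements that are trivial near the end. -/
theorem exists_fixators_le (hperf : ∀ a : Ω, Group.IsPerfect (MulAction.stabilizer F' a))
    {A : Set (Subgroup (almostPrescribedStar c F F'))} (hAn : A.Nonempty) (hA : IsClosed A)
    (hAi : ConjInvariant A) (hbot : ⊥ ∉ A) (r : Ray T) :
    ∃ L ∈ A, ∀ g : almostPrescribedStar c F F', (∃ n, ∀ u ∈ r.cone n, (g : T ≃g T) u = u) →
      g ∈ L := by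
  obtain ⟨H, hH, _, ⟨v, w, hvw, rfl⟩, hle⟩ := exists_rist_le
    (𝓤 := {U | ∃ p q, T.Adj p q ∧ U = halfTree T p q}) (A := A) (by
      rintro g _ ⟨p, q, hpq, rfl⟩ hg
      obtain ⟨v, w, hvw, hsub, hdisj⟩ :=
        exists_halfTree_disjoint hT (c.exists_two_branches hΩ) (g : T ≃g T) hpq hg
      refine ⟨_, ⟨v, w, hvw, rfl⟩, hsub, Set.disjoint_left.2 ?_⟩
      rintro _ ⟨u, hu, rfl⟩
      exact hdisj u hu) (by
      intro g hg
      obtain ⟨u, hu⟩ : ∃ u, (g : T ≃g T) u ≠ u := by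
        by_contra! hcon
        exact hg (Subtype.ext (RelIso.ext hcon))
      obtain ⟨a⟩ := nonempty_of_three_le hΩ
      exact ⟨_, ⟨_, u, (c.adj_step u a).symm, rfl⟩, u, mem_halfTree_self _ _, hu⟩) (by
      rintro _ ⟨p, q, hpq, rfl⟩
      exact commutator_rist_halfTree c hT hFF' hfree htrans hperf hpq) (by
      rintro _ ⟨p, q, hpq, rfl⟩
      exact rist_halfTree_ne_bot c hT hΩ hFF' htrans h2trans hpq) (by
      rintro _ ⟨p, q, hpq, rfl⟩ ι _
      obtain ⟨B, hB, hBs, hBd⟩ := c.exists_disjoint_halfTrees hT hΩ hpq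
      let e := Fintype.equivFin ι
      exact ⟨fun i => B (e i), fun i => hB _, fun i => hBs _, fun i j hij => hBd fun h =>
        hij (e.injective (Fin.ext h))⟩) hAn hA hAi hbot
  -- Pushing the complementary half-tree into the `n`-th cone, the conjugate of `H` comes to contain
  -- every element trivial on that cone.
  have hg : ∀ n, ∃ g ∈ almostPrescribedStar c F F', ∀ u ∈ halfTree T w v, g u ∈ r.cone n := fun n =>
    exists_contract c hT hΩ (r.adj n) hvw.symm
  choose g hg hgr using hg
  let u : Ultrafilter ℕ := hyperfilter ℕ
  have hle' : (u : Filter ℕ) ≤ atTop := by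
    rw [← Nat.cofinite_eq_atTop]
    exact hyperfilter_le_cofinite
  refine ⟨ultralimit u fun n => MulAut.conj (⟨g n, hg n⟩ : almostPrescribedStar c F F') • H,
    ultralimit_mem hA fun n => hAi _ H hH, ?_⟩
  rintro k ⟨m, hm⟩
  refine mem_ultralimit.2 ?_
  filter_upwards [hle' (eventually_ge_atTop m)] with n hn
  refine mem_conj_smul.2 (hle (mem_rist_iff.2 fun x hx => ?_))
  have h1 := hm _ (r.cone_antitone hT hn (hgr n x ((notMem_halfTree hT hvw).1 hx)))
  change (g n)⁻¹ ((k : T ≃g T) (g n x)) = x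
  rw [h1]
  exact RelIso.inv_apply_self _ _

omit hΩ hFF' htrans h2trans in
/-- A subgroup containing all elements trivial near the end of `r` and moving this end contains the
pointwise stabilizers of the edges of the ray far away. -/
theorem edge_stabilizer_le {L : Subgroup (almostPrescribedStar c F F')} {r : Ray T}
    (hL : ∀ g : almostPrescribedStar c F F', (∃ n, ∀ u ∈ r.cone n, (g : T ≃g T) u = u) → g ∈ L)
    {g : almostPrescribedStar c F F'} (hgL : g ∈ L) (hg : (g : T ≃g T) • r.toEnd ≠ r.toEnd) :
    ∃ n, ∀ m ≥ n, ∀ h : almostPrescribedStar c F F', (h : T ≃g T) (r.1 m) = r.1 m →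
      (h : T ≃g T) (r.1 (m + 1)) = r.1 (m + 1) → h ∈ L := by
  obtain ⟨n, hn⟩ := Ray.separated hT (s := r.map (g : T ≃g T)) hg
  refine ⟨n, fun m hm h h1 h2 => ?_⟩
  -- Split `h` along the edge into its part `k` in the cone and a factor trivial near the end. As
  -- `g` carries far cones out of the support of `k`, the element `g⁻¹ * k * g` is trivial near the
  -- end as well.
  obtain ⟨k, hk, hk1, hk2⟩ := exists_restrict c hT h.2.1 (r.adj m) h1 h2
  have hkL : (⟨k, hk⟩ : almostPrescribedStar c F F') ∈ L := by
    have h3 : g⁻¹ * ⟨k, hk⟩ * g ∈ L := by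
      obtain ⟨j, hj⟩ := hn.exists
      refine hL _ ⟨j, fun u hu => ?_⟩
      have h4 : (g : T ≃g T) u ∉ r.cone m := fun h' =>
        hj ((Ray.map_mem_cone_map hT (g : T ≃g T) r).2 hu) (r.cone_antitone hT hm h')
      change (g : T ≃g T)⁻¹ (k ((g : T ≃g T) u)) = u
      rw [(hk1 _ h4).1]
      exact RelIso.inv_apply_self _ _
    have h5 := mul_mem (mul_mem hgL h3) (inv_mem hgL)
    convert h5 using 1
    group
  have h6 : (⟨k, hk⟩ : almostPrescribedStar c F F')⁻¹ * h ∈ L := by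
    refine hL _ ⟨m, fun u hu => ?_⟩
    change k⁻¹ ((h : T ≃g T) u) = u
    rw [← (hk2 u hu).1]
    exact RelIso.inv_apply_self _ _
  have h7 := mul_mem hkL h6
  rwa [mul_inv_cancel_left] at h7

/-- A subgroup containing the pointwise stabilizers of two edges around `v` contains the
stabilizer of `v`. -/
theorem vertex_stabilizer_le {L : Subgroup (almostPrescribedStar c F F')} {v : V} {a b : Ω}
    (hab : a ≠ b) (ha : ∀ h : almostPrescribedStar c F F', (h : T ≃g T) v = v →
      (h : T ≃g T) (c.step v a) = c.step v a → h ∈ L)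
    (hb : ∀ h : almostPrescribedStar c F F', (h : T ≃g T) v = v →
      (h : T ≃g T) (c.step v b) = c.step v b → h ∈ L)
    {h : almostPrescribedStar c F F'} (hv : (h : T ≃g T) v = v) : h ∈ L := by
  have hroot : ∀ {d : Ω}, (∀ h : almostPrescribedStar c F F', (h : T ≃g T) v = v →
      (h : T ≃g T) (c.step v d) = c.step v d → h ∈ L) → ∀ f ∈ F', f d = d →
      ∃ k ∈ L, (k : T ≃g T) v = v ∧ c.localPerm (k : T ≃g T) v = f := by
    intro d hd f hf hfd
    have hadj := (c.adj_step v d).symm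
    obtain ⟨k, hk, hkU, hkv, -⟩ := exists_rooted c hT hFF' htrans hadj hf (by
      rw [c.around_step v d]
      exact hfd)
    have hfix := fixed_of_supported hT hadj hkU
    exact ⟨⟨k, hk⟩, hd ⟨k, hk⟩ hfix.2 hfix.1, hfix.2, hkv⟩
  -- If `h` does not take the colour `a` to `b`, an element fixing `b` corrects its effect on `a`.
  -- In the remaining case an element fixing `a` first moves `b` to a third colour.
  have hcase : ∀ h : almostPrescribedStar c F F', (h : T ≃g T) v = v →
      c.localPerm (h : T ≃g T) v a ≠ b → h ∈ L := by
    intro h hv hne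
    obtain ⟨f, hf, hfb, hfa⟩ := exists_mem_apply h2trans hab.symm hne.symm
    obtain ⟨k, hkL, hkv, hkf⟩ := hroot hb f hf hfb
    have hkinv : (k : T ≃g T)⁻¹ v = v := by
      conv_lhs => rw [← hkv]
      exact RelIso.inv_apply_self _ _
    have hmem : k⁻¹ * h ∈ L := by
      refine ha _ ?_ ?_
      · change (k : T ≃g T)⁻¹ ((h : T ≃g T) v) = v
        rw [hv, hkinv]
      · have h1 : (h : T ≃g T) (c.step v a) = (k : T ≃g T) (c.step v a) := by
          rw [c.map_step, c.map_step, hv, hkv, hkf, hfa]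
        change (k : T ≃g T)⁻¹ ((h : T ≃g T) (c.step v a)) = c.step v a
        rw [h1]
        exact RelIso.inv_apply_self _ _
    have := mul_mem hkL hmem
    rwa [mul_inv_cancel_left] at this
  by_cases hd : c.localPerm (h : T ≃g T) v a = b
  · obtain ⟨d, hda, hdb⟩ := exists_ne_ne hΩ a b
    obtain ⟨f, hf, hfa, hfb⟩ := exists_mem_apply h2trans hab hda.symm
    obtain ⟨k, hkL, hkv, hkf⟩ := hroot ha f hf hfa
    have hmem : k * h ∈ L := by
      refine hcase _ ?_ ?_
      · change (k : T ≃g T) ((h : T ≃g T) v) = v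
        rw [hv, hkv]
      · rw [Subgroup.coe_mul, c.localPerm_mul, hv, hkf, Equiv.Perm.mul_apply, hd, hfb]
        exact hdb
    exact (Subgroup.mul_mem_cancel_left _ hkL).1 hmem
  · exact hcase h hv hd

omit hΩ h2trans in
/-- The stabilizers of two adjacent vertices generate `G(F, F')^*`. -/
theorem eq_top_of_vertex_stabilizers_le {L : Subgroup (almostPrescribedStar c F F')} {v w : V}
    (hvw : T.Adj v w) (hv : ∀ h : almostPrescribedStar c F F', (h : T ≃g T) v = v → h ∈ L)
    (hw : ∀ h : almostPrescribedStar c F F', (h : T ≃g T) w = w → h ∈ L) : L = ⊤ := by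
  have hmove : ∀ {v w x : V}, T.Adj v w → T.Adj v x →
      (∀ h : almostPrescribedStar c F F', (h : T ≃g T) v = v → h ∈ L) →
      ∃ h ∈ L, (h : T ≃g T) w = x := by
    intro v w x hvw hvx hv
    obtain ⟨a, rfl⟩ := c.exists_step hvw
    obtain ⟨b, rfl⟩ := c.exists_step hvx
    obtain ⟨f, hf⟩ := htrans.exists_smul_eq a b
    obtain ⟨g, hg, hgv, hσ⟩ := exists_rotation c hT hFF' v f.2
    refine ⟨⟨g, hg⟩, hv _ hgv, ?_⟩
    change g (c.step v a) = c.step v b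
    rw [c.map_step, hgv, hσ]
    exact congrArg _ hf
  -- Rotations make each of the two stabilizers transitive on neighbours, so the orbits of `v` and
  -- `w` under `L` cover the tree.
  have horb : ∀ u, (∃ k ∈ L, (k : T ≃g T) v = u) ∨ ∃ k ∈ L, (k : T ≃g T) w = u := by
    have hadj : ∀ {v w x y : V} (k : almostPrescribedStar c F F'), T.Adj v w →
        (∀ h : almostPrescribedStar c F F', (h : T ≃g T) v = v → h ∈ L) →
        k ∈ L → (k : T ≃g T) v = x → T.Adj x y → ∃ k ∈ L, (k : T ≃g T) w = y := by
      rintro v w _ y k hvw hv hk rfl hxy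
      have h1 : T.Adj v ((k : T ≃g T)⁻¹ y) := by
        have := (k : T ≃g T)⁻¹.map_adj_iff.2 hxy
        rwa [RelIso.inv_apply_self] at this
      obtain ⟨h, hh, hhw⟩ := hmove hvw h1 hv
      refine ⟨k * h, mul_mem hk hh, ?_⟩
      change (k : T ≃g T) ((h : T ≃g T) w) = y
      rw [hhw]
      exact RelIso.apply_inv_self _ _
    refine connected_induction hT (Or.inl ⟨1, one_mem _, rfl⟩ :
      (∃ k ∈ L, (k : T ≃g T) v = v) ∨ ∃ k ∈ L, (k : T ≃g T) w = v) ?_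
    rintro x y hxy (⟨k, hk, hkx⟩ | ⟨k, hk, hkx⟩)
    · exact Or.inr (hadj k hvw hv hk hkx hxy)
    · exact Or.inl (hadj k hvw.symm hw hk hkx hxy)
  rw [Subgroup.eq_top_iff']
  intro g
  rcases horb ((g : T ≃g T) v) with ⟨k, hk, hkv⟩ | ⟨k, hk, hkw⟩
  · have h1 : k⁻¹ * g ∈ L := by
      refine hv _ ?_
      change (k : T ≃g T)⁻¹ ((g : T ≃g T) v) = v
      rw [← hkv]
      exact RelIso.inv_apply_self _ _
    have := mul_mem hk h1
    rwa [mul_inv_cancel_left] at this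
  -- Here some element would carry `v` to its neighbour `w`, of the other type.
  · refine absurd ?_ (not_adj_of_mem_typePreserving hT (k⁻¹ * g).2.2 v)
    have h1 : ((k⁻¹ * g : almostPrescribedStar c F F') : T ≃g T) v = w := by
      change (k : T ≃g T)⁻¹ ((g : T ≃g T) v) = w
      rw [← hkw]
      exact RelIso.inv_apply_self _ _
    rw [h1]
    exact hvw

theorem eq_top_of_fixators_le {L : Subgroup (almostPrescribedStar c F F')} {r : Ray T}
    (hL : ∀ g : almostPrescribedStar c F F', (∃ n, ∀ u ∈ r.cone n, (g : T ≃g T) u = u) → g ∈ L)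
    {g : almostPrescribedStar c F F'} (hgL : g ∈ L) (hg : (g : T ≃g T) • r.toEnd ≠ r.toEnd) :
    L = ⊤ := by
  obtain ⟨n, hn⟩ := edge_stabilizer_le c hT hL hgL hg
  have hvert : ∀ m ≥ n, ∀ h : almostPrescribedStar c F F',
      (h : T ≃g T) (r.1 (m + 1)) = r.1 (m + 1) → h ∈ L := by
    intro m hm h hh
    obtain ⟨a, ha⟩ := c.exists_step (r.adj m).symm
    obtain ⟨b, hb⟩ := c.exists_step (r.adj (m + 1))
    have hab : a ≠ b := by
      rintro rfl
      have := r.2.1 (ha.trans hb.symm)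
      omega
    refine vertex_stabilizer_le c hT hΩ hFF' htrans h2trans (v := r.1 (m + 1)) hab ?_ ?_ hh
    · intro k hk hk'
      rw [← ha] at hk'
      exact hn m hm k hk' hk
    · intro k hk hk'
      rw [← hb] at hk'
      exact hn (m + 1) (by omega) k hk hk'
  exact eq_top_of_vertex_stabilizers_le c hT hFF' htrans (r.adj (n + 1)) (hvert n le_rfl)
    (hvert (n + 1) (by omega))

include hfree

/-- At a continuity end the stabilizer consists of elements trivial near the end, so it lies in the
limit subgroup `L`. Since `L ≠ ⊤`, `L` cannot move the end, and the two agree. -/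
theorem stabilizerURS_subset (hperf : ∀ a : Ω, Group.IsPerfect (MulAction.stabilizer F' a))
    {A : Set (Subgroup (almostPrescribedStar c F F'))} (hAn : A.Nonempty) (hA : IsClosed A)
    (hAi : ConjInvariant A) (hbot : ⊥ ∉ A) (htop : ⊤ ∉ A) :
    stabilizerURS (almostPrescribedStar c F F') (XT T) ⊆ A := by
  refine closure_minimal ?_ hA
  rintro _ ⟨x, hx, rfl⟩
  obtain ⟨r, rfl⟩ := exists_ray_of_continuousAt c hT hΩ hFF' hfree htrans hx
  obtain ⟨L, hLA, hL⟩ :=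
    exists_fixators_le c hT hΩ hFF' hfree htrans h2trans hperf hAn hA hAi hbot r
  have hLr : L = MulAction.stabilizer _ r.toEnd.toXT := by
    refine le_antisymm (fun g hg => ?_) fun g hg =>
      hL g (fixed_cone_of_continuousAt_XT c hT hΩ hx ((smul_toXT _ g _).1 hg))
    by_contra hgr
    refine htop ?_
    rwa [← eq_top_of_fixators_le c hT hΩ hFF' htrans h2trans hL hg
      fun h => hgr ((smul_toXT _ g _).2 h)]
  rwa [← hLr]

omit h2trans in
theorem top_notMem_stabilizerURS :
    ⊤ ∉ stabilizerURS (almostPrescribedStar c F F') (XT T) := by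
  obtain ⟨v⟩ := hT.connected.nonempty
  obtain ⟨g, hg, -, -, hgξ⟩ := exists_fixing_no_end c (F' := F') hT hΩ hFF' hfree htrans v
  have hcl : stabilizerURS (almostPrescribedStar c F F') (XT T) ⊆ {H | ⟨g, hg⟩ ∈ H}ᶜ := by
    refine closure_minimal ?_ (isClopen_setOf_mem _).compl.isClosed
    rintro _ ⟨x, hx, rfl⟩ hgx
    obtain ⟨r, rfl⟩ := exists_ray_of_continuousAt c hT hΩ hFF' hfree htrans hx
    exact hgξ _ ((smul_toXT _ ⟨g, hg⟩ _).1 hgx)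
  exact fun h => hcl h (Subgroup.mem_top (⟨g, hg⟩ : almostPrescribedStar c F F'))

/-- Every end lies on one side of a given edge and is fixed by elements supported on the other side.
Two non-trivial elements thus detect all members, and this passes to the closure. -/
theorem bot_notMem_stabilizerURS :
    ⊥ ∉ stabilizerURS (almostPrescribedStar c F F') (XT T) := by
  obtain ⟨v⟩ := hT.connected.nonempty
  obtain ⟨a⟩ := nonempty_of_three_le hΩ
  have hvw := c.adj_step v a
  obtain ⟨p, hp, hp1⟩ := (Subgroup.bot_or_exists_ne_one _).resolve_left
    (rist_halfTree_ne_bot c hT hΩ hFF' htrans h2trans hvw)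
  obtain ⟨q, hq, hq1⟩ := (Subgroup.bot_or_exists_ne_one _).resolve_left
    (rist_halfTree_ne_bot c hT hΩ hFF' htrans h2trans hvw.symm)
  have hcl : stabilizerURS (almostPrescribedStar c F F') (XT T) ⊆ {H | p ∈ H} ∪ {H | q ∈ H} := by
    refine closure_minimal ?_ ((isClopen_setOf_mem p).union (isClopen_setOf_mem q)).isClosed
    rintro _ ⟨x, hx, rfl⟩
    obtain ⟨r, rfl⟩ := exists_ray_of_continuousAt c hT hΩ hFF' hfree htrans hx
    rcases r.eventually_mem_or hT hvw with h | h
    · refine Or.inr ((smul_toXT _ q _).2 (ofEnd_injective (smul_eq_of_mem_addEnds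
        (A := halfTree T v (c.step v a)) (fun u hu => mem_rist_iff.1 hq u ?_)
        (r.ofEnd_mem_addEnds.2 (r.eventually_mem_of_cone_subset hT h)))))
      rwa [notMem_halfTree hT hvw.symm]
    · refine Or.inl ((smul_toXT _ p _).2 (ofEnd_injective (smul_eq_of_mem_addEnds
        (A := halfTree T (c.step v a) v) (fun u hu => mem_rist_iff.1 hp u ?_)
        (r.ofEnd_mem_addEnds.2 (r.eventually_mem_of_cone_subset hT h)))))
      rwa [notMem_halfTree hT hvw]
  intro h
  rcases hcl h with h | h
  · exact hp1 (Subgroup.mem_bot.1 h)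
  · exact hq1 (Subgroup.mem_bot.1 h)

omit hFF' htrans h2trans in
theorem stabilizerURS_XT_nonempty :
    (stabilizerURS (almostPrescribedStar c F F') (XT T)).Nonempty := by
  obtain ⟨r, hr⟩ := c.exists_generic_ray hT hΩ hfree
  exact ⟨_, subset_closure ⟨_, Ray.continuousAt_stabilizer_XT hT fun g hg => hr g hg.1.2, rfl⟩⟩

theorem isURS_stabilizerURS_XT
    (hperf : ∀ a : Ω, Group.IsPerfect (MulAction.stabilizer F' a)) :
    IsURS (stabilizerURS (almostPrescribedStar c F F') (XT T)) where
  nonempty := stabilizerURS_XT_nonempty c hT hΩ hfree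
  isClosed := isClosed_closure
  invariant :=
    have := continuousConstSMul_XT hT (almostPrescribedStar c F F')
    conjInvariant_stabilizerURS
  minimal := fun _ hB hBn hBc hBi => subset_antisymm hB
    (stabilizerURS_subset c hT hΩ hFF' hfree htrans h2trans hperf hBn hBc hBi
      (fun h => bot_notMem_stabilizerURS c hT hΩ hFF' hfree htrans h2trans (hB h))
      fun h => top_notMem_stabilizerURS c hT hΩ hFF' hfree htrans (hB h))

/-- The uniformly recurrent subgroups of `G(F, F')^*`. -/
theorem setOf_isURS_eq (hperf : ∀ a : Ω, Group.IsPerfect (MulAction.stabilizer F' a)) :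
    {A | IsURS A} =
        {{⊥}, stabilizerURS (almostPrescribedStar c F F') (XT T), {⊤}} ∧
      {⊥} ≠ stabilizerURS (almostPrescribedStar c F F') (XT T) ∧
      stabilizerURS (almostPrescribedStar c F F') (XT T) ≠ {⊤} ∧
      ({⊥} : Set (Subgroup (almostPrescribedStar c F F'))) ≠ {⊤} := by
  have hS := isURS_stabilizerURS_XT c hT hΩ hFF' hfree htrans h2trans hperf
  have hbot := bot_notMem_stabilizerURS c hT hΩ hFF' hfree htrans h2trans
  have htop := top_notMem_stabilizerURS c (F' := F') hT hΩ hFF' hfree htrans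
  refine ⟨?_, fun h => hbot (h ▸ rfl), fun h => htop (h ▸ rfl), fun h => ?_⟩
  · ext A
    simp only [Set.mem_ofPred_eq, Set.mem_insert_iff, Set.mem_singleton_iff]
    constructor
    · intro hA
      by_cases h1 : ⊥ ∈ A
      · exact Or.inl (hA.eq_of_mem isURS_bot h1 rfl)
      by_cases h2 : ⊤ ∈ A
      · exact Or.inr (Or.inr (hA.eq_of_mem isURS_top h2 rfl))
      exact Or.inr (Or.inl (hA.minimal _ (stabilizerURS_subset c hT hΩ hFF' hfree htrans h2trans
        hperf hA.nonempty hA.isClosed hA.invariant h1 h2) hS.nonempty hS.isClosed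
        hS.invariant).symm)
    · rintro (rfl | rfl | rfl)
      · exact isURS_bot
      · exact hS
      · exact isURS_top
  · rw [Set.singleton_eq_singleton_iff] at h
    obtain ⟨H, hH⟩ := hS.nonempty
    have : H = ⊥ := le_antisymm (h ▸ le_top) bot_le
    exact hbot (this ▸ hH)

end HalfTreeAction

/-! ### Germ stabilizers of ends as a URS. -/

section GermStabilizer

variable {V Ω : Type*} {T : SimpleGraph V} (c : EdgeColouring T Ω) (hT : T.IsTree)
  (hΩ : 3 ≤ ENat.card Ω)

include c hT hΩ in
theorem mem_germStabilizer_ends {Γ : Subgroup (T ≃g T)} {r : Ray T} {g : Γ} :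
    g ∈ germStabilizer Γ r.toEnd ↔ ∃ n, ∀ u ∈ r.cone n, (g : T ≃g T) u = u := by
  rw [mem_germStabilizer, (r.hasBasis_nhds_ends hT).eventually_iff]
  constructor
  · rintro ⟨n, -, h⟩
    exact ⟨n, fun u hu => c.fixed_of_fixed_ends hT hΩ (r.adj n) (fun ξ hξ => h hξ) hu⟩
  · rintro ⟨n, h⟩
    exact ⟨n, trivial, fun ξ hξ => ofEnd_injective (smul_eq_of_mem_addEnds h hξ)⟩

variable {F F' : Subgroup (Equiv.Perm Ω)} (hfree : ∀ f ∈ F, ∀ a : Ω, f a = a → f = 1)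

include hT hfree in
/-- An automorphism with local permutations in `F` on a half-tree, and fixing a smaller half-tree
pointwise, fixes the half-tree pointwise. -/
theorem fixed_of_fixed_cone {g : T ≃g T} {v w : V}
    (hF : ∀ u ∈ halfTree T v w, c.localPerm g u ∈ F) {s : Ray T}
    (hs : ∀ᶠ k in atTop, s.cone k ⊆ halfTree T v w) (hg : ∃ k, ∀ u ∈ s.cone k, g u = u) {u : V}
    (hu : u ∈ halfTree T v w) : g u = u := by
  obtain ⟨k, hk⟩ := hg
  obtain ⟨m, hm, hkm⟩ := (hs.and (eventually_ge_atTop k)).exists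
  have hfix : ∀ u ∈ s.cone m, g u = u := fun u hu => hk u (s.cone_antitone hT hkm hu)
  -- Unlike the root `s.1 (m + 1)` of the cone, this vertex has all its neighbours in the cone, so
  -- its local permutation is trivial.
  have hmem : s.1 (m + 2) ∈ s.cone m := s.mem_cone hT (by omega)
  have h1 : c.localPerm g (s.1 (m + 2)) = 1 := by
    ext a
    refine c.localPerm_apply_self (hfix _ hmem) (hfix _ ?_)
    by_contra hcon
    have := (eq_of_adj_of_notMem hT (s.adj m) (c.adj_step _ a).symm hcon hmem).2
    have := s.2.1 this
    omega
  exact ((c.fixed_iff_of_free hfree hF hu).2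
    ((c.fixed_iff_of_free hfree hF (hm hmem)).1 ⟨hfix _ hmem, h1⟩)).1

include c hT hΩ hfree in
-- On a cone free of singularities of `g`, fixing any smaller cone forces fixing the whole, so the
-- answer is the same at all ends of the cone.
theorem eventually_mem_germStabilizer_iff (g : almostPrescribed c F F') (ξ : Ends T) :
    ∀ᶠ η in 𝓝 ξ, g ∈ germStabilizer (almostPrescribed c F F') η ↔
      g ∈ germStabilizer (almostPrescribed c F F') ξ := by
  obtain ⟨r, rfl⟩ := ξ.exists_ray
  obtain ⟨n, hn⟩ := (r.eventually_disjoint_cone hT g.2.2).exists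
  have hF : ∀ u ∈ r.cone n, c.localPerm (g : T ≃g T) u ∈ F := fun u hu => not_not.1 (hn u hu)
  have key : ∀ s : Ray T, (∀ᶠ k in atTop, s.cone k ⊆ r.cone n) →
      (g ∈ germStabilizer (almostPrescribed c F F') s.toEnd ↔
        ∀ u ∈ r.cone n, (g : T ≃g T) u = u) := by
    intro s hs
    rw [mem_germStabilizer_ends c hT hΩ]
    constructor
    · exact fun h u hu => fixed_of_fixed_cone c hT hfree hF hs h hu
    · intro h
      obtain ⟨k, hk⟩ := hs.exists
      exact ⟨k, fun u hu => h u (hk hu)⟩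
  rw [(r.hasBasis_nhds_ends hT).eventually_iff]
  refine ⟨n, trivial, fun η hη => ?_⟩
  obtain ⟨s, rfl⟩ := η.exists_ray
  rw [key s (s.eventually_cone_subset hT (r.adj n) (s.ofEnd_mem_addEnds.1 hη).frequently),
    key r ((eventually_ge_atTop n).mono fun m hm => r.cone_antitone hT hm)]

include c hT hΩ hfree in
theorem continuous_germStabilizer :
    Continuous (germStabilizer (almostPrescribed c F F') : Ends T → Subgroup _) := by
  refine continuous_subgroup_iff.2 fun g => ⟨isOpen_compl_iff.1 ?_, ?_⟩
  · refine isOpen_iff_mem_nhds.2 fun ξ hξ => ?_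
    filter_upwards [eventually_mem_germStabilizer_iff c hT hΩ hfree g ξ] with η hη h
    exact hξ (hη.1 h)
  · refine isOpen_iff_mem_nhds.2 fun ξ hξ => ?_
    filter_upwards [eventually_mem_germStabilizer_iff c hT hΩ hfree g ξ] with η hη
    exact hη.2 hξ

include c hT in
/-- The space of ends of a locally finite regular tree is compact. -/
theorem compactSpace_ends [Finite Ω] : CompactSpace (Ends T) := by
  refine ⟨isCompact_iff_ultrafilter_le_nhds.2 fun f _ => ?_⟩
  -- The ultrafilter selects one of the finitely many branches at each vertex; following the
  -- selection never backtracks and leads to the limit end.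
  have hex : ∀ v, ∃ a, ∀ᶠ ξ in f,
      WithEnds.ofEnd ξ ∈ addEnds (T := T) (halfTree T v (c.step v a)) := by
    intro v
    have h : (⋃ a, {ξ | WithEnds.ofEnd ξ ∈ addEnds (T := T) (halfTree T v (c.step v a))}) ∈ f := by
      refine mem_of_superset univ_mem fun ξ _ => ?_
      obtain ⟨s, rfl⟩ := ξ.exists_ray
      obtain ⟨x, hx, hs⟩ := s.exists_branch hT v
      obtain ⟨a, rfl⟩ := c.exists_step hx
      exact Set.mem_iUnion.2 ⟨a, s.ofEnd_mem_addEnds.2 hs⟩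
    rw [← Set.biUnion_univ, Ultrafilter.finite_biUnion_mem_iff Set.finite_univ] at h
    obtain ⟨a, -, ha⟩ := h
    exact ⟨a, ha⟩
  choose x hx using hex
  obtain ⟨v⟩ := hT.connected.nonempty
  let q : ℕ → V := fun n => Nat.rec v (fun _ u => c.step u (x u)) n
  have hq : ∀ n, q (n + 1) = c.step (q n) (x (q n)) := fun n => rfl
  have hne : ∀ n, x (q n) ≠ x (q (n + 1)) := by
    intro n h
    have h1 := hx (q n)
    have h2 := hx (q (n + 1))
    rw [← h, hq, c.step_step] at h2
    obtain ⟨ξ, hξ, hξ'⟩ := (h1.and h2).exists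
    obtain ⟨s, rfl⟩ := ξ.exists_ray
    obtain ⟨k, hk, hk'⟩ := ((s.ofEnd_mem_addEnds.1 hξ).and (s.ofEnd_mem_addEnds.1 hξ')).exists
    exact (notMem_halfTree hT (c.adj_step _ _)).2 hk' hk
  obtain ⟨r, hr0, hr⟩ := c.exists_ray hT v hne
  have hrq : ∀ n, r.1 n = q n := by
    intro n
    induction n with
    | zero => exact hr0
    | succ n ih => rw [hr, hq, ih]
  refine ⟨r.toEnd, Set.mem_univ _, ((r.hasBasis_nhds_ends hT).ge_iff).2 fun n _ => ?_⟩
  have h : r.cone n = halfTree T (q n) (c.step (q n) (x (q n))) :=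
    congrArg₂ (halfTree T) (hrq n) (hrq (n + 1))
  rw [h]
  exact hx (q n)

include c hT hΩ in
/-- Every closed set of subgroups that contains the germ stabilizer of one end and is invariant
under conjugation contains the germ stabilizers of all ends. -/
theorem range_germStabilizer_subset (hfree : ∀ f ∈ F, ∀ a : Ω, f a = a → f = 1)
    {B : Set (Subgroup (almostPrescribed c F F'))} (hB : IsClosed B) (hBi : ConjInvariant B)
    {ξ : Ends T} (hξ : germStabilizer (almostPrescribed c F F') ξ ∈ B) :
    Set.range (germStabilizer (almostPrescribed c F F') : Ends T → Subgroup _) ⊆ B := by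
  have := continuousConstSMul_ends hT (almostPrescribed c F F')
  rintro _ ⟨η, rfl⟩
  obtain ⟨s, rfl⟩ := ξ.exists_ray
  obtain ⟨r, rfl⟩ := η.exists_ray
  have hcl : IsClosed (germStabilizer (almostPrescribed c F F') ⁻¹' B : Set (Ends T)) :=
    hB.preimage (continuous_germStabilizer c hT hΩ hfree)
  change r.toEnd ∈ germStabilizer (almostPrescribed c F F') ⁻¹' B
  rw [← hcl.closure_eq, mem_closure_iff_nhds_basis (r.hasBasis_nhds_ends hT)]
  intro n _
  obtain ⟨g, hg, hgu⟩ := exists_contract c (F := F) (F' := F') hT hΩ (r.adj n) (s.adj 0)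
  refine ⟨(⟨g, hg.1⟩ : almostPrescribed c F F') • s.toEnd, ?_, ?_⟩
  · change germStabilizer _ _ ∈ B
    rw [germStabilizer_smul_eq_conj_smul]
    exact hBi _ _ hξ
  · exact ofEnd_smul_mem_addEnds g hgu (s.ofEnd_mem_addEnds_cone hT 0)

include c hT hΩ hfree in
theorem isURS_range_germStabilizer [Finite Ω] :
    IsURS (Set.range (germStabilizer (almostPrescribed c F F') : Ends T → Subgroup _)) where
  nonempty := by
    obtain ⟨r, -⟩ := c.exists_generic_ray hT hΩ hfree
    exact ⟨_, r.toEnd, rfl⟩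
  isClosed := by
    have := compactSpace_ends c hT
    exact (isCompact_range (continuous_germStabilizer c hT hΩ hfree)).isClosed
  invariant := by
    have := continuousConstSMul_ends hT (almostPrescribed c F F')
    rintro g _ ⟨ξ, rfl⟩
    exact ⟨g • ξ, germStabilizer_smul_eq_conj_smul g ξ⟩
  minimal := by
    intro B hB ⟨H, hH⟩ hBc hBi
    obtain ⟨ξ, rfl⟩ := hB hH
    exact subset_antisymm hB (range_germStabilizer_subset c hT hΩ hfree hBc hBi hH)

include hT hΩ hfree in
-- Stabilizers at continuity points are germ stabilizers, so their closure is a closed invariant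
-- subset of a URS; the generic ray makes it non-empty.
theorem stabilizerURS_ends_eq [Finite Ω] :
    stabilizerURS (almostPrescribed c F F') (Ends T) =
      Set.range (germStabilizer (almostPrescribed c F F') : Ends T → Subgroup _) := by
  have hU := isURS_range_germStabilizer c (F' := F') hT hΩ hfree
  have := continuousConstSMul_ends hT (almostPrescribed c F F')
  refine hU.minimal _ (closure_minimal ?_ hU.isClosed) ?_ isClosed_closure
    conjInvariant_stabilizerURS
  · rintro _ ⟨ξ, hξ, rfl⟩
    exact ⟨ξ, (stabilizer_eq_germStabilizer_of_continuousAt hξ).symm⟩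
  · obtain ⟨r, hr⟩ := c.exists_generic_ray hT hΩ hfree
    exact ⟨_, subset_closure ⟨_, Ray.continuousAt_stabilizer_ends hT fun g hg => hr g hg.2, rfl⟩⟩

end GermStabilizer

/-! ### Amenable subgroups and the Furstenberg URS. -/

section Amenability

variable {V Ω : Type*} {T : SimpleGraph V} (c : EdgeColouring T Ω)

/-- The ball of radius `n` around `v`. -/
def EdgeColouring.ball (v : V) : ℕ → Set V
  | 0 => {v}
  | n + 1 => EdgeColouring.ball v n ∪ ⋃ a, (fun u => c.step u a) '' EdgeColouring.ball v n

theorem EdgeColouring.ball_mono (v : V) : Monotone (c.ball v) :=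
  monotone_nat_of_le_succ fun _ => Set.subset_union_left

theorem EdgeColouring.self_mem_ball (v : V) (n : ℕ) : v ∈ c.ball v n :=
  c.ball_mono v (Nat.zero_le n) rfl

theorem EdgeColouring.finite_ball [Finite Ω] (v : V) (n : ℕ) : (c.ball v n).Finite := by
  induction n with
  | zero => exact Set.finite_singleton v
  | succ n ih => exact ih.union (Set.finite_iUnion fun a => ih.image _)

theorem EdgeColouring.exists_mem_ball (hT : T.IsTree) (v u : V) : ∃ n, u ∈ c.ball v n := by
  refine connected_induction hT (p := fun u => ∃ n, u ∈ c.ball v n) ⟨0, rfl⟩ ?_ u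
  rintro x y hxy ⟨n, hn⟩
  obtain ⟨a, rfl⟩ := c.exists_step hxy
  exact ⟨n + 1, Or.inr (Set.mem_iUnion.2 ⟨a, x, hn, rfl⟩)⟩

theorem EdgeColouring.exists_subset_ball (hT : T.IsTree) (v : V) {S : Set V} (hS : S.Finite) :
    ∃ n, S ⊆ c.ball v n := by
  choose f hf using c.exists_mem_ball hT v
  obtain ⟨N, hN⟩ := (hS.image f).bddAbove
  exact ⟨N, fun u hu => c.ball_mono v (hN ⟨u, hu, rfl⟩) (hf u)⟩

theorem EdgeColouring.map_mem_ball {g : T ≃g T} {v : V} (hg : g v = v) {n : ℕ} {u : V} :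
    g u ∈ c.ball v n ↔ u ∈ c.ball v n := by
  have key : ∀ {g : T ≃g T}, g v = v → ∀ {u}, u ∈ c.ball v n → g u ∈ c.ball v n := by
    intro g hg
    induction n with
    | zero =>
      rintro u rfl
      exact hg
    | succ n ih =>
      rintro u (hu | hu)
      · exact Or.inl (ih hu)
      · obtain ⟨a, x, hx, rfl⟩ := Set.mem_iUnion.1 hu
        refine Or.inr (Set.mem_iUnion.2 ⟨c.localPerm g x a, g x, ih hx, ?_⟩)
        exact (c.map_step g x a).symm
  refine ⟨fun h => ?_, key hg⟩
  have h1 : g⁻¹ v = v := by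
    conv_lhs => rw [← hg]
    exact RelIso.inv_apply_self g v
  have h2 := key h1 h
  rwa [RelIso.inv_apply_self] at h2

/-- The automorphisms fixing `v` and having local permutations in `F` outside the ball of radius
`n` around `v`. -/
def EdgeColouring.prescribedOutside (F : Subgroup (Equiv.Perm Ω)) (v : V) (n : ℕ) :
    Subgroup (T ≃g T) where
  carrier := {g | g v = v ∧ ∀ u ∉ c.ball v n, c.localPerm g u ∈ F}
  one_mem' := ⟨rfl, fun u _ => by rw [c.localPerm_one]; exact one_mem F⟩
  mul_mem' := by
    rintro g h ⟨hg, hg'⟩ ⟨hh, hh'⟩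
    refine ⟨?_, fun u hu => ?_⟩
    · change g (h v) = v
      rw [hh, hg]
    · rw [c.localPerm_mul]
      exact mul_mem (hg' _ fun h' => hu ((c.map_mem_ball hh).1 h')) (hh' u hu)
  inv_mem' := by
    rintro g ⟨hg, hg'⟩
    refine ⟨?_, fun u hu => ?_⟩
    · conv_lhs => rw [← hg]
      exact RelIso.inv_apply_self g v
    · rw [c.localPerm_inv]
      refine inv_mem (hg' _ fun h' => hu ?_)
      rw [← c.map_mem_ball hg, RelIso.apply_inv_self] at h'
      exact h'

/-- Outside the ball, freeness determines a local permutation from its value on one edge, known from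
the adjacent vertex. So an element is determined by its local permutations on a finite ball. -/
theorem EdgeColouring.finite_prescribedOutside [Finite Ω] (hT : T.IsTree)
    {F : Subgroup (Equiv.Perm Ω)} (hfree : ∀ f ∈ F, ∀ a : Ω, f a = a → f = 1) (v : V) (n : ℕ) :
    Finite (c.prescribedOutside F v n) := by
  have : Finite (c.ball v n) := c.finite_ball v n
  refine Finite.of_injective
    (fun (g : c.prescribedOutside F v n) (u : c.ball v n) => c.localPerm (g : T ≃g T) u)
    fun g h hgh => Subtype.ext (RelIso.ext fun u => ?_)
  refine (connected_induction hT (v := v) (p := fun u => (g : T ≃g T) u = (h : T ≃g T) u ∧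
    c.localPerm (g : T ≃g T) u = c.localPerm (h : T ≃g T) u)
    ⟨g.2.1.trans h.2.1.symm, congrFun hgh ⟨v, c.self_mem_ball v n⟩⟩ ?_ u).1
  rintro x y hxy ⟨hx, hx'⟩
  obtain ⟨a, rfl⟩ := c.exists_step hxy
  refine ⟨by rw [c.map_step, c.map_step, hx, hx'], ?_⟩
  by_cases hy : c.step x a ∈ c.ball v n
  · exact congrFun hgh ⟨_, hy⟩
  · refine (inv_mul_eq_one.1 (hfree _ (mul_mem (inv_mem (h.2.2 _ hy)) (g.2.2 _ hy)) a ?_)).symm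
    rw [Equiv.Perm.mul_apply, Equiv.Perm.inv_eq_iff_eq, c.localPerm_step, c.localPerm_step, hx']

/-- Finitely many elements trivial near the end fix a common vertex and have their singularities in
a common ball around it, so they lie in a finite group. -/
theorem isAmenable_germStabilizer [Finite Ω] (hT : T.IsTree) (hΩ : 3 ≤ ENat.card Ω)
    {F F' : Subgroup (Equiv.Perm Ω)} (hfree : ∀ f ∈ F, ∀ a : Ω, f a = a → f = 1) (ξ : Ends T) :
    IsAmenable (germStabilizer (almostPrescribed c F F') ξ) := by
  obtain ⟨r, rfl⟩ := ξ.exists_ray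
  refine isAmenable_of_locallyFinite fun s => ?_
  have hex : ∀ g : germStabilizer (almostPrescribed c F F') r.toEnd,
      ∀ᶠ n in atTop, ∀ u ∈ r.cone n, (g : T ≃g T) u = u := by
    intro g
    obtain ⟨n, hn⟩ := (mem_germStabilizer_ends c hT hΩ).1 g.2
    filter_upwards [eventually_ge_atTop n] with m hm u hu using hn u (r.cone_antitone hT hm hu)
  obtain ⟨n, hn⟩ := (s.eventually_all.2 fun g _ => hex g).exists
  obtain ⟨N, hN⟩ := c.exists_subset_ball hT (r.1 (n + 1))
    (s.finite_toSet.biUnion fun g _ => (g : almostPrescribed c F F').2.2)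
  let φ : germStabilizer (almostPrescribed c F F') r.toEnd →* (T ≃g T) :=
    (almostPrescribed c F F').subtype.comp (Subgroup.subtype _)
  have hφ : Function.Injective φ := Subtype.val_injective.comp Subtype.val_injective
  have := c.finite_prescribedOutside hT hfree (r.1 (n + 1)) N
  refine ⟨(c.prescribedOutside F (r.1 (n + 1)) N).comap φ, ?_, fun g hg => ⟨?_, fun u hu => ?_⟩⟩
  · exact Finite.of_injective
      (fun g => (⟨φ g, g.2⟩ : c.prescribedOutside F (r.1 (n + 1)) N))
      fun g h hgh => Subtype.ext (hφ (congrArg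
        (fun x : c.prescribedOutside F (r.1 (n + 1)) N => (x : T ≃g T)) hgh))
  · exact hn g hg _ (mem_halfTree_self _ _)
  · by_contra hF
    exact hu (hN (Set.mem_biUnion hg hF))

include c in
/-- An amenable group acting on the tree has a half-tree that none of its elements moves off
itself. -/
theorem exists_halfTree_meets_image (hT : T.IsTree) (hΩ : 3 ≤ ENat.card Ω) {G : Type*} [Group G]
    (hG : IsAmenable G) (φ : G →* (T ≃g T)) :
    ∃ v w, T.Adj v w ∧ ∀ g, ∃ u ∈ halfTree T v w, φ g u ∈ halfTree T v w := by
  obtain ⟨m, hm0, hm1, hadd, hinv⟩ := hG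
  obtain ⟨v⟩ := hT.connected.nonempty
  -- The mean is transported to sets of vertices along the orbit of `v`. One of three branches at
  -- `v` has mass below `1 / 2`; the complementary half-tree, of mass above `1 / 2`, must meet all
  -- its translates.
  let S : Set V → Set G := fun A => {g | φ g v ∈ A}
  have hmono : ∀ A B : Set G, Disjoint A B → m A + m B ≤ 1 := by
    intro A B h
    have h1 := hadd (A ∪ B) (A ∪ B)ᶜ disjoint_compl_right
    rw [Set.union_compl_self, hm1, hadd A B h] at h1
    linarith [hm0 (A ∪ B)ᶜ]
  have hS : ∀ A B : Set V, Disjoint A B → Disjoint (S A) (S B) := fun A B h =>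
    h.preimage (fun g => φ g v)
  have hcompl : ∀ A : Set V, m (S A) + m (S Aᶜ) = 1 := by
    intro A
    rw [← hadd _ _ (hS _ _ disjoint_compl_right), ← hm1]
    congr 1
    exact Set.union_compl_self (S A)
  obtain ⟨a, ha⟩ : ∃ a, m (S (halfTree T v (c.step v a))) < 1 / 2 := by
    by_contra! hcon
    obtain ⟨a⟩ := nonempty_of_three_le hΩ
    obtain ⟨b, hb, -⟩ := exists_ne_ne hΩ a a
    obtain ⟨d, hda, hdb⟩ := exists_ne_ne hΩ a b
    have hd : ∀ {a b : Ω}, a ≠ b → Disjoint (S (halfTree T v (c.step v a)))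
        (S (halfTree T v (c.step v b))) := fun h =>
      hS _ _ (halfTree_disjoint hT (c.adj_step _ _) (c.adj_step _ _) fun h' =>
        h (c.step_injective v h'))
    have h1 := hmono _ _ (Set.disjoint_union_left.2 ⟨hd hda.symm, hd hdb.symm⟩)
    rw [hadd _ _ (hd hb.symm)] at h1
    linarith [hcon a, hcon b, hcon d]
  refine ⟨c.step v a, v, (c.adj_step v a).symm, fun g => ?_⟩
  have hA : 1 / 2 < m (S (halfTree T (c.step v a) v)) := by
    have h := hcompl (halfTree T v (c.step v a))
    rw [compl_halfTree hT (c.adj_step v a)] at h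
    linarith
  by_contra! hcon
  have hdis : Disjoint ((fun x => g * x) '' S (halfTree T (c.step v a) v))
      (S (halfTree T (c.step v a) v)) := by
    rw [Set.disjoint_left]
    rintro _ ⟨x, hx, rfl⟩ hgx
    refine hcon _ hx ?_
    have : φ (g * x) v = φ g (φ x v) := by rw [map_mul]; rfl
    rw [← this]
    exact hgx
  have := hmono _ _ hdis
  rw [hinv] at this
  linarith

/-- Contract a half-tree that no element of `H` moves off itself into the cones of a generic ray.
Elements of the limit then cannot move its end, and genericity places them in the germ stabilizer.
-/
theorem ursLE_range_germStabilizer (hT : T.IsTree) (hΩ : 3 ≤ ENat.card Ω)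
    {F F' : Subgroup (Equiv.Perm Ω)} (hfree : ∀ f ∈ F, ∀ a : Ω, f a = a → f = 1)
    {B : Set (Subgroup (almostPrescribed c F F'))} (hB : IsAmenableURS B) :
    URSLE B (Set.range (germStabilizer (almostPrescribed c F F') : Ends T → Subgroup _)) := by
  obtain ⟨H, hH⟩ := hB.1.nonempty
  obtain ⟨v, w, hvw, hmeet⟩ := exists_halfTree_meets_image c hT hΩ (hB.2 H hH)
    ((almostPrescribed c F F').subtype.comp H.subtype)
  obtain ⟨r, hr⟩ := c.exists_generic_ray hT hΩ hfree
  choose g hg hgu using fun n =>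
    exists_contract c (F := F) (F' := F') hT hΩ (r.adj n) hvw
  let γ : ℕ → almostPrescribed c F F' := fun n => ⟨g n, (hg n).1⟩
  refine ⟨ultralimit (hyperfilter ℕ) fun n => MulAut.conj (γ n) • H,
    ultralimit_mem hB.1.isClosed fun n => hB.1.invariant _ _ hH, _, ⟨r.toEnd, rfl⟩, fun k hk => ?_⟩
  rw [mem_germStabilizer_ends c hT hΩ]
  refine hr k k.2.2 ?_
  by_contra hkr
  have hev : ∀ᶠ n in (hyperfilter ℕ : Filter ℕ), ∀ u ∈ r.cone n, (k : T ≃g T) u ∉ r.cone n :=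
    (Nat.hyperfilter_le_atTop) (Ray.eventually_disjoint_of_smul_ne hT hkr)
  obtain ⟨n, hn, hkn⟩ := (hev.and (mem_ultralimit.1 hk)).exists
  obtain ⟨u, hu, hu'⟩ := hmeet ⟨_, mem_conj_smul.1 hkn⟩
  refine hn _ (hgu n u hu) ?_
  have h := hgu n _ hu'
  change g n ((g n)⁻¹ ((k : T ≃g T) (g n u))) ∈ _ at h
  rwa [RelIso.apply_inv_self] at h

/-- The Furstenberg uniformly recurrent subgroup of `G(F, F')`. -/
theorem isFurstenbergURS_iff [Finite Ω] (hT : T.IsTree) (hΩ : 3 ≤ ENat.card Ω)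
    {F F' : Subgroup (Equiv.Perm Ω)} (hfree : ∀ f ∈ F, ∀ a : Ω, f a = a → f = 1)
    (A : Set (Subgroup (almostPrescribed c F F'))) :
    IsFurstenbergURS A ↔ A = stabilizerURS (almostPrescribed c F F') (Ends T) := by
  rw [stabilizerURS_ends_eq c hT hΩ hfree]
  have hU := isURS_range_germStabilizer c (F' := F') hT hΩ hfree
  have hUa : IsAmenableURS
      (Set.range (germStabilizer (almostPrescribed c F F') : Ends T → Subgroup _)) :=
    ⟨hU, fun _ ⟨ξ, hξ⟩ => hξ ▸ isAmenable_germStabilizer c hT hΩ hfree ξ⟩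
  constructor
  · exact fun hA => hA.1.1.antisymm hU (ursLE_range_germStabilizer c hT hΩ hfree hA.1) (hA.2 _ hUa)
  · rintro rfl
    exact ⟨hUa, fun B hB => ursLE_range_germStabilizer c hT hΩ hfree hB⟩

end Amenability

end TreeURS

theorem theorem4p30 {Ω V : Type*} [Countable Ω] (hΩ : 3 ≤ ENat.card Ω)
    (T : SimpleGraph V) (hT : T.IsTree) (c : TreeURS.EdgeColouring T Ω)
    (F F' : Subgroup (Equiv.Perm Ω)) (hFF' : F ≤ F')
    (hfree : ∀ f ∈ F, ∀ a : Ω, f a = a → f = 1) :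
    (MulAction.IsPretransitive F Ω →
      MulAction.IsMultiplyPretransitive F' Ω 2 →
      (∀ a : Ω, Group.IsPerfect (MulAction.stabilizer F' a)) →
      {A | TreeURS.IsURS A} =
          {{⊥}, TreeURS.stabilizerURS (TreeURS.almostPrescribedStar c F F') (TreeURS.XT T), {⊤}} ∧
        {⊥} ≠ TreeURS.stabilizerURS (TreeURS.almostPrescribedStar c F F') (TreeURS.XT T) ∧
        TreeURS.stabilizerURS (TreeURS.almostPrescribedStar c F F') (TreeURS.XT T) ≠ {⊤} ∧
        ({⊥} : Set (Subgroup (TreeURS.almostPrescribedStar c F F'))) ≠ {⊤}) ∧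
    (Finite Ω →
      (∀ A : Set (Subgroup (TreeURS.almostPrescribed c F F')), TreeURS.IsFurstenbergURS A ↔
        A = TreeURS.stabilizerURS (TreeURS.almostPrescribed c F F') (TreeURS.Ends T)) ∧
      TreeURS.stabilizerURS (TreeURS.almostPrescribed c F F') (TreeURS.Ends T) =
        Set.range fun ξ : TreeURS.Ends T =>
          TreeURS.germStabilizer (TreeURS.almostPrescribed c F F') ξ) := by
  refine ⟨fun htrans h2trans hperf =>
    TreeURS.setOf_isURS_eq c hT hΩ hFF' hfree htrans h2trans hperf, fun _ => ⟨fun A => ?_, ?_⟩⟩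
  · exact TreeURS.isFurstenbergURS_iff c hT hΩ hfree A
  · exact TreeURS.stabilizerURS_ends_eq c hT hΩ hfree
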